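/- **Model.** For $i=1,\dots,m$ let $y_i=\theta_i+e_i$ and $\theta_i=x_i'\beta+u_i$, where the $u_i$ are i.i.d. from a law $\mathcal G(0,A,\phi)$ with mean $0$ and variance $A$, not necessarily normal, belonging to a known parametric family indexed by $A\ge 0$ and $\phi\in\Theta\subseteq\mathbb R^k$; the $e_i\sim N(0,D_i)$ are independent of each other and of the $u_i$. The $D_i$ and the $m\times p$ matrix $X$ with rows $x_i'$ are known. Put $B_i=D_i/(A+D_i)$, $g_{1i}=AD_i/(A+D_i)$, $\tilde\theta_i=(1-B_i)y_i+B_ix_i'\beta$ and $H_i(\beta,A)=(\theta_i-\tilde\theta_i)/\sqrt{g_{1i}}$, with distribution function $F_{2i}$. Call $H_i(\beta,A)$ a pivot if $F_{2i}$ is the same for all $\beta\in\mathbb R^p$, $A\in(0,\infty)$, $\phi\in\Theta$. **Estimators.** With $\hat\beta_{\rm OLS}=(X'X)^{-1}X'y$ and $h_{ii}=x_i'(X'X)^{-1}x_i$, let $\hat A$ be the Prasad–Rao estimator $$\hat A=(m-p)^{-1}\Big[\sum_i (y_i-x_i'\hat\beta_{\rm OLS})^2-\sum_i D_i(1-h_{ii})\Big],$$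 replaced by a prescribed number $\tau_m\ge 0$ where this expression is not positive ($\tau_m=0$ being the usual truncation at zero). Let $\hat\beta$ be the weighted least squares estimator with weights $1/(\hat A+D_i)$, and let $\hat\theta_i$, $\hat g_{1i}$ and $H_i(\hat\beta,\hat A)=(\theta_i-\hat\theta_i)/\sqrt{\hat g_{1i}}$ be obtained from $\tilde\theta_i$, $g_{1i}$ and $H_i(\beta,A)$ by substituting $(\hat\beta,\hat A)$ for $(\beta,A)$. Read $H_i(\hat\beta,\hat A)$ as $0$ where $\hat A=0$. Let $\hat\phi$ be any $\Theta$-valued estimator of $\phi$. **Bootstrap.** Given $y$, draw $(\theta^*,y^*)$ from the model with parameters $(\hat\beta,\hat A,\hat\phi)$, let $\hat\beta^*,\hat A^*$ be the estimators computed from $y^*$, and let $H_i(\hat\beta^*,\hat A^*)$ be $H_i(\hat\beta,\hat A)$ computed from $(\theta^*,y^*)$. Let $q_l,q_u$ be the $\alpha/2$- and $(1-\alpha/2)$-quantiles of its conditional distribution given $y$, and put $\hat I_i^s=(\hat\theta_i+q_l\sqrt{\hat g_{1i}},\ \hat\theta_i+q_u\sqrt{\hat g_{1i}})$. **Theorem.**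 Suppose that - (R1) for all large $m$, $\operatorname{rank}X=p$, and $p$ is bounded; - (R2) $0<\inf_i D_i\le\sup_i D_i<\infty$, $A\in(0,\infty)$, and $\phi$ is in the interior of $\Theta$; - (R3) $\sup_{i\le m} h_{ii}=O(m^{-1})$; - (R4) $E|u_i|^{8+\delta}<\infty$ for some $0<\delta<1$; - (R5) $F_{2i}$ is three times continuously differentiable with bounded third derivative. Let $\alpha\in(0,1)$. Then, with a constant in $O(\cdot)$ that does not depend on $i$, for every $i=1,\dots,m$ for which $H_i(\beta,A)$ is a pivot, $$P(\theta_i\in\hat I_i^s)=P\big(\hat\theta_i+q_l\sqrt{\hat g_{1i}}\le\theta_i\le\hat\theta_i+q_u\sqrt{\hat g_{1i}}\big)=1-\alpha+O(m^{-3/2})\qquad(m\to\infty).$$ -/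

import Mathlib

open MeasureTheory ProbabilityTheory Filter Topology
open scoped Matrix

noncomputable section

namespace SmallArea

/-- The parametric family `𝒢(0, A, φ)` of random-effect laws, with parameter space
`A ∈ [0, ∞)`, `φ ∈ Θ ⊆ ℝᵏ`: a probability law on the line with finite second moment, mean `0`
and variance `A`. No shape (in particular no normality, symmetry or scaling) is prescribed. -/
structure RandomEffectFamily (k : ℕ) where
  Θ : Set (Fin k → ℝ)
  law : ℝ → (Fin k → ℝ) → Measure ℝ
  isProb : ∀ A, 0 ≤ A → ∀ φ ∈ Θ, IsProbabilityMeasure (law A φ)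
  memLp_two : ∀ A, 0 ≤ A → ∀ φ ∈ Θ, MemLp (fun u : ℝ => u) 2 (law A φ)
  mean_zero : ∀ A, 0 ≤ A → ∀ φ ∈ Θ, ∫ u, u ∂(law A φ) = 0
  variance_eq : ∀ A, 0 ≤ A → ∀ φ ∈ Θ, ∫ u, u ^ 2 ∂(law A φ) = A

/-- The known quantities for `m` areas: the `m × p` matrix `X` whose rows are the `xᵢ'`, and
the sampling variances `Dᵢ`. -/
structure Design (m p : ℕ) where
  X : Matrix (Fin m) (Fin p) ℝ
  D : Fin m → ℝ

variable {k m p : ℕ}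

namespace Design

/-- `xᵢ'β`. -/
def linPred (d : Design m p) (β : Fin p → ℝ) (i : Fin m) : ℝ := (d.X *ᵥ β) i

/-- Leverage `hᵢᵢ = xᵢ'(X'X)⁻¹xᵢ`. -/
def leverage (d : Design m p) (i : Fin m) : ℝ := (d.X * (d.Xᵀ * d.X)⁻¹ * d.Xᵀ) i i

/-- The law of `(θ, y)` under the area-level model: `θᵢ = xᵢ'β + uᵢ`, `yᵢ = θᵢ + eᵢ`, with
`uᵢ` i.i.d. from `𝒢(0, A, φ)` and, independently, `eᵢ` independent `N(0, Dᵢ)`. -/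
def modelLaw (d : Design m p) (G : RandomEffectFamily k) (β : Fin p → ℝ) (A : ℝ)
    (φ : Fin k → ℝ) : Measure ((Fin m → ℝ) × (Fin m → ℝ)) :=
  ((Measure.pi fun _ : Fin m => G.law A φ).prod
      (Measure.pi fun i : Fin m => gaussianReal 0 (d.D i).toNNReal)).map
    fun ue => (fun i => d.linPred β i + ue.1 i, fun i => d.linPred β i + ue.1 i + ue.2 i)

/-- `Bᵢ = Dᵢ / (A + Dᵢ)`. -/
def shrink (d : Design m p) (A : ℝ) (i : Fin m) : ℝ := d.D i / (A + d.D i)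

/-- `g₁ᵢ(A) = A Dᵢ / (A + Dᵢ)`. -/
def g1 (d : Design m p) (A : ℝ) (i : Fin m) : ℝ := A * d.D i / (A + d.D i)

/-- The linear predictor `(1 - Bᵢ) yᵢ + Bᵢ xᵢ'β`: the BLP of `θᵢ` at the true `(β, A)`, and the
EBLUP at the estimated ones. -/
def blp (d : Design m p) (β : Fin p → ℝ) (A : ℝ) (i : Fin m) (y : Fin m → ℝ) : ℝ :=
  (1 - d.shrink A i) * y i + d.shrink A i * d.linPred β i

/-- `Hᵢ(β, A) = (θᵢ - ((1 - Bᵢ) yᵢ + Bᵢ xᵢ'β)) / √g₁ᵢ(A)`, as a function of `ω = (θ, y)`. -/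
def H (d : Design m p) (β : Fin p → ℝ) (A : ℝ) (i : Fin m)
    (ω : (Fin m → ℝ) × (Fin m → ℝ)) : ℝ :=
  (ω.1 i - d.blp β A i ω.2) / √(d.g1 A i)

/-- `Σ = diag(A + D₁, …, A + D_m)`. -/
def Sigma (d : Design m p) (A : ℝ) : Matrix (Fin m) (Fin m) ℝ :=
  Matrix.diagonal fun i => A + d.D i

/-- Weighted least squares `β̃(A) = (X'Σ⁻¹X)⁻¹ X'Σ⁻¹ y`. -/
def betaTilde (d : Design m p) (A : ℝ) (y : Fin m → ℝ) : Fin p → ℝ :=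
  ((d.Xᵀ * (d.Sigma A)⁻¹ * d.X)⁻¹ * d.Xᵀ * (d.Sigma A)⁻¹) *ᵥ y

/-- Ordinary least squares `(X'X)⁻¹ X'y`. -/
def betaOLS (d : Design m p) (y : Fin m → ℝ) : Fin p → ℝ :=
  ((d.Xᵀ * d.X)⁻¹ * d.Xᵀ) *ᵥ y

/-- The untruncated Prasad–Rao moment estimator
`(m - p)⁻¹ [∑ᵢ (yᵢ - xᵢ'β̂_OLS)² - ∑ᵢ Dᵢ (1 - hᵢᵢ)]`. -/
def prasadRaoRaw (d : Design m p) (y : Fin m → ℝ) : ℝ :=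
  ((m : ℝ) - (p : ℝ))⁻¹ *
    (∑ i, (y i - d.linPred (d.betaOLS y) i) ^ 2 - ∑ i, d.D i * (1 - d.leverage i))

open Classical in
/-- The Prasad–Rao estimator `Â` of `A`, replaced by the value `τ` where the moment estimator is
not positive; `τ = 0` is the usual truncation `max(0, ·)`, and a small `τ > 0` keeps `Â`
positive. -/
def AHat (d : Design m p) (τ : ℝ) (y : Fin m → ℝ) : ℝ :=
  if 0 < d.prasadRaoRaw y then d.prasadRaoRaw y else τ

/-- `β̂ = β̃(Â)`. -/
def betaHat (d : Design m p) (τ : ℝ) (y : Fin m → ℝ) : Fin p → ℝ :=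
  d.betaTilde (d.AHat τ y) y

/-- `θ̂ᵢ`, the EBLUP. -/
def eblup (d : Design m p) (τ : ℝ) (i : Fin m) (y : Fin m → ℝ) : ℝ :=
  d.blp (d.betaHat τ y) (d.AHat τ y) i y

/-- `Hᵢ(β̂, Â) = (θᵢ - θ̂ᵢ) / √ĝ₁ᵢ`, all estimators being computed from the `y` in `ω = (θ, y)`. -/
def HHat (d : Design m p) (τ : ℝ) (i : Fin m) (ω : (Fin m → ℝ) × (Fin m → ℝ)) : ℝ :=
  d.H (d.betaHat τ ω.2) (d.AHat τ ω.2) i ω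

/-- `F₁ᵢ`: the distribution function of `Hᵢ(β̂, Â)` under the model with parameters
`(β, A, φ)`. -/
def F1 (d : Design m p) (G : RandomEffectFamily k) (τ : ℝ) (i : Fin m)
    (β : Fin p → ℝ) (A : ℝ) (φ : Fin k → ℝ) (q : ℝ) : ℝ :=
  (d.modelLaw G β A φ).real {ω | d.HHat τ i ω ≤ q}

/-- `F₂ᵢ`: the distribution function of `Hᵢ(β, A)` under the model with parameters
`(β, A, φ)`. -/
def F2 (d : Design m p) (G : RandomEffectFamily k) (i : Fin m)
    (β : Fin p → ℝ) (A : ℝ) (φ : Fin k → ℝ) (q : ℝ) : ℝ :=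
  (d.modelLaw G β A φ).real {ω | d.H β A i ω ≤ q}

/-- `Hᵢ(β, A)` is a pivot: its distribution is the same at all parameter values
`β ∈ ℝᵖ`, `A ∈ (0, ∞)`, `φ ∈ Θ`. -/
def IsPivot (d : Design m p) (G : RandomEffectFamily k) (i : Fin m) : Prop :=
  ∀ β β' : Fin p → ℝ, ∀ A A' : ℝ, 0 < A → 0 < A' → ∀ φ ∈ G.Θ, ∀ φ' ∈ G.Θ,
    ∀ q : ℝ, d.F2 G i β A φ q = d.F2 G i β' A' φ' q

/-- The `t`-quantile of the parametric bootstrap distribution of `Hᵢ(β̂*, Â*)` given the data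
`y`. The bootstrap sample `(θ*, y*)` is drawn from the area-level model with parameters
`(β̂(y), Â(y), φ̂(y))`, and `β̂*`, `Â*`, `θ̂ᵢ*`, `ĝ₁ᵢ*` are computed from `y*`. -/
def bootQuantile (d : Design m p) (G : RandomEffectFamily k) (τ : ℝ)
    (φHat : (Fin m → ℝ) → (Fin k → ℝ)) (i : Fin m) (t : ℝ) (y : Fin m → ℝ) : ℝ :=
  sInf {q : ℝ | t ≤ d.F1 G τ i (d.betaHat τ y) (d.AHat τ y) (φHat y) q}

/-- The endpoint `θ̂ᵢ + q √ĝ₁ᵢ`, with `q` the bootstrap `t`-quantile. -/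
def bootEndpoint (d : Design m p) (G : RandomEffectFamily k) (τ : ℝ)
    (φHat : (Fin m → ℝ) → (Fin k → ℝ)) (i : Fin m) (t : ℝ) (y : Fin m → ℝ) : ℝ :=
  d.eblup τ i y + d.bootQuantile G τ φHat i t y * √(d.g1 (d.AHat τ y) i)

end Design

end SmallArea

end

/-!
The theorem rests on the fact that a pivot forces normality. On the model,
`Hᵢ(β, A) = c₁ uᵢ - c₂ eᵢ` with `c₁ = √(Dᵢ / (A (A + Dᵢ)))` and `c₂ = √(A / (Dᵢ (A + Dᵢ)))`. As
`A → ∞` the first term tends to `0` in `L²` and the second to a standard normal variable, so the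
common law of a pivot is `N(0, 1)`; dividing characteristic functions, `𝒢(0, A, φ)` is `N(0, A)` for
every `A` and `φ` (`Design.IsPivot.law_eq_gaussianReal`). A single pivot thus turns the whole model
into the normal one, in which `φ̂` plays no role.

In the normal model everything is written in standard normal coordinates `(s, z)`: `z` drives
`y - Xβ`, and the independent `sᵢ` drives the deviation of `θᵢ` from its conditional mean
(`Design.modelLaw_apply`). The law of `Hᵢ(β̂, Â)` depends on the variance parameter `a` only, and
given `z` the event `Hᵢ(β̂, Â) ≤ q` is `sᵢ ≤ T + q (1 + ρ)`, with `T = (θ̂ᵢ - θ̃ᵢ) / √g₁ᵢ` and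
`ρ = √(ĝ₁ᵢ / g₁ᵢ) - 1`. With `V = Â - a = O(m^{-1/2})`, `T = ℓ + O(m^{-1})` with `ℓ` linear in `V`
and in the regression error, and `ρ` is expanded to second order in `V`. Taking expectations of
`Φ(T + q (1 + ρ))`, the terms `T` and `ℓ V` vanish because they are odd in `z`, and `V` because it is
centred. What remains is `Φ(q) + φ(q) (e₁ q + e₃ q³) + O(m^{-3/2})`, where `e₁, e₃` are `O(m^{-1})`
(`exists_abs_cdf_sub_edgeworth_le`). Coupling different `a` through the same `z` shows that `e₁` and
`e₃` are even Lipschitz in `a` with constants `O(m^{-1})` (`exists_abs_edgeCoef_le`).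

Inverting the expansion, the quantiles at `Â` and at `A` differ by `O(m^{-3/2} + m^{-1} |Â - A|)`
(`exists_abs_quantile_sub_le`), which has expectation `O(m^{-3/2})`. So the bootstrap quantile may be
replaced by the true one, and each endpoint has the right one-sided coverage up to `O(m^{-3/2})`
(`exists_abs_integral_cutoff_sub_le`).

The error terms are controlled uniformly over designs and areas by a calculus of random variables all
of whose moments have a given order (`UniformMoments`), and by its version for families indexed by
`a` with increments of the same order (`LipMoments`).
-/

namespace SmallArea

variable {k m p : ℕ}

/-! ### Pivots and normality -/

namespace Design

@[fun_prop]
lemma measurable_modelMap (d : Design m p) (β : Fin p → ℝ) :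
    Measurable fun ue : (Fin m → ℝ) × (Fin m → ℝ) =>
      ((fun i => d.linPred β i + ue.1 i, fun i => d.linPred β i + ue.1 i + ue.2 i) :
        (Fin m → ℝ) × (Fin m → ℝ)) := by
  fun_prop

lemma isProbabilityMeasure_modelLaw (d : Design m p) (G : RandomEffectFamily k)
    (β : Fin p → ℝ) {A : ℝ} (hA : 0 ≤ A) {φ : Fin k → ℝ} (hφ : φ ∈ G.Θ) :
    IsProbabilityMeasure (d.modelLaw G β A φ) := by
  have := G.isProb A hA φ hφ
  exact Measure.isProbabilityMeasure_map (d.measurable_modelMap β).aemeasurable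

@[fun_prop]
lemma measurable_H (d : Design m p) (β : Fin p → ℝ) (A : ℝ) (i : Fin m) :
    Measurable (d.H β A i) := by
  unfold H blp
  fun_prop

/-- On the model, `Hᵢ(β, A)` is a linear combination of the two independent errors `uᵢ`, `eᵢ`. -/
lemma H_modelMap (d : Design m p) (β : Fin p → ℝ) {A : ℝ} (hA : 0 < A) (i : Fin m)
    (hD : 0 < d.D i) (u e : Fin m → ℝ) :
    d.H β A i (fun i => d.linPred β i + u i, fun i => d.linPred β i + u i + e i) =
      √(d.D i / (A * (A + d.D i))) * u i - √(A / (d.D i * (A + d.D i))) * e i := by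
  have hAD : 0 < A + d.D i := by positivity
  have h1 : √(d.D i / (A * (A + d.D i))) = d.shrink A i / √(d.g1 A i) := by
    rw [eq_div_iff (by unfold g1; positivity), ← Real.sqrt_mul (by positivity), shrink, g1]
    rw [show d.D i / (A * (A + d.D i)) * (A * d.D i / (A + d.D i)) = (d.D i / (A + d.D i)) ^ 2 by
      field_simp]
    exact Real.sqrt_sq (by positivity)
  have h2 : √(A / (d.D i * (A + d.D i))) = (1 - d.shrink A i) / √(d.g1 A i) := by
    rw [eq_div_iff (by unfold g1; positivity), ← Real.sqrt_mul (by positivity), shrink, g1]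
    rw [show A / (d.D i * (A + d.D i)) * (A * d.D i / (A + d.D i)) =
      (1 - d.D i / (A + d.D i)) ^ 2 by field_simp; ring]
    exact Real.sqrt_sq (by rw [sub_nonneg, div_le_one hAD]; linarith)
  rw [h1, h2, H, blp]
  ring

/-- The characteristic function of the law of `Hᵢ(β, A)`. -/
lemma charFun_map_H (d : Design m p) (G : RandomEffectFamily k) (β : Fin p → ℝ) {A : ℝ}
    (hA : 0 < A) {φ : Fin k → ℝ} (hφ : φ ∈ G.Θ) (i : Fin m) (hD : 0 < d.D i) (t : ℝ) :
    charFun ((d.modelLaw G β A φ).map (d.H β A i)) t =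
      charFun (G.law A φ) (√(d.D i / (A * (A + d.D i))) * t) *
        Complex.exp (-(A / (A + d.D i) : ℝ) * t ^ 2 / 2) := by
  have := G.isProb A hA.le φ hφ
  have hAD : 0 < A + d.D i := by positivity
  set c₁ := √(d.D i / (A * (A + d.D i))) with hc₁
  set c₂ := √(A / (d.D i * (A + d.D i))) with hc₂
  rw [charFun_apply_real, integral_map (d.measurable_H β A i).aemeasurable (by fun_prop), modelLaw,
    integral_map (d.measurable_modelMap β).aemeasurable]
  swap
  · refine Measurable.aestronglyMeasurable ?_
    have := d.measurable_H β A i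
    fun_prop
  simp_rw [H_modelMap d β hA i hD]
  have h : ∀ ue : (Fin m → ℝ) × (Fin m → ℝ),
      Complex.exp (t * ((c₁ * ue.1 i - c₂ * ue.2 i : ℝ) : ℂ) * Complex.I) =
        Complex.exp ((c₁ * t : ℝ) * ue.1 i * Complex.I) *
          Complex.exp ((-(c₂ * t) : ℝ) * ue.2 i * Complex.I) := by
    intro ue
    rw [← Complex.exp_add]
    congr 1
    push_cast
    ring
  simp_rw [← hc₁, ← hc₂, h]
  rw [integral_prod_mul (fun u : Fin m → ℝ => Complex.exp ((c₁ * t : ℝ) * u i * Complex.I))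
    (fun e : Fin m → ℝ => Complex.exp ((-(c₂ * t) : ℝ) * e i * Complex.I))]
  have h₁ := (measurePreserving_eval (fun _ : Fin m => G.law A φ) i).map_eq
  have h₂ := (measurePreserving_eval (fun j : Fin m => gaussianReal 0 (d.D j).toNNReal) i).map_eq
  have e₁ : charFun (G.law A φ) (c₁ * t) =
      ∫ u : Fin m → ℝ, Complex.exp ((c₁ * t : ℝ) * u i * Complex.I)
        ∂(Measure.pi fun _ : Fin m => G.law A φ) := by
    conv_lhs => rw [← h₁]
    rw [charFun_apply_real, integral_map (measurable_pi_apply i).aemeasurable (by fun_prop)]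
  have e₂ : charFun (gaussianReal 0 (d.D i).toNNReal) (-(c₂ * t)) =
      ∫ u : Fin m → ℝ, Complex.exp ((-(c₂ * t) : ℝ) * u i * Complex.I)
        ∂(Measure.pi fun j : Fin m => gaussianReal 0 (d.D j).toNNReal) := by
    conv_lhs => rw [← h₂]
    rw [charFun_apply_real, integral_map (measurable_pi_apply i).aemeasurable (by fun_prop)]
  rw [← e₁, ← e₂, charFun_gaussianReal]
  congr 2
  have : (d.D i) * (c₂ * t) ^ 2 = A / (A + d.D i) * t ^ 2 := by
    rw [mul_pow, hc₂, Real.sq_sqrt (by positivity)]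
    field_simp
  rw [Real.coe_toNNReal _ hD.le]
  have h' := congrArg (fun x : ℝ => (x : ℂ)) this
  push_cast at h' ⊢
  linear_combination (-1/2) * h'

/-- If `Hᵢ(β, A)` is a pivot, the characteristic function of its law does not depend on the
parameters. -/
lemma IsPivot.charFun_map_H_eq {d : Design m p} {G : RandomEffectFamily k} {i : Fin m}
    (h : d.IsPivot G i) (β : Fin p → ℝ) {A A' : ℝ} (hA : 0 < A) (hA' : 0 < A')
    {φ φ' : Fin k → ℝ} (hφ : φ ∈ G.Θ) (hφ' : φ' ∈ G.Θ) :
    charFun ((d.modelLaw G β A φ).map (d.H β A i)) =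
      charFun ((d.modelLaw G β A' φ').map (d.H β A' i)) := by
  have := d.isProbabilityMeasure_modelLaw G β hA.le hφ
  have := d.isProbabilityMeasure_modelLaw G β hA'.le hφ'
  have := Measure.isProbabilityMeasure_map (μ := d.modelLaw G β A φ)
    (d.measurable_H β A i).aemeasurable
  have := Measure.isProbabilityMeasure_map (μ := d.modelLaw G β A' φ')
    (d.measurable_H β A' i).aemeasurable
  congr 1
  refine Measure.eq_of_cdf _ _ ?_
  ext q
  rw [cdf_eq_real, cdf_eq_real, map_measureReal_apply (d.measurable_H β A i) measurableSet_Iic,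
    map_measureReal_apply (d.measurable_H β A' i) measurableSet_Iic]
  exact h β β A A' hA hA' φ hφ φ' hφ' q

end Design

/-- The characteristic function of a random effect is close to `1` at arguments that are small on
the scale of its standard deviation. -/
lemma RandomEffectFamily.norm_charFun_sub_one_le (G : RandomEffectFamily k) {A : ℝ} (hA : 0 ≤ A)
    {φ : Fin k → ℝ} (hφ : φ ∈ G.Θ) (t : ℝ) :
    ‖charFun (G.law A φ) t - 1‖ ≤ |t| * √A := by
  have := G.isProb A hA φ hφ
  have hm := G.memLp_two A hA φ hφ
  have hi : Integrable (fun u : ℝ => u) (G.law A φ) := hm.integrable (by norm_num)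
  have hv := G.variance_eq A hA φ hφ
  have hint : Integrable (fun u : ℝ => Complex.exp (t * u * Complex.I)) (G.law A φ) := by
    refine Integrable.of_bound (C := 1) (by fun_prop) (ae_of_all _ fun u => ?_)
    rw [← Complex.ofReal_mul, Complex.norm_exp_ofReal_mul_I]
  have h1 : charFun (G.law A φ) t - 1 =
      ∫ u, (Complex.exp (t * u * Complex.I) - 1) ∂(G.law A φ) := by
    rw [charFun_apply_real, integral_sub hint (integrable_const _)]
    simp
  have h2 : ∫ u, |u| ∂(G.law A φ) ≤ √A := by
    refine Real.le_sqrt_of_sq_le ?_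
    have := variance_nonneg (fun u : ℝ => |u|) (G.law A φ)
    rw [variance_eq_sub (X := fun u : ℝ => |u|) hm.abs] at this
    simp only [Pi.pow_apply, sq_abs, hv] at this
    linarith
  rw [h1]
  calc ‖∫ u, (Complex.exp (t * u * Complex.I) - 1) ∂(G.law A φ)‖
      ≤ ∫ u, ‖Complex.exp (t * u * Complex.I) - 1‖ ∂(G.law A φ) := norm_integral_le_integral_norm _
    _ ≤ ∫ u, |t| * |u| ∂(G.law A φ) := by
        refine integral_mono (hint.sub (integrable_const _)).norm (hi.abs.const_mul _) fun u => ?_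
        have := Real.norm_exp_I_mul_ofReal_sub_one_le (x := t * u)
        rw [Real.norm_eq_abs, abs_mul] at this
        refine le_trans (le_of_eq ?_) this
        congr 3
        push_cast
        ring
    _ = |t| * ∫ u, |u| ∂(G.law A φ) := integral_const_mul _ _
    _ ≤ |t| * √A := by gcongr

/-- A centred law on the line with variance `0` is a point mass. -/
lemma RandomEffectFamily.law_zero (G : RandomEffectFamily k) {φ : Fin k → ℝ} (hφ : φ ∈ G.Θ) :
    G.law 0 φ = gaussianReal 0 0 := by
  have := G.isProb 0 le_rfl φ hφ
  refine Measure.ext_of_charFun ?_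
  ext t
  have := G.norm_charFun_sub_one_le le_rfl hφ t
  rw [Real.sqrt_zero, mul_zero] at this
  rw [charFun_gaussianReal, sub_eq_zero.1 (norm_le_zero_iff.1 this)]
  simp

namespace Design

/-- The common law of a pivot is standard normal: as `A → ∞` the contribution of the random effect
to `Hᵢ(β, A)` disappears. -/
lemma IsPivot.charFun_map_H {d : Design m p} {G : RandomEffectFamily k} {i : Fin m}
    (h : d.IsPivot G i) (hD : 0 < d.D i) (β : Fin p → ℝ) {A : ℝ} (hA : 0 < A)
    {φ : Fin k → ℝ} (hφ : φ ∈ G.Θ) (t : ℝ) :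
    charFun ((d.modelLaw G β A φ).map (d.H β A i)) t = Complex.exp (-(t ^ 2) / 2) := by
  have hB : Tendsto (fun a : ℝ => d.D i / (a + d.D i)) atTop (𝓝 0) :=
    tendsto_const_nhds.div_atTop (tendsto_atTop_add_const_right _ _ tendsto_id)
  have hR : Tendsto (fun a : ℝ => charFun (G.law a φ) (√(d.D i / (a * (a + d.D i))) * t))
      atTop (𝓝 1) := by
    rw [tendsto_iff_norm_sub_tendsto_zero]
    have hz : Tendsto (fun a : ℝ => √(d.D i / (a + d.D i)) * |t|) atTop (𝓝 0) := by
      simpa using hB.sqrt.mul_const |t|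
    refine squeeze_zero' (Eventually.of_forall fun a => norm_nonneg _) ?_ hz
    filter_upwards [eventually_gt_atTop 0] with a ha
    refine (G.norm_charFun_sub_one_le ha.le hφ _).trans (le_of_eq ?_)
    rw [abs_mul, abs_of_nonneg (Real.sqrt_nonneg _), mul_right_comm,
      ← Real.sqrt_mul (by positivity)]
    congr 2
    field_simp
  have hE : Tendsto (fun a : ℝ => Complex.exp (-(a / (a + d.D i) : ℝ) * t ^ 2 / 2)) atTop
      (𝓝 (Complex.exp (-((1 : ℝ) : ℂ) * t ^ 2 / 2))) := by
    have h1 : Tendsto (fun a : ℝ => a / (a + d.D i)) atTop (𝓝 1) := by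
      have := hB.const_sub 1
      rw [sub_zero] at this
      refine this.congr' ?_
      filter_upwards [eventually_gt_atTop 0] with a ha
      field_simp
      ring
    have h2 : Continuous fun x : ℝ => Complex.exp (-(x : ℂ) * t ^ 2 / 2) := by fun_prop
    exact (h2.tendsto 1).comp h1
  have hlim := hR.mul hE
  have hc : Tendsto (fun _ : ℝ => charFun ((d.modelLaw G β A φ).map (d.H β A i)) t) atTop
      (𝓝 (1 * Complex.exp (-((1 : ℝ) : ℂ) * t ^ 2 / 2))) := by
    refine hlim.congr' ?_
    filter_upwards [eventually_gt_atTop 0] with a ha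
    rw [← d.charFun_map_H G β ha hφ i hD, h.charFun_map_H_eq β hA ha hφ hφ]
  rw [tendsto_nhds_unique tendsto_const_nhds hc]
  simp

/-- **A pivot forces normal random effects.** If `Hᵢ(β, A)` is a pivot for one area of one design,
every law of the family is normal. -/
theorem IsPivot.law_eq_gaussianReal {d : Design m p} {G : RandomEffectFamily k} {i : Fin m}
    (h : d.IsPivot G i) (hD : 0 < d.D i) {A : ℝ} (hA : 0 ≤ A) {φ : Fin k → ℝ}
    (hφ : φ ∈ G.Θ) : G.law A φ = gaussianReal 0 A.toNNReal := by
  rcases hA.eq_or_lt with rfl | hA'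
  · simpa using G.law_zero hφ
  have := G.isProb A hA φ hφ
  have hAD : 0 < A + d.D i := by positivity
  refine Measure.ext_of_charFun ?_
  ext s
  set c := √(d.D i / (A * (A + d.D i))) with hc
  have hc0 : 0 < c := by positivity
  have h1 := h.charFun_map_H hD 0 hA' hφ (s / c)
  rw [d.charFun_map_H G 0 hA' hφ i hD, ← hc, mul_div_cancel₀ _ hc0.ne'] at h1
  rw [charFun_gaussianReal, Real.coe_toNNReal _ hA]
  have h2 := congrArg (· * Complex.exp ((A / (A + d.D i) : ℝ) * ((s / c : ℝ) : ℂ) ^ 2 / 2)) h1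
  simp only [mul_assoc, ← Complex.exp_add] at h2
  rw [show -((A / (A + d.D i) : ℝ) : ℂ) * ((s / c : ℝ) : ℂ) ^ 2 / 2 +
    ((A / (A + d.D i) : ℝ) : ℂ) * ((s / c : ℝ) : ℂ) ^ 2 / 2 = 0 by ring, Complex.exp_zero,
    mul_one] at h2
  rw [h2]
  congr 1
  have h3 : (A / (A + d.D i)) * (s / c) ^ 2 - (s / c) ^ 2 = - (A * s ^ 2) := by
    rw [div_pow, hc, Real.sq_sqrt (by positivity)]
    field_simp
    ring
  have h4 := congrArg (fun x : ℝ => (x : ℂ)) h3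
  push_cast at h4 ⊢
  linear_combination (1/2) * h4

end Design

/-! ### Uniform moment bounds -/

section UniformMoments

variable {ι : Type*} {Ω : ι → Type*} [∀ j, MeasurableSpace (Ω j)] {μ : ∀ j, Measure (Ω j)}

/-- The random variables `X j`, on possibly different spaces, are of order `s j > 0` in every `Lⁿ`,
uniformly in `j`: `E|X j|ⁿ ≤ Cₙ (s j)ⁿ` with `Cₙ` free of `j`. -/
structure UniformMoments (μ : ∀ j, Measure (Ω j)) (X : ∀ j, Ω j → ℝ) (s : ι → ℝ) : Prop where
  scale_pos : ∀ j, 0 < s j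
  meas : ∀ j, Measurable (X j)
  bound : ∀ n : ℕ, ∃ C : ℝ, ∀ j, Integrable (fun ω => |X j ω| ^ n) (μ j) ∧
    ∫ ω, |X j ω| ^ n ∂μ j ≤ C * s j ^ n

namespace UniformMoments

variable {X Y : ∀ j, Ω j → ℝ} {s r : ι → ℝ}

/-- The constants may be taken nonnegative. -/
lemma bound' (h : UniformMoments μ X s) (n : ℕ) : ∃ C : ℝ, 0 ≤ C ∧
    ∀ j, Integrable (fun ω => |X j ω| ^ n) (μ j) ∧ ∫ ω, |X j ω| ^ n ∂μ j ≤ C * s j ^ n := by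
  obtain ⟨C, hC⟩ := h.bound n
  refine ⟨max C 0, le_max_right _ _, fun j => ⟨(hC j).1, (hC j).2.trans ?_⟩⟩
  have := (h.scale_pos j).le
  gcongr
  exact le_max_left _ _

lemma reindex {ι' : Type*} (f : ι' → ι) (h : UniformMoments μ X s) :
    UniformMoments (fun j => μ (f j)) (fun j => X (f j)) (fun j => s (f j)) :=
  ⟨fun _ => h.scale_pos _, fun _ => h.meas _, fun n => (h.bound n).imp fun _ hC j => hC (f j)⟩

/-- Domination, with a change of scale. -/
lemma of_abs_le (h : UniformMoments μ X s) (hY : ∀ j, Measurable (Y j)) (hr : ∀ j, 0 < r j)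
    {c : ℝ} (hXY : ∀ j ω, |Y j ω| ≤ c * |X j ω|) {b : ℝ} (hsr : ∀ j, s j ≤ b * r j) :
    UniformMoments μ Y r := by
  refine ⟨hr, hY, fun n => ?_⟩
  obtain ⟨C, hC0, hC⟩ := h.bound' n
  have hle : ∀ j ω, |Y j ω| ^ n ≤ |c| ^ n * |X j ω| ^ n := fun j ω => by
    rw [← mul_pow]
    gcongr
    exact (hXY j ω).trans (by gcongr; exact le_abs_self c)
  refine ⟨|c| ^ n * C * |b| ^ n, fun j => ?_⟩
  have hi : Integrable (fun ω => |Y j ω| ^ n) (μ j) := by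
    refine ((hC j).1.const_mul (|c| ^ n)).mono' ?_ (ae_of_all _ fun ω => ?_)
    · have := hY j
      fun_prop
    · rw [Real.norm_eq_abs, abs_of_nonneg (by positivity)]
      exact hle j ω
  refine ⟨hi, ?_⟩
  calc ∫ ω, |Y j ω| ^ n ∂μ j ≤ ∫ ω, |c| ^ n * |X j ω| ^ n ∂μ j :=
        integral_mono hi ((hC j).1.const_mul _) (hle j)
    _ = |c| ^ n * ∫ ω, |X j ω| ^ n ∂μ j := integral_const_mul _ _
    _ ≤ |c| ^ n * (C * s j ^ n) := by gcongr; exact (hC j).2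
    _ ≤ |c| ^ n * (C * (|b| * r j) ^ n) := by
        have := (h.scale_pos j).le
        have := (hr j).le
        gcongr
        exact (hsr j).trans (by gcongr; exact le_abs_self b)
    _ = |c| ^ n * C * |b| ^ n * r j ^ n := by rw [mul_pow]; ring

lemma mono (h : UniformMoments μ X s) (hr : ∀ j, 0 < r j) (b : ℝ)
    (hsr : ∀ j, s j ≤ b * r j) : UniformMoments μ X r :=
  h.of_abs_le h.meas hr (c := 1) (fun j ω => by simp) hsr

lemma congr (h : UniformMoments μ X s) (hXY : ∀ j ω, Y j ω = X j ω) :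
    UniformMoments μ Y s := by
  have : Y = X := by ext j ω; exact hXY j ω
  rwa [this]

lemma abs (h : UniformMoments μ X s) : UniformMoments μ (fun j ω => |X j ω|) s :=
  h.of_abs_le (fun j => by have := h.meas j; fun_prop) h.scale_pos (c := 1) (b := 1)
    (fun j ω => by simp) (fun j => by simp)

lemma neg (h : UniformMoments μ X s) : UniformMoments μ (fun j ω => -X j ω) s :=
  h.of_abs_le (fun j => by have := h.meas j; fun_prop) h.scale_pos (c := 1) (b := 1)
    (fun j ω => by simp) (fun j => by simp)

lemma mul (hX : UniformMoments μ X s) (hY : UniformMoments μ Y r) :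
    UniformMoments μ (fun j ω => X j ω * Y j ω) (fun j => s j * r j) := by
  refine ⟨fun j => mul_pos (hX.scale_pos j) (hY.scale_pos j),
    fun j => (hX.meas j).mul (hY.meas j), fun n => ?_⟩
  obtain ⟨C, hC0, hC⟩ := hX.bound' (2 * n)
  obtain ⟨C', hC0', hC'⟩ := hY.bound' (2 * n)
  refine ⟨(C + C') / 2, fun j => ?_⟩
  have hs := hX.scale_pos j
  have hr := hY.scale_pos j
  have hle : ∀ ω, |X j ω * Y j ω| ^ n ≤ (r j ^ n / s j ^ n / 2) * |X j ω| ^ (2 * n) +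
      (s j ^ n / r j ^ n / 2) * |Y j ω| ^ (2 * n) := fun ω => by
    have h2 := two_mul_le_add_sq ((|X j ω| / s j) ^ n) ((|Y j ω| / r j) ^ n)
    have h3 := mul_le_mul_of_nonneg_left h2 (show 0 ≤ s j ^ n * r j ^ n / 2 by positivity)
    refine le_trans (le_of_eq ?_) (h3.trans (le_of_eq ?_))
    · rw [abs_mul, mul_pow, div_pow, div_pow]
      field_simp
    · rw [div_pow, div_pow, div_pow, div_pow, mul_comm 2 n, pow_mul, pow_mul]
      field_simp
  have hg : Integrable (fun ω => (r j ^ n / s j ^ n / 2) * |X j ω| ^ (2 * n) +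
      (s j ^ n / r j ^ n / 2) * |Y j ω| ^ (2 * n)) (μ j) :=
    ((hC j).1.const_mul _).add ((hC' j).1.const_mul _)
  have hi : Integrable (fun ω => |X j ω * Y j ω| ^ n) (μ j) := by
    refine hg.mono' ?_ (ae_of_all _ fun ω => ?_)
    · have := hX.meas j
      have := hY.meas j
      fun_prop
    · rw [Real.norm_eq_abs, abs_of_nonneg (by positivity)]
      exact hle ω
  refine ⟨hi, ?_⟩
  calc ∫ ω, |X j ω * Y j ω| ^ n ∂μ j ≤ _ := integral_mono hi hg hle
    _ = (r j ^ n / s j ^ n / 2) * ∫ ω, |X j ω| ^ (2 * n) ∂μ j +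
        (s j ^ n / r j ^ n / 2) * ∫ ω, |Y j ω| ^ (2 * n) ∂μ j := by
        rw [integral_add ((hC j).1.const_mul _) ((hC' j).1.const_mul _), integral_const_mul,
          integral_const_mul]
    _ ≤ (r j ^ n / s j ^ n / 2) * (C * s j ^ (2 * n)) +
        (s j ^ n / r j ^ n / 2) * (C' * r j ^ (2 * n)) := by
        gcongr
        exacts [(hC j).2, (hC' j).2]
    _ = (C + C') / 2 * (s j * r j) ^ n := by
        rw [mul_pow, two_mul, pow_add, pow_add]
        field_simp

lemma add (hX : UniformMoments μ X s) (hY : UniformMoments μ Y s) :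
    UniformMoments μ (fun j ω => X j ω + Y j ω) s := by
  refine ⟨hX.scale_pos, fun j => (hX.meas j).add (hY.meas j), fun n => ?_⟩
  obtain ⟨C, hC⟩ := hX.bound n
  obtain ⟨C', hC'⟩ := hY.bound n
  refine ⟨2 ^ (n - 1) * (C + C'), fun j => ?_⟩
  have hle : ∀ ω, |X j ω + Y j ω| ^ n ≤ 2 ^ (n - 1) * (|X j ω| ^ n + |Y j ω| ^ n) := fun ω =>
    (pow_le_pow_left₀ (abs_nonneg _) (abs_add_le _ _) n).trans
      (add_pow_le (abs_nonneg _) (abs_nonneg _) n)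
  have hg : Integrable (fun ω => (2 : ℝ) ^ (n - 1) * (|X j ω| ^ n + |Y j ω| ^ n)) (μ j) :=
    ((hC j).1.add (hC' j).1).const_mul _
  have hi : Integrable (fun ω => |X j ω + Y j ω| ^ n) (μ j) := by
    refine hg.mono' ?_ (ae_of_all _ fun ω => ?_)
    · have := hX.meas j
      have := hY.meas j
      fun_prop
    · rw [Real.norm_eq_abs, abs_of_nonneg (by positivity)]
      exact hle ω
  refine ⟨hi, ?_⟩
  calc ∫ ω, |X j ω + Y j ω| ^ n ∂μ j ≤ _ := integral_mono hi hg hle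
    _ = 2 ^ (n - 1) * (∫ ω, |X j ω| ^ n ∂μ j + ∫ ω, |Y j ω| ^ n ∂μ j) := by
        rw [integral_const_mul, integral_add (hC j).1 (hC' j).1]
    _ ≤ 2 ^ (n - 1) * (C * s j ^ n + C' * s j ^ n) := by
        gcongr
        exacts [(hC j).2, (hC' j).2]
    _ = 2 ^ (n - 1) * (C + C') * s j ^ n := by ring

lemma sub (hX : UniformMoments μ X s) (hY : UniformMoments μ Y s) :
    UniformMoments μ (fun j ω => X j ω - Y j ω) s :=
  (hX.add hY.neg).congr fun _ _ => sub_eq_add_neg _ _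

lemma const [∀ j, IsProbabilityMeasure (μ j)] {c : ι → ℝ} (hs : ∀ j, 0 < s j) (b : ℝ)
    (hc : ∀ j, |c j| ≤ b * s j) : UniformMoments μ (fun j _ => c j) s := by
  refine ⟨hs, fun j => measurable_const, fun n => ⟨b ^ n, fun j => ⟨integrable_const _, ?_⟩⟩⟩
  simp only [integral_const, probReal_univ, one_smul]
  rw [← mul_pow]
  exact pow_le_pow_left₀ (abs_nonneg _) (hc j) n

/-- The average of uniformly bounded variables is bounded with the same scale. -/
lemma average {N : ι → ℕ} (hN : ∀ j, 0 < N j) {Z : ∀ j, Fin (N j) → Ω j → ℝ}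
    (h : UniformMoments (ι := Σ j, Fin (N j)) (fun q => μ q.1) (fun q => Z q.1 q.2)
      (fun q => s q.1)) :
    UniformMoments μ (fun j ω => (∑ l, Z j l ω) / N j) s := by
  refine ⟨fun j => h.scale_pos ⟨j, ⟨0, hN j⟩⟩,
    fun j => (Finset.measurable_fun_sum _ fun l _ => h.meas ⟨j, l⟩).div_const _, fun n => ?_⟩
  rcases n with _ | n
  · obtain ⟨C, hC⟩ := h.bound 0
    refine ⟨C, fun j => ?_⟩
    simpa using hC ⟨j, ⟨0, hN j⟩⟩
  obtain ⟨C, hC⟩ := h.bound (n + 1)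
  refine ⟨C, fun j => ?_⟩
  have hNj : (0 : ℝ) < N j := by exact_mod_cast hN j
  have hle : ∀ ω, |(∑ l, Z j l ω) / N j| ^ (n + 1) ≤
      (∑ l, |Z j l ω| ^ (n + 1)) / N j := fun ω => by
    have h1 := pow_sum_div_card_le_sum_pow (s := Finset.univ) (f := fun l => |Z j l ω|)
      (fun l _ => abs_nonneg _) n
    rw [Finset.card_univ, Fintype.card_fin] at h1
    rw [abs_div, abs_of_pos hNj, div_pow]
    calc |∑ l, Z j l ω| ^ (n + 1) / (N j : ℝ) ^ (n + 1)
        ≤ (∑ l, |Z j l ω|) ^ (n + 1) / (N j : ℝ) ^ (n + 1) := by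
          gcongr
          exact Finset.abs_sum_le_sum_abs _ _
      _ = (∑ l, |Z j l ω|) ^ (n + 1) / (N j : ℝ) ^ n / N j := by rw [pow_succ (N j : ℝ), div_div]
      _ ≤ _ := by gcongr
  have hg : Integrable (fun ω => (∑ l, |Z j l ω| ^ (n + 1)) / N j) (μ j) :=
    (integrable_finsetSum _ fun l _ => (hC ⟨j, l⟩).1).div_const _
  have hi : Integrable (fun ω => |(∑ l, Z j l ω) / N j| ^ (n + 1)) (μ j) := by
    refine hg.mono' ?_ (ae_of_all _ fun ω => ?_)
    · have : ∀ l, Measurable (Z j l) := fun l => h.meas ⟨j, l⟩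
      fun_prop
    · rw [Real.norm_eq_abs, abs_of_nonneg (by positivity)]
      exact hle ω
  refine ⟨hi, ?_⟩
  calc ∫ ω, |(∑ l, Z j l ω) / N j| ^ (n + 1) ∂μ j ≤ _ := integral_mono hi hg hle
    _ = (∑ l, ∫ ω, |Z j l ω| ^ (n + 1) ∂μ j) / N j := by
        rw [integral_div, integral_finsetSum _ fun l _ => (hC ⟨j, l⟩).1]
    _ ≤ (∑ _l : Fin (N j), C * s j ^ (n + 1)) / N j := by
        gcongr with l
        exact (hC ⟨j, l⟩).2
    _ = C * s j ^ (n + 1) := by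
        rw [Finset.sum_const, Finset.card_univ, Fintype.card_fin, nsmul_eq_mul]
        field_simp

lemma integrable (h : UniformMoments μ X s) (j : ι) : Integrable (X j) (μ j) := by
  obtain ⟨C, hC⟩ := h.bound 1
  have := (hC j).1
  simp only [pow_one] at this
  exact (integrable_norm_iff (h.meas j).aestronglyMeasurable).1 this

lemma integral_abs_le (h : UniformMoments μ X s) :
    ∃ C : ℝ, 0 ≤ C ∧ ∀ j, ∫ ω, |X j ω| ∂μ j ≤ C * s j := by
  obtain ⟨C, hC0, hC⟩ := h.bound' 1
  exact ⟨C, hC0, fun j => by simpa using (hC j).2⟩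

lemma abs_integral_le (h : UniformMoments μ X s) :
    ∃ C : ℝ, 0 ≤ C ∧ ∀ j, |∫ ω, X j ω ∂μ j| ≤ C * s j := by
  obtain ⟨C, hC0, hC⟩ := h.integral_abs_le
  exact ⟨C, hC0, fun j => (abs_integral_le_integral_abs).trans (hC j)⟩

/-- Exponential moments on the scale `s` control all moments. -/
lemma of_exp (hs : ∀ j, 0 < s j) (hX : ∀ j, Measurable (X j)) {c : ℝ}
    (hpos : ∀ j, Integrable (fun ω => Real.exp (X j ω / s j)) (μ j) ∧
      ∫ ω, Real.exp (X j ω / s j) ∂μ j ≤ c)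
    (hneg : ∀ j, Integrable (fun ω => Real.exp (-(X j ω) / s j)) (μ j) ∧
      ∫ ω, Real.exp (-(X j ω) / s j) ∂μ j ≤ c) :
    UniformMoments μ X s := by
  refine ⟨hs, hX, fun n => ⟨n.factorial * (c + c), fun j => ?_⟩⟩
  have hsj := hs j
  have hle : ∀ ω, |X j ω| ^ n ≤ s j ^ n * n.factorial *
      (Real.exp (X j ω / s j) + Real.exp (-(X j ω) / s j)) := fun ω => by
    have h1 := Real.pow_div_factorial_le_exp (x := |X j ω| / s j) (by positivity) n
    rw [div_le_iff₀ (by positivity), div_pow, div_le_iff₀ (by positivity)] at h1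
    refine h1.trans ?_
    have h2 : Real.exp (|X j ω| / s j) ≤
        Real.exp (X j ω / s j) + Real.exp (-(X j ω) / s j) := by
      rcases abs_choice (X j ω) with h | h <;> rw [h] <;> linarith [Real.exp_pos (X j ω / s j),
        Real.exp_pos (-(X j ω) / s j)]
    calc Real.exp (|X j ω| / s j) * n.factorial * s j ^ n
        = s j ^ n * n.factorial * Real.exp (|X j ω| / s j) := by ring
      _ ≤ _ := by gcongr
  have hg := ((hpos j).1.add (hneg j).1).const_mul (s j ^ n * n.factorial)
  have hi : Integrable (fun ω => |X j ω| ^ n) (μ j) := by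
    refine hg.mono' ?_ (ae_of_all _ fun ω => ?_)
    · have := hX j
      fun_prop
    · rw [Real.norm_eq_abs, abs_of_nonneg (by positivity)]
      exact hle ω
  refine ⟨hi, ?_⟩
  calc ∫ ω, |X j ω| ^ n ∂μ j ≤ _ := integral_mono hi hg hle
    _ = s j ^ n * n.factorial * (∫ ω, Real.exp (X j ω / s j) ∂μ j +
        ∫ ω, Real.exp (-(X j ω) / s j) ∂μ j) := by
        rw [integral_const_mul]
        congr 1
        exact integral_add (hpos j).1 (hneg j).1
    _ ≤ s j ^ n * n.factorial * (c + c) := by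
        gcongr
        exacts [(hpos j).2, (hneg j).2]
    _ = _ := by ring

end UniformMoments

end UniformMoments

/-! ### Standard normal vectors -/

/-- The law of `m` independent standard normal variables. -/
noncomputable def stdNormal (m : ℕ) : Measure (Fin m → ℝ) :=
  Measure.pi fun _ : Fin m => gaussianReal 0 1

instance (m : ℕ) : IsProbabilityMeasure (stdNormal m) := by
  unfold stdNormal
  infer_instance

lemma integrable_exp_linear (m : ℕ) (ℓ : Fin m → ℝ) :
    Integrable (fun z : Fin m → ℝ => Real.exp (∑ l, ℓ l * z l)) (stdNormal m) := by
  simp_rw [Real.exp_sum]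
  exact Integrable.fintype_prod_dep fun l => integrable_exp_mul_gaussianReal (ℓ l)

lemma integral_exp_linear (m : ℕ) (ℓ : Fin m → ℝ) :
    ∫ z, Real.exp (∑ l, ℓ l * z l) ∂stdNormal m = Real.exp ((∑ l, ℓ l ^ 2) / 2) := by
  simp_rw [Real.exp_sum]
  rw [stdNormal, integral_fintype_prod_eq_prod (fun l x => Real.exp (ℓ l * x)), Finset.sum_div,
    Real.exp_sum]
  refine Finset.prod_congr rfl fun l _ => ?_
  have := congrFun (mgf_id_gaussianReal (μ := 0) (v := 1)) (ℓ l)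
  simpa [mgf] using this

/-- Linear forms in standard normal variables have all moments on the scale of the Euclidean norm
of their coefficients. -/
lemma UniformMoments.linear {ι : Type*} {N : ι → ℕ} {ℓ : ∀ j, Fin (N j) → ℝ} {s : ι → ℝ}
    (hs : ∀ j, 0 < s j) (hℓ : ∀ j, ∑ l, ℓ j l ^ 2 ≤ s j ^ 2) :
    UniformMoments (fun j => stdNormal (N j)) (fun j z => ∑ l, ℓ j l * z l) s := by
  have key : ∀ (j : ι) (ε : ℝ), ε ^ 2 = 1 →
      Integrable (fun z : Fin (N j) → ℝ => Real.exp (ε * (∑ l, ℓ j l * z l) / s j))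
        (stdNormal (N j)) ∧
      ∫ z, Real.exp (ε * (∑ l, ℓ j l * z l) / s j) ∂stdNormal (N j) ≤ Real.exp (1 / 2) := by
    intro j ε hε
    have h0 : ∀ z : Fin (N j) → ℝ, ε * (∑ l, ℓ j l * z l) / s j =
        ∑ l, (ε * ℓ j l / s j) * z l := fun z => by
      rw [Finset.mul_sum, Finset.sum_div]
      refine Finset.sum_congr rfl fun l _ => by ring
    simp_rw [h0]
    refine ⟨integrable_exp_linear _ _, ?_⟩
    rw [integral_exp_linear]
    gcongr
    simp_rw [div_pow, mul_pow, hε, one_mul]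
    rw [← Finset.sum_div, div_le_one (pow_pos (hs j) 2)]
    exact hℓ j
  refine .of_exp hs (fun j => by fun_prop) (c := Real.exp (1 / 2)) (fun j => ?_) fun j => ?_
  · simpa using key j 1 (by norm_num)
  · simpa using key j (-1) (by norm_num)

lemma one_sub_ge_exp {x : ℝ} (hx : |x| ≤ 1 / 2) : Real.exp (-x - x ^ 2) ≤ 1 - x := by
  obtain ⟨h1, h2⟩ := abs_le.1 hx
  have h3 : 0 < 1 - x := by linarith
  rw [show -x - x ^ 2 = -(x + x ^ 2) by ring, Real.exp_neg, inv_le_comm₀ (Real.exp_pos _) h3,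
    inv_le_iff_one_le_mul₀ h3]
  rcases le_total 0 x with h | h
  · have := Real.quadratic_le_exp_of_nonneg (x := x + x ^ 2) (by positivity)
    nlinarith [mul_le_mul_of_nonneg_right this h3.le, mul_nonneg h h, mul_nonneg h (mul_nonneg h h),
      mul_nonneg (mul_nonneg h h) (sub_nonneg.2 h2),
      mul_nonneg (mul_nonneg h (mul_nonneg h h)) (sub_nonneg.2 h2)]
  · have := Real.add_one_le_exp (x + x ^ 2)
    nlinarith [mul_le_mul_of_nonneg_right this h3.le, mul_nonneg_of_nonpos_of_nonpos h h]

/-- `z² - 1` is sub-exponential. -/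
lemma exp_sq_sub_one_gaussian {t : ℝ} (ht : |t| ≤ 1 / 4) :
    Integrable (fun x : ℝ => Real.exp (t * (x ^ 2 - 1))) (gaussianReal 0 1) ∧
      ∫ x, Real.exp (t * (x ^ 2 - 1)) ∂gaussianReal 0 1 ≤ Real.exp (2 * t ^ 2) := by
  have hb : 0 < 1 / 2 - t := by linarith [(abs_le.1 ht).2]
  have hpdf : ∀ x : ℝ, gaussianPDFReal 0 1 x * Real.exp (t * (x ^ 2 - 1)) =
      (Real.exp (-t) * (√(2 * Real.pi))⁻¹) * Real.exp (-(1 / 2 - t) * x ^ 2) := fun x => by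
    rw [gaussianPDFReal]
    simp only [NNReal.coe_one, mul_one, sub_zero]
    rw [mul_assoc, ← Real.exp_add, mul_comm (Real.exp (-t)), mul_assoc, ← Real.exp_add]
    congr 2
    ring
  constructor
  · rw [gaussianReal_of_var_ne_zero _ one_ne_zero, integrable_withDensity_iff_integrable_smul'
      (measurable_gaussianPDF 0 1) (ae_of_all _ fun x => gaussianPDF_lt_top)]
    simp_rw [toReal_gaussianPDF, smul_eq_mul, hpdf]
    exact (integrable_exp_neg_mul_sq hb).const_mul _
  · rw [integral_gaussianReal_eq_integral_smul one_ne_zero]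
    simp_rw [smul_eq_mul, hpdf]
    rw [integral_const_mul, integral_gaussian]
    have h1 : 0 < 1 - 2 * t := by linarith
    have h2 : √(Real.pi / (1 / 2 - t)) = √(2 * Real.pi) / √(1 - 2 * t) := by
      rw [← Real.sqrt_div (by positivity)]
      congr 1
      field_simp
    rw [h2]
    have h3 : √(2 * Real.pi) ≠ 0 := by positivity
    have h4 : Real.exp (-t - 2 * t ^ 2) ≤ √(1 - 2 * t) := by
      refine Real.le_sqrt_of_sq_le ?_
      have := one_sub_ge_exp (x := 2 * t) (by rw [abs_mul, abs_two]; linarith)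
      rw [← Real.exp_nat_mul]
      refine le_trans (le_of_eq ?_) this
      congr 1
      push_cast
      ring
    calc Real.exp (-t) * (√(2 * Real.pi))⁻¹ * (√(2 * Real.pi) / √(1 - 2 * t))
        = Real.exp (-t) / √(1 - 2 * t) := by field_simp
      _ ≤ Real.exp (-t) / Real.exp (-t - 2 * t ^ 2) := by gcongr
      _ = Real.exp (2 * t ^ 2) := by rw [← Real.exp_sub]; congr 1; ring

/-- Sums of `N` independent bounded multiples of `z² - 1` are of order `√N`. -/
lemma UniformMoments.centered_squares {ι : Type*} {N : ι → ℕ} (hN : ∀ j, 0 < N j)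
    {c : ∀ j, Fin (N j) → ℝ} {b : ℝ} (hc : ∀ j l, |c j l| ≤ b) :
    UniformMoments (fun j => stdNormal (N j)) (fun j z => ∑ l, c j l * (z l ^ 2 - 1))
      (fun j => √(N j)) := by
  -- The scale has to be positive, and large enough for all exponents to be at most `1 / 4`.
  set b' := max b 1 with hb'
  have hb1 : 1 ≤ b' := le_max_right _ _
  have hN' : ∀ j, (0 : ℝ) < N j := fun j => by exact_mod_cast hN j
  have key : ∀ (j : ι) (ε : ℝ), |ε| = 1 →
      Integrable (fun z : Fin (N j) → ℝ =>
        Real.exp (ε * (∑ l, c j l * (z l ^ 2 - 1)) / (4 * b' * √(N j)))) (stdNormal (N j)) ∧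
      ∫ z, Real.exp (ε * (∑ l, c j l * (z l ^ 2 - 1)) / (4 * b' * √(N j))) ∂stdNormal (N j)
        ≤ Real.exp 1 := by
    intro j ε hε
    have hs : 1 ≤ √(N j : ℝ) := by
      rw [Real.one_le_sqrt]
      exact_mod_cast hN j
    set t : Fin (N j) → ℝ := fun l => ε * c j l / (4 * b' * √(N j)) with ht
    have h0 : ∀ z : Fin (N j) → ℝ, ε * (∑ l, c j l * (z l ^ 2 - 1)) / (4 * b' * √(N j)) =
        ∑ l, t l * (z l ^ 2 - 1) := fun z => by
      rw [Finset.mul_sum, Finset.sum_div]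
      refine Finset.sum_congr rfl fun l _ => by rw [ht]; ring
    have htl : ∀ l, |t l| ≤ 1 / 4 * (1 / √(N j)) := fun l => by
      rw [ht]
      simp only
      rw [abs_div, abs_mul, hε, one_mul, abs_of_pos (show 0 < 4 * b' * √(N j) by positivity),
        div_le_iff₀ (by positivity)]
      refine ((hc j l).trans (le_max_left b 1)).trans (le_of_eq ?_)
      rw [← hb']
      field_simp
    have htl' : ∀ l, |t l| ≤ 1 / 4 := fun l => (htl l).trans (by
      have : 1 / √(N j : ℝ) ≤ 1 := by rw [div_le_one (by positivity)]; exact hs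
      linarith)
    simp_rw [h0, Real.exp_sum]
    refine ⟨Integrable.fintype_prod_dep fun l => (exp_sq_sub_one_gaussian (htl' l)).1, ?_⟩
    rw [stdNormal, integral_fintype_prod_eq_prod (fun l x => Real.exp (t l * (x ^ 2 - 1)))]
    calc ∏ l, ∫ x, Real.exp (t l * (x ^ 2 - 1)) ∂gaussianReal 0 1
        ≤ ∏ _l : Fin (N j), Real.exp (1 / N j) := by
          refine Finset.prod_le_prod (fun l _ => integral_nonneg fun x => (Real.exp_pos _).le)
            fun l _ => ((exp_sq_sub_one_gaussian (htl' l)).2.trans (Real.exp_le_exp.2 ?_))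
          have h2 := pow_le_pow_left₀ (abs_nonneg _) (htl l) 2
          rw [sq_abs, mul_pow, div_pow 1 (√(N j : ℝ)), Real.sq_sqrt (hN' j).le] at h2
          have : 0 < 1 / (N j : ℝ) := by have := hN' j; positivity
          linarith
      _ = Real.exp 1 := by
          rw [Finset.prod_const, Finset.card_univ, Fintype.card_fin, ← Real.exp_nat_mul]
          congr 1
          have := (hN' j).ne'
          field_simp
  have hpos : ∀ j, 0 < 4 * b' * √(N j : ℝ) := fun j => by
    have := hN' j
    positivity
  have main : UniformMoments (fun j => stdNormal (N j)) (fun j z => ∑ l, c j l * (z l ^ 2 - 1))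
      (fun j => 4 * b' * √(N j)) := by
    refine .of_exp hpos (fun j => by fun_prop) (c := Real.exp 1) (fun j => ?_) fun j => ?_
    · simpa using key j 1 (by norm_num)
    · simpa using key j (-1) (by norm_num)
  exact main.mono (fun j => by have := hN' j; positivity) (4 * b') fun j => le_rfl

lemma map_neg_stdNormal (m : ℕ) : (stdNormal m).map (fun z => -z) = stdNormal m := by
  have := Measure.pi_map_pi (μ := fun _ : Fin m => gaussianReal 0 1)
    (f := fun _ x => -x) (fun i => by fun_prop)
  simp only [gaussianReal_map_neg, neg_zero] at this
  exact this

/-- Odd functions of standard normal vectors have mean zero. -/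
lemma integral_stdNormal_of_odd {m : ℕ} {f : (Fin m → ℝ) → ℝ} (hf : ∀ z, f (-z) = -f z) :
    ∫ z, f z ∂stdNormal m = 0 := by
  have he : MeasurableEmbedding fun z : Fin m → ℝ => -z := (MeasurableEquiv.neg _).measurableEmbedding
  have h1 : ∫ z, f z ∂stdNormal m = ∫ z, f (-z) ∂stdNormal m := by
    conv_lhs => rw [← map_neg_stdNormal m]
    exact he.integral_map f
  simp_rw [hf] at h1
  rw [integral_neg] at h1
  linarith

lemma integral_linear_sq_stdNormal {m : ℕ} (c : Fin m → ℝ) :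
    ∫ z, (∑ l, c l * z l) ^ 2 ∂stdNormal m = ∑ l, c l ^ 2 := by
  have h1 : ∫ z, (∑ l, c l * z l) ∂stdNormal m = 0 :=
    integral_stdNormal_of_odd fun z => by simp [Finset.sum_neg_distrib]
  have h2 := variance_sum_pi (μ := fun _ : Fin m => gaussianReal 0 1)
    (X := fun l x => c l * x) fun l => (memLp_id_gaussianReal' 2 (by simp)).const_mul (c l)
  have h3 : (∑ l, fun ω : Fin m → ℝ => c l * ω l) = fun ω => ∑ l, c l * ω l := by
    ext ω
    simp
  rw [h3] at h2
  change variance _ (stdNormal m) = _ at h2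
  rw [variance_of_integral_eq_zero (Measurable.aemeasurable (by fun_prop)) h1] at h2
  refine h2.trans (Finset.sum_congr rfl fun l _ => ?_)
  rw [variance_const_mul, variance_fun_id_gaussianReal]
  simp

lemma integral_sq_stdNormal {m : ℕ} (l : Fin m) : ∫ z, z l ^ 2 ∂stdNormal m = 1 := by
  have := integral_linear_sq_stdNormal (Pi.single l (1 : ℝ))
  simpa [Pi.single_apply, ite_pow] using this

/-! ### Least squares projections -/

namespace Design

/-- Bounds under which all estimates below are uniform: they hold for all large `m` when the design
has full rank, a bounded number of covariates, sampling variances in `[lo, hi]` and leverages of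
order `1 / m`. The condition `2 * p ≤ m` keeps `m - p` of order `m`. -/
structure Regular (d : Design m p) (lo hi K : ℝ) : Prop where
  lo_pos : 0 < lo
  m_pos : 0 < m
  injective : Function.Injective d.X.mulVec
  two_mul_le : 2 * p ≤ m
  lo_le : ∀ j, lo ≤ d.D j
  le_hi : ∀ j, d.D j ≤ hi
  leverage_le : ∀ j, d.leverage j ≤ K / m

/-- The weights `1 / (a + Dⱼ)`. -/
noncomputable def weight (d : Design m p) (a : ℝ) : Fin m → ℝ := fun j => (a + d.D j)⁻¹

/-- The weighted least squares projection onto the column space of `X`, with weights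
`1 / (a + Dⱼ)`. -/
noncomputable def hat (d : Design m p) (a : ℝ) : Matrix (Fin m) (Fin m) ℝ :=
  d.X * (d.Xᵀ * Matrix.diagonal (d.weight a) * d.X)⁻¹ * d.Xᵀ * Matrix.diagonal (d.weight a)

/-- The orthogonal projection onto the column space of `X`. -/
noncomputable def proj (d : Design m p) : Matrix (Fin m) (Fin m) ℝ := d.X * (d.Xᵀ * d.X)⁻¹ * d.Xᵀ

lemma inv_Sigma (d : Design m p) {a : ℝ} (h : ∀ j, 0 < a + d.D j) :
    (d.Sigma a)⁻¹ = Matrix.diagonal (d.weight a) := by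
  refine Matrix.inv_eq_right_inv ?_
  rw [Sigma, Matrix.diagonal_mul_diagonal, ← Matrix.diagonal_one]
  congr 1
  ext j
  exact mul_inv_cancel₀ (h j).ne'

lemma linPred_betaTilde (d : Design m p) {a : ℝ} (h : ∀ j, 0 < a + d.D j) (y : Fin m → ℝ)
    (i : Fin m) : d.linPred (d.betaTilde a y) i = (d.hat a *ᵥ y) i := by
  rw [linPred, betaTilde, inv_Sigma d h, Matrix.mulVec_mulVec, hat]
  simp only [Matrix.mul_assoc]

lemma linPred_betaOLS (d : Design m p) (y : Fin m → ℝ) (i : Fin m) :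
    d.linPred (d.betaOLS y) i = (d.proj *ᵥ y) i := by
  rw [linPred, betaOLS, Matrix.mulVec_mulVec, proj]
  simp only [Matrix.mul_assoc]

lemma isUnit_gram (d : Design m p) (hinj : Function.Injective d.X.mulVec) {w : Fin m → ℝ}
    (hw : ∀ j, 0 < w j) : IsUnit (d.Xᵀ * Matrix.diagonal w * d.X).det := by
  have h := (Matrix.posDef_diagonal_iff.2 hw).conjTranspose_mul_mul_same hinj
  rw [Matrix.conjTranspose_eq_transpose_of_trivial] at h
  exact (Matrix.isUnit_iff_isUnit_det _).1 h.isUnit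

namespace Regular

variable {d : Design m p} {lo hi K : ℝ}

lemma add_pos (h : d.Regular lo hi K) {a : ℝ} (ha : 0 ≤ a) (j : Fin m) : 0 < a + d.D j := by
  linarith [h.lo_pos, h.lo_le j]

lemma D_pos (h : d.Regular lo hi K) (j : Fin m) : 0 < d.D j := h.lo_pos.trans_le (h.lo_le j)

lemma weight_pos (h : d.Regular lo hi K) {a : ℝ} (ha : 0 ≤ a) (j : Fin m) : 0 < d.weight a j :=
  inv_pos.2 (h.add_pos ha j)

lemma weight_le (h : d.Regular lo hi K) {a : ℝ} (ha : 0 ≤ a) (j : Fin m) :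
    d.weight a j ≤ lo⁻¹ :=
  inv_anti₀ h.lo_pos (by linarith [h.lo_le j])

lemma hi_pos (h : d.Regular lo hi K) : 0 < hi :=
  (h.D_pos ⟨0, h.m_pos⟩).trans_le (h.le_hi _)

lemma hat_mul_X (h : d.Regular lo hi K) {a : ℝ} (ha : 0 ≤ a) : d.hat a * d.X = d.X := by
  have := d.isUnit_gram h.injective (h.weight_pos ha)
  rw [hat]
  calc d.X * (d.Xᵀ * Matrix.diagonal (d.weight a) * d.X)⁻¹ * d.Xᵀ *
        Matrix.diagonal (d.weight a) * d.X
      = d.X * ((d.Xᵀ * Matrix.diagonal (d.weight a) * d.X)⁻¹ *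
          (d.Xᵀ * Matrix.diagonal (d.weight a) * d.X)) := by simp only [Matrix.mul_assoc]
    _ = d.X := by rw [Matrix.nonsing_inv_mul _ this, Matrix.mul_one]

lemma isUnit_gram_one (h : d.Regular lo hi K) : IsUnit (d.Xᵀ * d.X).det := by
  have := d.isUnit_gram h.injective (w := fun _ => 1) (fun _ => one_pos)
  rwa [Matrix.diagonal_one, Matrix.mul_one] at this

lemma proj_mul_X (h : d.Regular lo hi K) : d.proj * d.X = d.X := by
  rw [proj, Matrix.mul_assoc, Matrix.mul_assoc, Matrix.nonsing_inv_mul _ h.isUnit_gram_one,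
    Matrix.mul_one]

lemma hat_mulVec_X (h : d.Regular lo hi K) {a : ℝ} (ha : 0 ≤ a) (c : Fin p → ℝ) :
    d.hat a *ᵥ (d.X *ᵥ c) = d.X *ᵥ c := by
  rw [Matrix.mulVec_mulVec, h.hat_mul_X ha]

lemma proj_mulVec_X (h : d.Regular lo hi K) (c : Fin p → ℝ) :
    d.proj *ᵥ (d.X *ᵥ c) = d.X *ᵥ c := by
  rw [Matrix.mulVec_mulVec, h.proj_mul_X]

lemma exists_hat_eq (d : Design m p) (a : ℝ) (v : Fin m → ℝ) :
    ∃ c, d.hat a *ᵥ v = d.X *ᵥ c :=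
  ⟨((d.Xᵀ * Matrix.diagonal (d.weight a) * d.X)⁻¹ * d.Xᵀ * Matrix.diagonal (d.weight a)) *ᵥ v, by
    rw [hat, Matrix.mulVec_mulVec]; simp only [Matrix.mul_assoc]⟩

lemma hat_mulVec_hat (h : d.Regular lo hi K) {a b : ℝ} (hb : 0 ≤ b) (v : Fin m → ℝ) :
    d.hat b *ᵥ (d.hat a *ᵥ v) = d.hat a *ᵥ v := by
  obtain ⟨c, hc⟩ := exists_hat_eq d a v
  rw [hc, h.hat_mulVec_X hb]

lemma proj_mulVec_hat (h : d.Regular lo hi K) {a : ℝ} (v : Fin m → ℝ) :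
    d.proj *ᵥ (d.hat a *ᵥ v) = d.hat a *ᵥ v := by
  obtain ⟨c, hc⟩ := exists_hat_eq d a v
  rw [hc, h.proj_mulVec_X]

/-- The normal equations. -/
lemma normal_eq (h : d.Regular lo hi K) {a : ℝ} (ha : 0 ≤ a) (v : Fin m → ℝ) :
    (d.Xᵀ * Matrix.diagonal (d.weight a)) *ᵥ (v - d.hat a *ᵥ v) = 0 := by
  have hu := d.isUnit_gram h.injective (h.weight_pos ha)
  have h1 : (d.Xᵀ * Matrix.diagonal (d.weight a)) * d.hat a =
      d.Xᵀ * Matrix.diagonal (d.weight a) := by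
    rw [hat]
    calc (d.Xᵀ * Matrix.diagonal (d.weight a)) *
          (d.X * (d.Xᵀ * Matrix.diagonal (d.weight a) * d.X)⁻¹ * d.Xᵀ *
            Matrix.diagonal (d.weight a))
        = (d.Xᵀ * Matrix.diagonal (d.weight a) * d.X) *
            (d.Xᵀ * Matrix.diagonal (d.weight a) * d.X)⁻¹ *
              (d.Xᵀ * Matrix.diagonal (d.weight a)) := by simp only [Matrix.mul_assoc]
      _ = _ := by rw [Matrix.mul_nonsing_inv _ hu, Matrix.one_mul]
  rw [Matrix.mulVec_sub, Matrix.mulVec_mulVec, h1, sub_self]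

/-- Weighted Pythagoras for the weighted least squares projection. -/
lemma sum_weight_sq (h : d.Regular lo hi K) {a : ℝ} (ha : 0 ≤ a) (v : Fin m → ℝ) :
    ∑ j, d.weight a j * v j ^ 2 = ∑ j, d.weight a j * (d.hat a *ᵥ v) j ^ 2 +
      ∑ j, d.weight a j * (v j - (d.hat a *ᵥ v) j) ^ 2 := by
  have hcross : ∑ j, d.weight a j * ((d.hat a *ᵥ v) j * (v j - (d.hat a *ᵥ v) j)) = 0 := by
    obtain ⟨c, hc⟩ := exists_hat_eq d a v
    have h1 : (d.hat a *ᵥ v) ⬝ᵥ (Matrix.diagonal (d.weight a) *ᵥ (v - d.hat a *ᵥ v)) = 0 := by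
      conv_lhs => arg 1; rw [hc]
      rw [dotProduct_comm, Matrix.dotProduct_mulVec, ← Matrix.mulVec_transpose,
        Matrix.mulVec_mulVec, h.normal_eq ha, zero_dotProduct]
    rw [← h1, dotProduct]
    refine Finset.sum_congr rfl fun j _ => ?_
    rw [Matrix.mulVec_diagonal, Pi.sub_apply]
    ring
  have h2 : ∀ j, d.weight a j * v j ^ 2 = d.weight a j * (d.hat a *ᵥ v) j ^ 2 +
      d.weight a j * (v j - (d.hat a *ᵥ v) j) ^ 2 +
      2 * (d.weight a j * ((d.hat a *ᵥ v) j * (v j - (d.hat a *ᵥ v) j))) := fun j => by ring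
  rw [Finset.sum_congr rfl fun j _ => h2 j, Finset.sum_add_distrib, Finset.sum_add_distrib,
    ← Finset.mul_sum, hcross, mul_zero, add_zero]

lemma sum_hat_sq_le (h : d.Regular lo hi K) {a : ℝ} (ha : 0 ≤ a) (v : Fin m → ℝ) :
    ∑ j, (d.hat a *ᵥ v) j ^ 2 ≤ hi / lo * ∑ j, v j ^ 2 := by
  have hlo := h.lo_pos
  have hhi := h.hi_pos
  have hle : lo ≤ hi := (h.lo_le ⟨0, h.m_pos⟩).trans (h.le_hi _)
  have h1 : ∑ j, (d.hat a *ᵥ v) j ^ 2 ≤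
      (a + hi) * ∑ j, d.weight a j * (d.hat a *ᵥ v) j ^ 2 := by
    rw [Finset.mul_sum]
    refine Finset.sum_le_sum fun j _ => ?_
    rw [← mul_assoc]
    refine le_mul_of_one_le_left (sq_nonneg _) ?_
    rw [weight, ← div_eq_mul_inv, one_le_div (h.add_pos ha j)]
    linarith [h.le_hi j]
  have h2 : ∑ j, d.weight a j * (d.hat a *ᵥ v) j ^ 2 ≤ ∑ j, d.weight a j * v j ^ 2 := by
    rw [h.sum_weight_sq ha v]
    refine le_add_of_nonneg_right (Finset.sum_nonneg fun j _ => ?_)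
    have := (h.weight_pos ha j).le
    positivity
  have h3 : ∑ j, d.weight a j * v j ^ 2 ≤ (a + lo)⁻¹ * ∑ j, v j ^ 2 := by
    rw [Finset.mul_sum]
    refine Finset.sum_le_sum fun j _ => ?_
    gcongr
    exact inv_anti₀ (by linarith) (by linarith [h.lo_le j])
  have h4 : (a + hi) * (a + lo)⁻¹ ≤ hi / lo := by
    rw [← div_eq_mul_inv, div_le_div_iff₀ (by linarith) hlo]
    nlinarith
  have hs : 0 ≤ ∑ j, v j ^ 2 := Finset.sum_nonneg fun j _ => sq_nonneg _
  calc _ ≤ (a + hi) * ((a + lo)⁻¹ * ∑ j, v j ^ 2) := by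
        refine h1.trans ?_
        gcongr
        exact h2.trans h3
    _ = (a + hi) * (a + lo)⁻¹ * ∑ j, v j ^ 2 := by ring
    _ ≤ _ := by gcongr

lemma proj_transpose (d : Design m p) : d.projᵀ = d.proj := by
  rw [proj, Matrix.transpose_mul, Matrix.transpose_mul, Matrix.transpose_nonsing_inv,
    Matrix.transpose_mul, Matrix.transpose_transpose]
  simp only [Matrix.mul_assoc]

lemma proj_mul_proj (h : d.Regular lo hi K) : d.proj * d.proj = d.proj := by
  conv_lhs => arg 2; rw [proj]
  rw [← Matrix.mul_assoc, ← Matrix.mul_assoc, h.proj_mul_X, proj]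

lemma sum_proj_sq (h : d.Regular lo hi K) (i : Fin m) :
    ∑ j, d.proj i j ^ 2 = d.leverage i := by
  have h1 := congrFun (congrFun h.proj_mul_proj i) i
  rw [Matrix.mul_apply] at h1
  change _ = d.proj i i
  rw [← h1]
  refine Finset.sum_congr rfl fun j _ => ?_
  rw [sq]
  congr 1
  conv_lhs => rw [← proj_transpose d]
  rfl

lemma leverage_nonneg (h : d.Regular lo hi K) (i : Fin m) : 0 ≤ d.leverage i := by
  rw [← h.sum_proj_sq]
  positivity

lemma sum_leverage (h : d.Regular lo hi K) : ∑ j, d.leverage j = p := by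
  have h1 : ∑ j, d.leverage j = d.proj.trace := rfl
  rw [h1, proj, Matrix.trace_mul_comm, ← Matrix.mul_assoc,
    Matrix.mul_nonsing_inv _ h.isUnit_gram_one, Matrix.trace_one, Fintype.card_fin]

/-- Each coordinate of a weighted least squares fit is small, as the leverages are. -/
lemma abs_hat_mulVec_le (h : d.Regular lo hi K) {a : ℝ} (ha : 0 ≤ a) (v : Fin m → ℝ)
    (i : Fin m) :
    |(d.hat a *ᵥ v) i| ≤ √(hi / lo * K) * √(1 / m) * √(∑ j, v j ^ 2) := by
  have hlo := h.lo_pos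
  have hhi := h.hi_pos
  have hm : (0 : ℝ) < m := by exact_mod_cast h.m_pos
  have hlev : d.leverage i ≤ K * (1 / m) := by
    rw [mul_one_div]
    exact h.leverage_le i
  have hK : 0 ≤ K * (1 / m) := (h.leverage_nonneg i).trans hlev
  have h1 : (d.hat a *ᵥ v) i = ∑ j, d.proj i j * (d.hat a *ᵥ v) j := by
    conv_lhs => rw [← h.proj_mulVec_hat v]
    rfl
  have hs : 0 ≤ ∑ j, v j ^ 2 := Finset.sum_nonneg fun j _ => sq_nonneg _
  have hK' : 0 ≤ K := by
    by_contra hc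
    have := mul_neg_of_neg_of_pos (not_le.1 hc) (show 0 < 1 / (m : ℝ) by positivity)
    linarith
  rw [← Real.sqrt_mul (by positivity), ← Real.sqrt_mul (by positivity)]
  refine Real.abs_le_sqrt ?_
  rw [h1]
  calc (∑ j, d.proj i j * (d.hat a *ᵥ v) j) ^ 2
      ≤ (∑ j, d.proj i j ^ 2) * ∑ j, (d.hat a *ᵥ v) j ^ 2 :=
        Finset.sum_mul_sq_le_sq_mul_sq _ _ _
    _ ≤ (K * (1 / m)) * (hi / lo * ∑ j, v j ^ 2) := by
        rw [h.sum_proj_sq]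
        exact mul_le_mul hlev (h.sum_hat_sq_le ha v)
          (Finset.sum_nonneg fun j _ => sq_nonneg _) hK
    _ = hi / lo * K * (1 / m) * ∑ j, v j ^ 2 := by ring

end Regular

/-- The weighted residuals `(vⱼ - v̂ⱼ) / (a + Dⱼ)` of weighted least squares. -/
noncomputable def resid (d : Design m p) (a : ℝ) (v : Fin m → ℝ) : Fin m → ℝ :=
  fun j => d.weight a j * (v j - (d.hat a *ᵥ v) j)

namespace Regular

variable {d : Design m p} {lo hi K : ℝ}

lemma sum_resid_sq_le (h : d.Regular lo hi K) {a : ℝ} (ha : 0 ≤ a) (v : Fin m → ℝ) :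
    ∑ j, d.resid a v j ^ 2 ≤ (lo⁻¹) ^ 2 * ∑ j, v j ^ 2 := by
  have hlo := h.lo_pos
  have hw := fun j => (h.weight_pos ha j).le
  calc ∑ j, d.resid a v j ^ 2
      ≤ lo⁻¹ * ∑ j, d.weight a j * (v j - (d.hat a *ᵥ v) j) ^ 2 := by
        rw [Finset.mul_sum]
        refine Finset.sum_le_sum fun j _ => ?_
        rw [resid, mul_pow, sq (d.weight a j), mul_assoc]
        have := h.weight_le ha j
        have := hw j
        gcongr
    _ ≤ lo⁻¹ * ∑ j, d.weight a j * v j ^ 2 := by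
        refine mul_le_mul_of_nonneg_left ?_ (inv_nonneg.2 hlo.le)
        rw [h.sum_weight_sq ha v]
        refine le_add_of_nonneg_left (Finset.sum_nonneg fun j _ => ?_)
        have := hw j
        positivity
    _ ≤ lo⁻¹ * ∑ j, lo⁻¹ * v j ^ 2 := by
        gcongr with j
        exact h.weight_le ha j
    _ = _ := by rw [← Finset.mul_sum]; ring

/-- How the weighted least squares fit depends on the variance parameter in the weights. -/
lemma hat_mulVec_eq (h : d.Regular lo hi K) {a b : ℝ} (ha : 0 ≤ a) (hb : 0 ≤ b)
    (v : Fin m → ℝ) :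
    d.hat b *ᵥ v = d.hat a *ᵥ v - (b - a) • (d.hat b *ᵥ d.resid a v) := by
  set x := v - d.hat a *ᵥ v with hx
  have h1 : d.hat b *ᵥ v - d.hat a *ᵥ v = d.hat b *ᵥ x := by
    rw [hx, Matrix.mulVec_sub, h.hat_mulVec_hat hb]
  have h2 : Matrix.diagonal (d.weight b) *ᵥ x =
      Matrix.diagonal (d.weight a) *ᵥ x -
        (b - a) • (Matrix.diagonal (d.weight b) *ᵥ d.resid a v) := by
    ext j
    simp only [Matrix.mulVec_diagonal, Pi.sub_apply, Pi.smul_apply, smul_eq_mul, resid]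
    have h3 : x j = v j - (d.hat a *ᵥ v) j := rfl
    rw [← h3, weight, weight]
    have := (h.add_pos ha j).ne'
    have := (h.add_pos hb j).ne'
    field_simp
    ring
  have h4 : d.hat b *ᵥ x = -((b - a) • (d.hat b *ᵥ d.resid a v)) := by
    have h5 : ∀ u, d.hat b *ᵥ u = (d.X * (d.Xᵀ * Matrix.diagonal (d.weight b) * d.X)⁻¹) *ᵥ
        (d.Xᵀ *ᵥ (Matrix.diagonal (d.weight b) *ᵥ u)) := fun u => by
      rw [Matrix.mulVec_mulVec, Matrix.mulVec_mulVec, hat]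
    have h6 : d.Xᵀ *ᵥ (Matrix.diagonal (d.weight a) *ᵥ x) = 0 := by
      rw [Matrix.mulVec_mulVec]
      exact h.normal_eq ha v
    rw [h5 x, h2, Matrix.mulVec_sub, h6, h5 (d.resid a v), zero_sub, Matrix.mulVec_neg,
      Matrix.mulVec_smul, Matrix.mulVec_smul]
  rw [sub_eq_add_neg, ← h4, ← h1]
  abel

/-- Second-order expansion of the weighted least squares fit in the variance parameter. -/
lemma hat_mulVec_eq₂ (h : d.Regular lo hi K) {a b : ℝ} (ha : 0 ≤ a) (hb : 0 ≤ b)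
    (v : Fin m → ℝ) (i : Fin m) :
    (d.hat b *ᵥ v) i = (d.hat a *ᵥ v) i - (b - a) * (d.hat a *ᵥ d.resid a v) i +
      (b - a) ^ 2 * (d.hat b *ᵥ d.resid a (d.resid a v)) i := by
  have h1 := congrFun (h.hat_mulVec_eq ha hb v) i
  have h2 := congrFun (h.hat_mulVec_eq ha hb (d.resid a v)) i
  simp only [Pi.sub_apply, Pi.smul_apply, smul_eq_mul] at h1 h2
  rw [h1, h2]
  ring

lemma sum_sub_proj_sq (h : d.Regular lo hi K) (v : Fin m → ℝ) :
    ∑ j, (v j - (d.proj *ᵥ v) j) ^ 2 = ∑ j, v j ^ 2 - ∑ j, (d.proj *ᵥ v) j ^ 2 := by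
  have h1 : ∑ j, (d.proj *ᵥ v) j * (v j - (d.proj *ᵥ v) j) = 0 := by
    change (d.proj *ᵥ v) ⬝ᵥ (v - d.proj *ᵥ v) = 0
    rw [dotProduct_comm, Matrix.dotProduct_mulVec, ← Matrix.mulVec_transpose, proj_transpose,
      Matrix.mulVec_sub, Matrix.mulVec_mulVec, h.proj_mul_proj, sub_self, zero_dotProduct]
  have h2 : ∀ j, (v j - (d.proj *ᵥ v) j) ^ 2 = v j ^ 2 - (d.proj *ᵥ v) j ^ 2 -
      2 * ((d.proj *ᵥ v) j * (v j - (d.proj *ᵥ v) j)) := fun j => by ring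
  rw [Finset.sum_congr rfl fun j _ => h2 j, Finset.sum_sub_distrib, Finset.sum_sub_distrib,
    ← Finset.mul_sum, h1]
  ring

end Regular

end Design

lemma measurable_det {α : Type*} [MeasurableSpace α] {n : ℕ}
    {M : α → Matrix (Fin n) (Fin n) ℝ} (hM : ∀ k l, Measurable fun a => M a k l) :
    Measurable fun a => (M a).det := by
  simp only [Matrix.det_apply, Units.smul_def, zsmul_eq_mul]
  fun_prop

lemma measurable_matrix_inv {α : Type*} [MeasurableSpace α] {n : ℕ}
    {M : α → Matrix (Fin n) (Fin n) ℝ} (hM : ∀ k l, Measurable fun a => M a k l)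
    (k l : Fin n) : Measurable fun a => (M a)⁻¹ k l := by
  simp only [Matrix.inv_def, Matrix.smul_apply, smul_eq_mul, Ring.inverse_eq_inv',
    Matrix.adjugate_apply]
  refine (measurable_det hM).inv.mul (measurable_det fun r c => ?_)
  simp only [Matrix.updateRow_apply]
  split_ifs
  exacts [measurable_const, hM r c]

lemma measurable_matrix_mul {α : Type*} [MeasurableSpace α] {n₁ n₂ n₃ : ℕ}
    {M : α → Matrix (Fin n₁) (Fin n₂) ℝ} {N : α → Matrix (Fin n₂) (Fin n₃) ℝ}
    (hM : ∀ k l, Measurable fun a => M a k l) (hN : ∀ k l, Measurable fun a => N a k l)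
    (k : Fin n₁) (l : Fin n₃) : Measurable fun a => (M a * N a) k l := by
  simp only [Matrix.mul_apply]
  fun_prop

namespace Design

lemma measurable_hat (d : Design m p) (i j : Fin m) : Measurable fun a : ℝ => d.hat a i j := by
  have hw : ∀ k l, Measurable fun a : ℝ => Matrix.diagonal (d.weight a) k l := fun k l => by
    simp only [Matrix.diagonal_apply, weight]
    split_ifs <;> fun_prop
  have hc : ∀ {n₁ n₂ : ℕ} (M : Matrix (Fin n₁) (Fin n₂) ℝ) k l,
      Measurable fun _ : ℝ => M k l := fun M k l => measurable_const
  exact measurable_matrix_mul (measurable_matrix_mul (measurable_matrix_mul (hc d.X)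
    (measurable_matrix_inv (measurable_matrix_mul (measurable_matrix_mul (hc d.Xᵀ) hw) (hc d.X))))
    (hc d.Xᵀ)) hw i j

end Design

/-! ### Measurability and equivariance of the estimators -/

namespace Design

lemma AHat_nonneg (d : Design m p) {τ : ℝ} (hτ : 0 ≤ τ) (y : Fin m → ℝ) : 0 ≤ d.AHat τ y := by
  unfold AHat
  split_ifs with h
  exacts [h.le, hτ]

@[fun_prop]
lemma measurable_mulVec (M : Matrix (Fin m) (Fin m) ℝ) (i : Fin m) :
    Measurable fun y : Fin m → ℝ => (M *ᵥ y) i := by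
  simp only [Matrix.mulVec, dotProduct]
  fun_prop

@[fun_prop]
lemma measurable_prasadRaoRaw (d : Design m p) : Measurable d.prasadRaoRaw := by
  unfold prasadRaoRaw
  simp only [linPred_betaOLS]
  fun_prop

@[fun_prop]
lemma measurable_AHat (d : Design m p) (τ : ℝ) : Measurable (d.AHat τ) := by
  classical
  have h := d.measurable_prasadRaoRaw
  exact Measurable.ite (measurableSet_lt measurable_const h) h measurable_const

namespace Regular

variable {d : Design m p} {lo hi K : ℝ}

lemma linPred_betaHat (h : d.Regular lo hi K) {τ : ℝ} (hτ : 0 ≤ τ) (y : Fin m → ℝ) (i : Fin m) :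
    d.linPred (d.betaHat τ y) i = (d.hat (d.AHat τ y) *ᵥ y) i :=
  d.linPred_betaTilde (h.add_pos (d.AHat_nonneg hτ y)) y i

lemma measurable_eblup (h : d.Regular lo hi K) {τ : ℝ} (hτ : 0 ≤ τ) (i : Fin m) :
    Measurable (d.eblup τ i) := by
  unfold eblup blp shrink
  simp only [h.linPred_betaHat hτ]
  have h1 : Measurable fun y : Fin m → ℝ => (d.hat (d.AHat τ y) *ᵥ y) i := by
    simp only [Matrix.mulVec, dotProduct]
    have : ∀ j, Measurable fun y => d.hat (d.AHat τ y) i j := fun j =>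
      (d.measurable_hat i j).comp (d.measurable_AHat τ)
    fun_prop
  fun_prop

lemma measurable_HHat (h : d.Regular lo hi K) {τ : ℝ} (hτ : 0 ≤ τ) (i : Fin m) :
    Measurable (d.HHat τ i) := by
  have h1 := h.measurable_eblup hτ i
  change Measurable fun ω : (Fin m → ℝ) × (Fin m → ℝ) =>
    (ω.1 i - d.eblup τ i ω.2) / √(d.g1 (d.AHat τ ω.2) i)
  unfold g1
  fun_prop

lemma prasadRaoRaw_shift (h : d.Regular lo hi K) (β : Fin p → ℝ) (y : Fin m → ℝ) :
    d.prasadRaoRaw (d.X *ᵥ β + y) = d.prasadRaoRaw y := by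
  unfold prasadRaoRaw
  simp only [linPred_betaOLS, Matrix.mulVec_add, h.proj_mulVec_X, Pi.add_apply,
    add_sub_add_left_eq_sub]

lemma AHat_shift (h : d.Regular lo hi K) (τ : ℝ) (β : Fin p → ℝ) (y : Fin m → ℝ) :
    d.AHat τ (d.X *ᵥ β + y) = d.AHat τ y := by
  unfold AHat
  rw [h.prasadRaoRaw_shift]

lemma eblup_shift (h : d.Regular lo hi K) {τ : ℝ} (hτ : 0 ≤ τ) (β : Fin p → ℝ)
    (y : Fin m → ℝ) (i : Fin m) :
    d.eblup τ i (d.X *ᵥ β + y) = (d.X *ᵥ β) i + d.eblup τ i y := by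
  unfold eblup blp
  rw [h.linPred_betaHat hτ, h.linPred_betaHat hτ, h.AHat_shift, Matrix.mulVec_add,
    h.hat_mulVec_X (d.AHat_nonneg hτ y)]
  simp only [Pi.add_apply]
  ring

/-- The studentized prediction error does not depend on the regression coefficients. -/
lemma HHat_shift (h : d.Regular lo hi K) {τ : ℝ} (hτ : 0 ≤ τ) (β : Fin p → ℝ)
    (θ y : Fin m → ℝ) (i : Fin m) :
    d.HHat τ i (d.X *ᵥ β + θ, d.X *ᵥ β + y) = d.HHat τ i (θ, y) := by
  change ((d.X *ᵥ β + θ) i - d.eblup τ i (d.X *ᵥ β + y)) /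
    √(d.g1 (d.AHat τ (d.X *ᵥ β + y)) i) = (θ i - d.eblup τ i y) / √(d.g1 (d.AHat τ y) i)
  rw [h.eblup_shift hτ, h.AHat_shift, Pi.add_apply, add_sub_add_left_eq_sub]

end Regular

/-! ### The normal model in standard normal coordinates -/

/-- The vector `y - Xβ` in standard normal coordinates. -/
noncomputable def noise (d : Design m p) (a : ℝ) (z : Fin m → ℝ) : Fin m → ℝ :=
  fun j => √(a + d.D j) * z j

/-- `(θ - Xβ, y - Xβ)` in standard normal coordinates `(s, z)`: `z` drives `y`, and the independent
`s` drives the deviation of `θ` from its conditional mean given `y`. -/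
noncomputable def simMap (d : Design m p) (a : ℝ) (sz : (Fin m → ℝ) × (Fin m → ℝ)) :
    (Fin m → ℝ) × (Fin m → ℝ) :=
  (fun j => (1 - d.shrink a j) * d.noise a sz.2 j + √(d.g1 a j) * sz.1 j, d.noise a sz.2)

lemma measurable_simMap (d : Design m p) : Measurable (Function.uncurry d.simMap) := by
  unfold simMap noise shrink g1 Function.uncurry
  fun_prop

lemma measurable_simMap_right (d : Design m p) (a : ℝ) : Measurable (d.simMap a) :=
  d.measurable_simMap.comp measurable_prodMk_left

end Design

/-- The joint law of two independent standard normal vectors is invariant under rotations in the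
planes spanned by corresponding coordinates. -/
lemma measurePreserving_rotation (θ : Fin m → ℝ) :
    MeasurePreserving (fun sz : (Fin m → ℝ) × (Fin m → ℝ) =>
      ((fun j => Real.cos (θ j) * sz.1 j + Real.sin (θ j) * sz.2 j,
        fun j => -Real.sin (θ j) * sz.1 j + Real.cos (θ j) * sz.2 j) :
          (Fin m → ℝ) × (Fin m → ℝ)))
      ((stdNormal m).prod (stdNormal m)) ((stdNormal m).prod (stdNormal m)) := by
  have h1 := measurePreserving_arrowProdEquivProdArrow ℝ ℝ (Fin m)
    (fun _ => gaussianReal 0 1) (fun _ => gaussianReal 0 1)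
  have h2 : ∀ j, MeasurePreserving (ContinuousLinearMap.rotation (E := ℝ) (θ j))
      ((gaussianReal 0 1).prod (gaussianReal 0 1)) ((gaussianReal 0 1).prod (gaussianReal 0 1)) :=
    fun j => ⟨by fun_prop, IsGaussian.map_rotation_eq_self (by simp) (θ j)⟩
  have h3 := measurePreserving_pi _ _ h2
  refine MeasurePreserving.congr ((h1.comp h3).comp h1.symm) (by fun_prop)
    (ae_of_all _ fun sz => ?_)
  simp only [Function.comp_apply]
  ext j <;> simp [MeasurableEquiv.arrowProdEquivProdArrow, Equiv.arrowProdEquivProdArrow,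
    ContinuousLinearMap.rotation_apply]

lemma gaussianReal_eq_map {v : ℝ} (hv : 0 ≤ v) :
    gaussianReal 0 v.toNNReal = (gaussianReal 0 1).map (√v * ·) := by
  rw [gaussianReal_map_const_mul, mul_zero, mul_one]
  congr 1
  ext
  simp [Real.sq_sqrt hv, hv]

lemma pi_gaussianReal_eq_map {v : Fin m → ℝ} (hv : ∀ j, 0 ≤ v j) :
    Measure.pi (fun j => gaussianReal 0 (v j).toNNReal) =
      (stdNormal m).map fun z j => √(v j) * z j := by
  rw [stdNormal, Measure.pi_map_pi (fun j => by fun_prop)]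
  congr 1
  ext1 j
  exact gaussianReal_eq_map (hv j)

namespace Design

/-- With normal random effects, the area-level model is a shift of the model in standard normal
coordinates. -/
lemma modelLaw_eq_map (d : Design m p) (G : RandomEffectFamily k) (β : Fin p → ℝ) {a : ℝ}
    (ha : 0 ≤ a) (hD : ∀ j, 0 < d.D j) {φ : Fin k → ℝ}
    (hG : G.law a φ = gaussianReal 0 a.toNNReal) :
    d.modelLaw G β a φ = ((stdNormal m).prod (stdNormal m)).map fun sz =>
      (d.X *ᵥ β + (d.simMap a sz).1, d.X *ᵥ β + (d.simMap a sz).2) := by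
  have h0 : ∀ j, 0 < a + d.D j := fun j => by linarith [hD j]
  -- The rotation that takes `uⱼ + eⱼ` to a multiple of the second coordinate.
  set θ : Fin m → ℝ := fun j => Real.arccos √(d.D j / (a + d.D j)) with hθ
  have hcos : ∀ j, Real.cos (θ j) = √(d.D j / (a + d.D j)) := fun j => by
    refine Real.cos_arccos (by linarith [Real.sqrt_nonneg (d.D j / (a + d.D j))]) ?_
    rw [Real.sqrt_le_one, div_le_one (h0 j)]
    linarith
  have hsin : ∀ j, Real.sin (θ j) = √(a / (a + d.D j)) := fun j => by
    rw [hθ, Real.sin_arccos, Real.sq_sqrt (div_nonneg (hD j).le (h0 j).le)]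
    congr 1
    have := (h0 j).ne'
    field_simp
    ring
  rw [modelLaw, hG, pi_gaussianReal_eq_map (fun j => (hD j).le),
    pi_gaussianReal_eq_map (v := fun _ : Fin m => a) (fun _ => ha),
    Measure.map_prod_map _ _ (by fun_prop) (by fun_prop),
    Measure.map_map (d.measurable_modelMap β) (by fun_prop),
    ← (measurePreserving_rotation θ).map_eq, Measure.map_map
      ((d.measurable_modelMap β).comp (by fun_prop)) (by fun_prop)]
  rw [(measurePreserving_rotation θ).map_eq]
  congr 1
  have hs1 : ∀ j, √a * √(d.D j / (a + d.D j)) = √(d.g1 a j) := fun j => by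
    rw [← Real.sqrt_mul ha, g1]
    congr 1
    ring
  have hs2 : ∀ j, √a * √(a / (a + d.D j)) = (1 - d.shrink a j) * √(a + d.D j) := fun j => by
    have hj := h0 j
    have h2 := Real.mul_self_sqrt hj.le
    rw [Real.sqrt_div ha, shrink, mul_div_assoc', Real.mul_self_sqrt ha]
    field_simp
    rw [Real.sq_sqrt hj.le]
    ring
  have hs3 : ∀ j, √a * √(d.D j / (a + d.D j)) = √(d.D j) * √(a / (a + d.D j)) := fun j => by
    rw [← Real.sqrt_mul ha, ← Real.sqrt_mul (hD j).le]
    congr 1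
    ring
  have hs4 : ∀ j, √a * √(a / (a + d.D j)) + √(d.D j) * √(d.D j / (a + d.D j)) =
      √(a + d.D j) := fun j => by
    have hj := h0 j
    rw [Real.sqrt_div ha, Real.sqrt_div (hD j).le, mul_div_assoc', mul_div_assoc',
      Real.mul_self_sqrt ha, Real.mul_self_sqrt (hD j).le, ← add_div, Real.div_sqrt]
  ext sz j
  · simp only [Function.comp_apply, Prod.map_apply, hcos, hsin, simMap, noise, Pi.add_apply]
    change (d.X *ᵥ β) j + _ = _
    linear_combination sz.1 j * hs1 j + sz.2 j * hs2 j
  · simp only [Function.comp_apply, Prod.map_apply, hcos, hsin, simMap, noise, Pi.add_apply]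
    change (d.X *ᵥ β) j + _ + _ = _
    linear_combination sz.1 j * hs3 j + sz.2 j * hs4 j

lemma modelLaw_apply (d : Design m p) (G : RandomEffectFamily k) (β : Fin p → ℝ) {a : ℝ}
    (ha : 0 ≤ a) (hD : ∀ j, 0 < d.D j) {φ : Fin k → ℝ}
    (hG : G.law a φ = gaussianReal 0 a.toNNReal) {E : Set ((Fin m → ℝ) × (Fin m → ℝ))}
    (hE : MeasurableSet E) :
    d.modelLaw G β a φ E = ((stdNormal m).prod (stdNormal m))
      {sz | (d.X *ᵥ β + (d.simMap a sz).1, d.X *ᵥ β + (d.simMap a sz).2) ∈ E} := by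
  have hm := d.measurable_simMap_right a
  have hm' : Measurable fun sz =>
      (d.X *ᵥ β + (d.simMap a sz).1, d.X *ᵥ β + (d.simMap a sz).2) :=
    (measurable_const.add hm.fst).prodMk (measurable_const.add hm.snd)
  rw [d.modelLaw_eq_map G β ha hD hG]
  exact Measure.map_apply hm' hE

end Design

/-! ### Conditioning on the data -/

/-- The standard normal distribution function. -/
noncomputable def Φ (x : ℝ) : ℝ := cdf (gaussianReal 0 1) x

lemma measurable_Φ : Measurable Φ := (monotone_cdf _).measurable

lemma Φ_nonneg (x : ℝ) : 0 ≤ Φ x := cdf_nonneg _ x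

lemma Φ_le_one (x : ℝ) : Φ x ≤ 1 := cdf_le_one _ x

lemma stdNormal_apply_Iic (i : Fin m) (c : ℝ) :
    stdNormal m {s | s i ≤ c} = ENNReal.ofReal (Φ c) := by
  have h := (measurePreserving_eval (fun _ : Fin m => gaussianReal 0 1) i).measure_preimage
    (measurableSet_Iic (a := c)).nullMeasurableSet
  rw [← ofReal_cdf] at h
  exact h

lemma measureReal_le_eq_integral (i : Fin m) {c : (Fin m → ℝ) → ℝ} (hc : Measurable c) :
    ((stdNormal m).prod (stdNormal m)).real {sz | sz.1 i ≤ c sz.2} =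
      ∫ z, Φ (c z) ∂stdNormal m := by
  have hs : MeasurableSet {sz : (Fin m → ℝ) × (Fin m → ℝ) | sz.1 i ≤ c sz.2} :=
    measurableSet_le (by fun_prop) (by fun_prop)
  rw [measureReal_def, Measure.prod_apply_symm hs, integral_eq_lintegral_of_nonneg_ae
    (ae_of_all _ fun z => Φ_nonneg _) (measurable_Φ.comp hc).aestronglyMeasurable]
  congr 1
  refine lintegral_congr fun z => ?_
  exact stdNormal_apply_Iic i (c z)

lemma measure_eq_zero_graph (i : Fin m) {c : (Fin m → ℝ) → ℝ} (hc : Measurable c) :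
    ((stdNormal m).prod (stdNormal m)) {sz | sz.1 i = c sz.2} = 0 := by
  have hs : MeasurableSet {sz : (Fin m → ℝ) × (Fin m → ℝ) | sz.1 i = c sz.2} :=
    measurableSet_eq_fun (by fun_prop) (by fun_prop)
  have := nullSingletonClass_gaussianReal (μ := 0) (v := 1) one_ne_zero
  rw [Measure.prod_apply_symm hs]
  refine (lintegral_congr fun z => ?_).trans lintegral_zero
  have h := (measurePreserving_eval (fun _ : Fin m => gaussianReal 0 1) i).measure_preimage
    (measurableSet_singleton (c z)).nullMeasurableSet
  rw [measure_singleton] at h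
  exact h

/-! ### Quantiles -/

/-- The Galois connection between a distribution function and its quantile function. -/
lemma sInf_cdf_le_iff (ν : Measure ℝ) {t : ℝ} (ht : 0 < t) (ht1 : t < 1) (q : ℝ) :
    sInf {q | t ≤ cdf ν q} ≤ q ↔ t ≤ cdf ν q := by
  have hne : {q | t ≤ cdf ν q}.Nonempty :=
    ((tendsto_cdf_atTop ν).eventually (eventually_ge_nhds ht1)).exists
  have hbdd : BddBelow {q | t ≤ cdf ν q} := by
    obtain ⟨b, hb⟩ := ((tendsto_cdf_atBot ν).eventually (eventually_lt_nhds ht)).exists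
    refine ⟨b, fun q hq => ?_⟩
    by_contra hc
    exact absurd ((hq.trans (monotone_cdf ν (not_le.1 hc).le)).trans_lt hb) (lt_irrefl _)
  refine ⟨fun h => ?_, fun h => csInf_le hbdd h⟩
  have h1 : Tendsto (cdf ν) (𝓝[>] q) (𝓝 (cdf ν q)) :=
    ((cdf ν).right_continuous q).mono_left (nhdsWithin_mono _ Set.Ioi_subset_Ici_self)
  refine ge_of_tendsto h1 ?_
  filter_upwards [self_mem_nhdsWithin] with x hx
  obtain ⟨b, hb, hbx⟩ := exists_lt_of_csInf_lt hne (h.trans_lt hx)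
  exact hb.trans (monotone_cdf ν hbx.le)

namespace Design

/-- The law of `Hᵢ(β̂, Â)` under the normal model with variance parameter `a`. -/
noncomputable def lawHHat (d : Design m p) (τ : ℝ) (i : Fin m) (a : ℝ) : Measure ℝ :=
  ((stdNormal m).prod (stdNormal m)).map fun sz => d.HHat τ i (d.simMap a sz)

/-- The quantile of `Hᵢ(β̂, Â)` under the normal model with variance parameter `a`. -/
noncomputable def quantile (d : Design m p) (τ : ℝ) (i : Fin m) (t a : ℝ) : ℝ :=
  sInf {q | t ≤ cdf (d.lawHHat τ i a) q}

namespace Regular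

variable {d : Design m p} {lo hi K : ℝ}

lemma isProbabilityMeasure_lawHHat (h : d.Regular lo hi K) {τ : ℝ} (hτ : 0 ≤ τ) (i : Fin m)
    (a : ℝ) : IsProbabilityMeasure (d.lawHHat τ i a) :=
  Measure.isProbabilityMeasure_map
    ((h.measurable_HHat hτ i).comp (d.measurable_simMap_right a)).aemeasurable

lemma cdf_lawHHat (h : d.Regular lo hi K) {τ : ℝ} (hτ : 0 ≤ τ) (i : Fin m) (a q : ℝ) :
    cdf (d.lawHHat τ i a) q =
      ((stdNormal m).prod (stdNormal m)).real {sz | d.HHat τ i (d.simMap a sz) ≤ q} := by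
  have := h.isProbabilityMeasure_lawHHat hτ i a
  have hm : Measurable fun sz => d.HHat τ i (d.simMap a sz) :=
    (h.measurable_HHat hτ i).comp (d.measurable_simMap_right a)
  rw [cdf_eq_real, lawHHat, map_measureReal_apply hm measurableSet_Iic]
  rfl

lemma F1_eq (h : d.Regular lo hi K) {τ : ℝ} (hτ : 0 ≤ τ) (i : Fin m)
    {G : RandomEffectFamily k} (β : Fin p → ℝ) {a : ℝ} (ha : 0 ≤ a) {φ : Fin k → ℝ}
    (hG : G.law a φ = gaussianReal 0 a.toNNReal) (q : ℝ) :
    d.F1 G τ i β a φ q = cdf (d.lawHHat τ i a) q := by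
  have hs : MeasurableSet {ω | d.HHat τ i ω ≤ q} :=
    measurableSet_le (h.measurable_HHat hτ i) measurable_const
  rw [h.cdf_lawHHat hτ, F1, measureReal_def, measureReal_def,
    d.modelLaw_apply G β ha h.D_pos hG hs]
  congr 2
  ext sz
  exact iff_of_eq (congrArg (· ≤ q) (h.HHat_shift hτ β _ _ i))

lemma bootQuantile_eq (h : d.Regular lo hi K) {τ : ℝ} (hτ : 0 ≤ τ) (i : Fin m)
    {G : RandomEffectFamily k}
    (hG : ∀ a, 0 ≤ a → ∀ φ ∈ G.Θ, G.law a φ = gaussianReal 0 a.toNNReal)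
    {φHat : (Fin m → ℝ) → (Fin k → ℝ)} (hφ : ∀ y, φHat y ∈ G.Θ) (t : ℝ) (y : Fin m → ℝ) :
    d.bootQuantile G τ φHat i t y = d.quantile τ i t (d.AHat τ y) := by
  unfold bootQuantile quantile
  congr 1
  ext q
  exact iff_of_eq (congrArg (t ≤ ·) (h.F1_eq hτ i _ (d.AHat_nonneg hτ y)
    (hG _ (d.AHat_nonneg hτ y) _ (hφ y)) q))

lemma measurable_quantile (h : d.Regular lo hi K) {τ : ℝ} (hτ : 0 ≤ τ) (i : Fin m) {t : ℝ}
    (ht : 0 < t) (ht1 : t < 1) : Measurable (d.quantile τ i t) := by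
  refine measurable_of_Iic fun q => ?_
  have h1 : d.quantile τ i t ⁻¹' Set.Iic q = {a | t ≤ cdf (d.lawHHat τ i a) q} := by
    ext a
    exact sInf_cdf_le_iff _ ht ht1 q
  rw [h1]
  refine measurableSet_le measurable_const ?_
  simp only [h.cdf_lawHHat hτ]
  have hs : MeasurableSet {x : ℝ × ((Fin m → ℝ) × (Fin m → ℝ)) |
      d.HHat τ i (d.simMap x.1 x.2) ≤ q} :=
    measurableSet_le ((h.measurable_HHat hτ i).comp d.measurable_simMap) measurable_const
  exact (measurable_measure_prodMk_left (ν := (stdNormal m).prod (stdNormal m)) hs).ennreal_toReal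

end Regular

end Design

/-! ### Moment bounds that are Lipschitz in the variance parameter -/

section LipMoments

variable {ι : Type*} {N : ι → ℕ}

/-- A family of linear forms in standard normal vectors is of the order of its operator norms. -/
lemma UniformMoments.of_isLinearMap {X : ∀ j, (Fin (N j) → ℝ) → ℝ} {s : ι → ℝ}
    (hs : ∀ j, 0 < s j) (hX : ∀ j, IsLinearMap ℝ (X j)) (B : ℝ)
    (hB : ∀ j v, |X j v| ≤ B * s j * √(∑ l, v l ^ 2)) :
    UniformMoments (fun j => stdNormal (N j)) X s := by
  set B' := max B 1 with hB'
  have hB1 : 0 < B' := lt_of_lt_of_le one_pos (le_max_right _ _)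
  set ℓ : ∀ j, Fin (N j) → ℝ := fun j l => X j (Pi.single l 1) with hℓ
  have hrep : ∀ j v, X j v = ∑ l, ℓ j l * v l := fun j v => by
    have h := LinearMap.pi_apply_eq_sum_univ ((hX j).mk' (X j)) v
    simp only [IsLinearMap.mk'_apply, smul_eq_mul] at h
    rw [h]
    refine Finset.sum_congr rfl fun l _ => ?_
    rw [mul_comm, hℓ]
    congr 2
    ext l'
    simp [Pi.single_apply, eq_comm]
  have hnorm : ∀ j, ∑ l, ℓ j l ^ 2 ≤ (B' * s j) ^ 2 := fun j => by
    have h := hB j (ℓ j)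
    have hsj := hs j
    rw [hrep] at h
    set S := ∑ l, ℓ j l ^ 2 with hS
    have hS' : ∑ l, ℓ j l * ℓ j l = S := by simp only [hS, sq]
    have hS0 : 0 ≤ S := Finset.sum_nonneg fun l _ => sq_nonneg _
    rw [hS', abs_of_nonneg hS0] at h
    have h2 : S ≤ B' * s j * √S := h.trans (by gcongr; exact le_max_left _ _)
    by_cases h0 : √S = 0
    · rw [Real.sqrt_eq_zero hS0] at h0
      rw [h0]
      positivity
    have h0' : 0 < √S := lt_of_le_of_ne (Real.sqrt_nonneg _) (Ne.symm h0)
    have h3 : √S ≤ B' * s j := by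
      refine le_of_mul_le_mul_right ?_ h0'
      rwa [Real.mul_self_sqrt hS0]
    calc S = √S ^ 2 := (Real.sq_sqrt hS0).symm
      _ ≤ _ := by gcongr
  have h := UniformMoments.linear (ℓ := ℓ) (s := fun j => B' * s j)
    (fun j => mul_pos hB1 (hs j)) hnorm
  exact (h.mono hs B' fun j => le_rfl).congr hrep

variable {a₀ a₁ : ℝ}

/-- Processes indexed by `a ∈ [a₀, a₁]` on standard normal space which, uniformly in `j`, are of
order `s j` and whose increments are of order `s j * |a - a'|`. Pairs with `a = a'` are left out of
the second condition because scales are positive. -/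
structure LipMoments (N : ι → ℕ) (a₀ a₁ : ℝ) (X : ∀ j, ℝ → (Fin (N j) → ℝ) → ℝ)
    (s : ι → ℝ) : Prop where
  bdd : UniformMoments (ι := ι × Set.Icc a₀ a₁) (fun j => stdNormal (N j.1))
    (fun j => X j.1 j.2) (fun j => s j.1)
  lip : UniformMoments (ι := {j : ι × Set.Icc a₀ a₁ × Set.Icc a₀ a₁ // j.2.1 ≠ j.2.2})
    (fun j => stdNormal (N j.1.1))
    (fun j z => X j.1.1 j.1.2.1 z - X j.1.1 j.1.2.2 z)
    (fun j => s j.1.1 * |(j.1.2.1 : ℝ) - j.1.2.2|)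

namespace LipMoments

variable {X Y : ∀ j, ℝ → (Fin (N j) → ℝ) → ℝ} {s r : ι → ℝ}

lemma congr (h : LipMoments N a₀ a₁ X s)
    (hXY : ∀ j, ∀ a ∈ Set.Icc a₀ a₁, ∀ z, Y j a z = X j a z) : LipMoments N a₀ a₁ Y s :=
  ⟨h.bdd.congr fun j => hXY j.1 j.2 j.2.2, h.lip.congr fun j z => by
    rw [hXY _ _ j.1.2.1.2, hXY _ _ j.1.2.2.2]⟩

lemma mono (h : LipMoments N a₀ a₁ X s) (hr : ∀ j, 0 < r j) (b : ℝ)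
    (hsr : ∀ j, s j ≤ b * r j) : LipMoments N a₀ a₁ X r :=
  ⟨h.bdd.mono (fun j => hr j.1) b fun j => hsr j.1,
    h.lip.mono (fun j => mul_pos (hr _) (abs_pos.2 (sub_ne_zero.2 fun h => j.2 (Subtype.ext h)))) b
      fun j => by
        rw [← mul_assoc]
        exact mul_le_mul_of_nonneg_right (hsr _) (abs_nonneg _)⟩

lemma reindex {ι' : Type*} (f : ι' → ι) (h : LipMoments N a₀ a₁ X s) :
    LipMoments (fun j => N (f j)) a₀ a₁ (fun j => X (f j)) (fun j => s (f j)) :=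
  ⟨h.bdd.reindex fun j : ι' × Set.Icc a₀ a₁ => (f j.1, j.2),
    h.lip.reindex fun j : {j : ι' × Set.Icc a₀ a₁ × Set.Icc a₀ a₁ // j.2.1 ≠ j.2.2} =>
      ⟨(f j.1.1, j.1.2), j.2⟩⟩

lemma add (hX : LipMoments N a₀ a₁ X s) (hY : LipMoments N a₀ a₁ Y s) :
    LipMoments N a₀ a₁ (fun j a z => X j a z + Y j a z) s :=
  ⟨hX.bdd.add hY.bdd, (hX.lip.add hY.lip).congr fun j z => by ring⟩

lemma sub (hX : LipMoments N a₀ a₁ X s) (hY : LipMoments N a₀ a₁ Y s) :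
    LipMoments N a₀ a₁ (fun j a z => X j a z - Y j a z) s :=
  ⟨hX.bdd.sub hY.bdd, (hX.lip.sub hY.lip).congr fun j z => by ring⟩

lemma mul (hX : LipMoments N a₀ a₁ X s) (hY : LipMoments N a₀ a₁ Y r) :
    LipMoments N a₀ a₁ (fun j a z => X j a z * Y j a z) (fun j => s j * r j) := by
  refine ⟨hX.bdd.mul hY.bdd, ?_⟩
  have h1 := hX.lip.mul (hY.bdd.reindex fun
    j : {j : ι × Set.Icc a₀ a₁ × Set.Icc a₀ a₁ // j.2.1 ≠ j.2.2} => (j.1.1, j.1.2.1))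
  have h2 := (hX.bdd.reindex fun
    j : {j : ι × Set.Icc a₀ a₁ × Set.Icc a₀ a₁ // j.2.1 ≠ j.2.2} => (j.1.1, j.1.2.2)).mul hY.lip
  have hpos : ∀ j : {j : ι × Set.Icc a₀ a₁ × Set.Icc a₀ a₁ // j.2.1 ≠ j.2.2},
      0 < s j.1.1 * r j.1.1 * |(j.1.2.1 : ℝ) - j.1.2.2| := fun j =>
    mul_pos (mul_pos (hX.bdd.scale_pos (j.1.1, j.1.2.1)) (hY.bdd.scale_pos (j.1.1, j.1.2.1)))
      (abs_pos.2 (sub_ne_zero.2 fun h => j.2 (Subtype.ext h)))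
  refine ((h1.mono hpos 1 fun j => le_of_eq (by ring)).add
    (h2.mono hpos 1 fun j => le_of_eq (by ring))).congr fun j z => by ring

/-- Deterministic, bounded and Lipschitz processes. -/
lemma const {b : ι → ℝ → ℝ} (hs : ∀ j, 0 < s j) (B : ℝ)
    (hb : ∀ j, ∀ a ∈ Set.Icc a₀ a₁, |b j a| ≤ B * s j)
    (hb' : ∀ j, ∀ a ∈ Set.Icc a₀ a₁, ∀ a' ∈ Set.Icc a₀ a₁,
      |b j a - b j a'| ≤ B * s j * |a - a'|) :
    LipMoments N a₀ a₁ (fun j a _ => b j a) s :=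
  ⟨.const (fun _ => hs _) B fun j => hb _ _ j.2.2,
    .const (fun j => mul_pos (hs _) (abs_pos.2 (sub_ne_zero.2 fun h => j.2 (Subtype.ext h)))) B
      fun j => (hb' _ _ j.1.2.1.2 _ j.1.2.2.2).trans (le_of_eq (mul_assoc _ _ _))⟩

lemma of_isLinearMap (hs : ∀ j, 0 < s j) (hX : ∀ j a, IsLinearMap ℝ (X j a)) (B : ℝ)
    (hb : ∀ j, ∀ a ∈ Set.Icc a₀ a₁, ∀ v, |X j a v| ≤ B * s j * √(∑ l, v l ^ 2))
    (hb' : ∀ j, ∀ a ∈ Set.Icc a₀ a₁, ∀ a' ∈ Set.Icc a₀ a₁, ∀ v,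
      |X j a v - X j a' v| ≤ B * s j * |a - a'| * √(∑ l, v l ^ 2)) :
    LipMoments N a₀ a₁ X s :=
  ⟨.of_isLinearMap (fun j => hs _) (fun j => hX _ _) B fun j => hb _ _ j.2.2,
    .of_isLinearMap (fun j => mul_pos (hs _) (abs_pos.2 (sub_ne_zero.2 fun h => j.2 (Subtype.ext h))))
      (fun j => ((hX _ j.1.2.1).mk' _ - (hX _ j.1.2.2).mk' _).isLinear) B
      fun j v => (hb' _ _ j.1.2.1.2 _ j.1.2.2.2 v).trans (le_of_eq (by ring))⟩

lemma average {n : ι → ℕ} (hn : ∀ j, 0 < n j) {Z : ∀ j, Fin (n j) → ℝ → (Fin (N j) → ℝ) → ℝ}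
    (h : LipMoments (ι := Σ j, Fin (n j)) (fun q => N q.1) a₀ a₁ (fun q => Z q.1 q.2)
      (fun q => s q.1)) :
    LipMoments N a₀ a₁ (fun j a z => (∑ l, Z j l a z) / n j) s := by
  refine ⟨.average (N := fun j : ι × Set.Icc a₀ a₁ => n j.1) (fun j => hn _) (h.bdd.reindex
    fun q : (Σ j : ι × Set.Icc a₀ a₁, Fin (n j.1)) => (⟨q.1.1, q.2⟩, q.1.2)), ?_⟩
  have := UniformMoments.average
    (N := fun j : {j : ι × Set.Icc a₀ a₁ × Set.Icc a₀ a₁ // j.2.1 ≠ j.2.2} => n j.1.1)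
    (μ := fun j => stdNormal (N j.1.1))
    (Z := fun j l z => Z j.1.1 l j.1.2.1 z - Z j.1.1 l j.1.2.2 z)
    (s := fun j => s j.1.1 * |(j.1.2.1 : ℝ) - j.1.2.2|) (fun j => hn _)
    (h.lip.reindex fun q : (Σ j : {j : ι × Set.Icc a₀ a₁ × Set.Icc a₀ a₁ // j.2.1 ≠ j.2.2},
      Fin (n j.1.1)) => ⟨(⟨q.1.1.1, q.2⟩, q.1.1.2), q.1.2⟩)
  exact this.congr fun j z => by rw [Finset.sum_sub_distrib, sub_div]

/-- Expectations of such processes are bounded and Lipschitz functions of the parameter. -/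
lemma integral (h : LipMoments N a₀ a₁ X s) : ∃ C : ℝ, 0 ≤ C ∧ ∀ j,
    ∀ a ∈ Set.Icc a₀ a₁, |∫ z, X j a z ∂stdNormal (N j)| ≤ C * s j ∧
      ∀ a' ∈ Set.Icc a₀ a₁, |∫ z, X j a z ∂stdNormal (N j) - ∫ z, X j a' z ∂stdNormal (N j)| ≤
        C * s j * |a - a'| := by
  obtain ⟨C, hC0, hC⟩ := h.bdd.abs_integral_le
  obtain ⟨C', hC0', hC'⟩ := h.lip.abs_integral_le
  refine ⟨max C C', le_max_of_le_left hC0, fun j a ha => ⟨?_, fun a' ha' => ?_⟩⟩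
  · have := h.bdd.scale_pos (j, ⟨a, ha⟩)
    exact (hC (j, ⟨a, ha⟩)).trans (mul_le_mul_of_nonneg_right (le_max_left _ _) this.le)
  · rcases eq_or_ne a a' with rfl | hne
    · simp
    have hi := h.bdd.integrable (j, ⟨a, ha⟩)
    have hi' := h.bdd.integrable (j, ⟨a', ha'⟩)
    have h1 := hC' ⟨(j, ⟨a, ha⟩, ⟨a', ha'⟩), fun h => hne (congrArg Subtype.val h)⟩
    have h2 := h.lip.scale_pos ⟨(j, ⟨a, ha⟩, ⟨a', ha'⟩), fun h => hne (congrArg Subtype.val h)⟩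
    rw [← integral_sub hi hi', mul_assoc]
    exact h1.trans (mul_le_mul_of_nonneg_right (le_max_right _ _) h2.le)

end LipMoments

/-- Deterministic functions of the variance parameter, bounded and Lipschitz on `[a₀, a₁]` uniformly
in `j`. -/
def LipCoef (a₀ a₁ : ℝ) (b : ι → ℝ → ℝ) : Prop :=
  ∃ B : ℝ, 0 ≤ B ∧ ∀ j, ∀ a ∈ Set.Icc a₀ a₁, |b j a| ≤ B ∧
    ∀ a' ∈ Set.Icc a₀ a₁, |b j a - b j a'| ≤ B * |a - a'|

namespace LipCoef

variable {b c : ι → ℝ → ℝ}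

lemma const {D : ι → ℝ} {B : ℝ} (hD : ∀ j, |D j| ≤ B) : LipCoef a₀ a₁ fun j _ => D j :=
  ⟨max B 0, le_max_right _ _, fun j _ _ => ⟨(hD j).trans (le_max_left _ _), fun a' _ => by
    rw [sub_self, abs_zero]; positivity⟩⟩

lemma id (h : 0 ≤ a₀) : LipCoef a₀ a₁ fun (_ : ι) a => a :=
  ⟨max a₁ 1, le_max_of_le_right zero_le_one, fun _ _ ha =>
    ⟨(abs_of_nonneg (h.trans ha.1)).trans_le (ha.2.trans (le_max_left _ _)), fun _ _ =>
      le_mul_of_one_le_left (abs_nonneg _) (le_max_right _ _)⟩⟩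

lemma add (hb : LipCoef a₀ a₁ b) (hc : LipCoef a₀ a₁ c) :
    LipCoef a₀ a₁ fun j a => b j a + c j a := by
  obtain ⟨B, hB0, hB⟩ := hb
  obtain ⟨C, hC0, hC⟩ := hc
  refine ⟨B + C, add_nonneg hB0 hC0, fun j a ha => ⟨?_, fun a' ha' => ?_⟩⟩
  · exact (abs_add_le _ _).trans (add_le_add (hB j a ha).1 (hC j a ha).1)
  · rw [add_sub_add_comm, add_mul]
    exact (abs_add_le _ _).trans (add_le_add ((hB j a ha).2 a' ha') ((hC j a ha).2 a' ha'))

lemma mul (hb : LipCoef a₀ a₁ b) (hc : LipCoef a₀ a₁ c) :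
    LipCoef a₀ a₁ fun j a => b j a * c j a := by
  obtain ⟨B, hB0, hB⟩ := hb
  obtain ⟨C, hC0, hC⟩ := hc
  refine ⟨max (B * C) (B * C + B * C), le_max_of_le_left (by positivity), fun j a ha =>
    ⟨?_, fun a' ha' => ?_⟩⟩
  · rw [abs_mul]
    exact (mul_le_mul (hB j a ha).1 (hC j a ha).1 (abs_nonneg _) hB0).trans (le_max_left _ _)
  · have h1 : b j a * c j a - b j a' * c j a' =
        (b j a - b j a') * c j a + b j a' * (c j a - c j a') := by ring
    rw [h1]
    refine (abs_add_le _ _).trans ?_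
    rw [abs_mul, abs_mul]
    refine le_trans ?_ (mul_le_mul_of_nonneg_right (le_max_right _ _) (abs_nonneg _))
    rw [add_mul]
    refine add_le_add ?_ ?_
    · refine (mul_le_mul ((hB j a ha).2 a' ha') (hC j a ha).1 (abs_nonneg _)
        (by positivity)).trans (le_of_eq (by ring))
    · refine (mul_le_mul (hB j a' ha').1 ((hC j a ha).2 a' ha') (abs_nonneg _)
        (by positivity)).trans (le_of_eq (by ring))

lemma inv (hb : LipCoef a₀ a₁ b) {ε : ℝ} (hε : 0 < ε)
    (hpos : ∀ j, ∀ a ∈ Set.Icc a₀ a₁, ε ≤ b j a) : LipCoef a₀ a₁ fun j a => (b j a)⁻¹ := by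
  obtain ⟨B, hB0, hB⟩ := hb
  have hle : ∀ j, ∀ a ∈ Set.Icc a₀ a₁, |(b j a)⁻¹| ≤ ε⁻¹ := fun j a ha => by
    rw [abs_of_pos (inv_pos.2 (hε.trans_le (hpos j a ha)))]
    exact inv_anti₀ hε (hpos j a ha)
  refine ⟨max ε⁻¹ (ε⁻¹ * ε⁻¹ * B), le_max_of_le_left (by positivity), fun j a ha =>
    ⟨(hle j a ha).trans (le_max_left _ _), fun a' ha' => ?_⟩⟩
  have h1 := (hε.trans_le (hpos j a ha)).ne'
  have h2 := (hε.trans_le (hpos j a' ha')).ne'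
  have h3 : (b j a)⁻¹ - (b j a')⁻¹ = -((b j a)⁻¹ * (b j a')⁻¹ * (b j a - b j a')) := by
    field_simp
    ring
  rw [h3, abs_neg, abs_mul, abs_mul]
  calc |(b j a)⁻¹| * |(b j a')⁻¹| * |b j a - b j a'| ≤ ε⁻¹ * ε⁻¹ * (B * |a - a'|) := by
        gcongr
        exacts [hle j a ha, hle j a' ha', (hB j a ha).2 a' ha']
    _ = (ε⁻¹ * ε⁻¹ * B) * |a - a'| := by ring
    _ ≤ _ := by gcongr; exact le_max_right _ _

lemma sqrt (hb : LipCoef a₀ a₁ b) {ε : ℝ} (hε : 0 < ε)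
    (hpos : ∀ j, ∀ a ∈ Set.Icc a₀ a₁, ε ≤ b j a) : LipCoef a₀ a₁ fun j a => √(b j a) := by
  obtain ⟨B, hB0, hB⟩ := hb
  have hs : 0 < √ε := by positivity
  refine ⟨max √B (B / √ε), le_max_of_le_left (by positivity), fun j a ha => ⟨?_, fun a' ha' => ?_⟩⟩
  · rw [abs_of_nonneg (Real.sqrt_nonneg _)]
    exact (Real.sqrt_le_sqrt ((le_abs_self _).trans (hB j a ha).1)).trans (le_max_left _ _)
  · have h1 : √ε ≤ √(b j a) := Real.sqrt_le_sqrt (hpos j a ha)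
    have h2 : 0 ≤ √(b j a') := Real.sqrt_nonneg _
    have h3 : |√(b j a) - √(b j a')| * (√(b j a) + √(b j a')) = |b j a - b j a'| := by
      rw [← abs_of_nonneg (a := √(b j a) + √(b j a')) (by positivity), ← abs_mul]
      congr 1
      nlinarith [Real.mul_self_sqrt (hε.le.trans (hpos j a ha)),
        Real.mul_self_sqrt (hε.le.trans (hpos j a' ha'))]
    have h4 : |√(b j a) - √(b j a')| * √ε ≤ B * |a - a'| := by
      refine le_trans ?_ ((hB j a ha).2 a' ha')
      rw [← h3]
      gcongr
      linarith
    rw [← le_div_iff₀ hs] at h4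
    refine h4.trans ?_
    rw [mul_div_right_comm]
    gcongr
    exact le_max_right _ _

lemma lipMoments (hb : LipCoef a₀ a₁ b) : LipMoments N a₀ a₁ (fun j a _ => b j a) fun _ => 1 := by
  obtain ⟨B, hB0, hB⟩ := hb
  exact .const (fun _ => one_pos) B (fun j a ha => by rw [mul_one]; exact (hB j a ha).1)
    fun j a ha a' ha' => by rw [mul_one]; exact (hB j a ha).2 a' ha'

end LipCoef

lemma LipMoments.coef_mul {X : ∀ j, ℝ → (Fin (N j) → ℝ) → ℝ} {s : ι → ℝ} {b : ι → ℝ → ℝ}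
    (hX : LipMoments N a₀ a₁ X s) (hb : LipCoef a₀ a₁ b) :
    LipMoments N a₀ a₁ (fun j a z => b j a * X j a z) s := by
  have h := hb.lipMoments.mul hX
  simpa only [one_mul] using h

end LipMoments

/-! ### The order of the estimation errors -/

/-- A regular design together with one of its areas; the bounds below are uniform over all of
these. -/
structure Setting (lo hi K : ℝ) where
  m : ℕ
  p : ℕ
  d : Design m p
  reg : d.Regular lo hi K
  i : Fin m

namespace Design

/-- The error `Â - a` of the untruncated Prasad–Rao estimator, in standard normal coordinates. -/
noncomputable def varErr (d : Design m p) (a : ℝ) (z : Fin m → ℝ) : ℝ :=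
  d.prasadRaoRaw (d.noise a z) - a

lemma isLinearMap_noise (d : Design m p) (a : ℝ) : IsLinearMap ℝ (d.noise a) :=
  ⟨fun x y => by ext j; simp [noise, mul_add], fun c x => by ext j; simp [noise]; ring⟩

lemma isLinearMap_resid (d : Design m p) (a : ℝ) : IsLinearMap ℝ (d.resid a) :=
  ⟨fun x y => by ext j; simp only [resid, Matrix.mulVec_add, Pi.add_apply]; ring,
    fun c x => by
      ext j; simp only [resid, Matrix.mulVec_smul, Pi.smul_apply, smul_eq_mul]; ring⟩

lemma isLinearMap_mulVec (M : Matrix (Fin m) (Fin m) ℝ) (i : Fin m) :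
    IsLinearMap ℝ fun v : Fin m → ℝ => (M *ᵥ v) i :=
  ⟨fun x y => by simp [Matrix.mulVec_add], fun c x => by simp [Matrix.mulVec_smul]⟩

lemma isLinearMap_comp {f : (Fin m → ℝ) → ℝ} {g : (Fin m → ℝ) → Fin m → ℝ}
    (hf : IsLinearMap ℝ f) (hg : IsLinearMap ℝ g) : IsLinearMap ℝ fun v => f (g v) :=
  (hf.mk' f ∘ₗ hg.mk' g).isLinear

lemma noise_neg (d : Design m p) (a : ℝ) (z : Fin m → ℝ) : d.noise a (-z) = -d.noise a z := by
  ext j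
  simp [noise]

lemma prasadRaoRaw_neg (d : Design m p) (y : Fin m → ℝ) :
    d.prasadRaoRaw (-y) = d.prasadRaoRaw y := by
  unfold prasadRaoRaw
  simp only [linPred_betaOLS, Matrix.mulVec_neg, Pi.neg_apply]
  congr 2
  refine Finset.sum_congr rfl fun j _ => by ring

lemma varErr_neg (d : Design m p) (a : ℝ) (z : Fin m → ℝ) : d.varErr a (-z) = d.varErr a z := by
  rw [varErr, noise_neg, prasadRaoRaw_neg, varErr]

@[fun_prop]
lemma measurable_noise (d : Design m p) (a : ℝ) : Measurable (d.noise a) := by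
  unfold noise
  fun_prop

@[fun_prop]
lemma measurable_varErr (d : Design m p) (a : ℝ) : Measurable (d.varErr a) := by
  unfold varErr
  fun_prop

namespace Regular

variable {d : Design m p} {lo hi K : ℝ}

lemma sub_pos (h : d.Regular lo hi K) : (m : ℝ) / 2 ≤ m - p ∧ (0 : ℝ) < m - p := by
  have h1 : (2 : ℝ) * p ≤ m := by exact_mod_cast h.two_mul_le
  have h2 : (0 : ℝ) < m := by exact_mod_cast h.m_pos
  constructor <;> linarith

lemma K_nonneg (h : d.Regular lo hi K) : 0 ≤ K := by
  have h1 := (h.leverage_nonneg ⟨0, h.m_pos⟩).trans (h.leverage_le _)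
  have h2 : (0 : ℝ) < m := by exact_mod_cast h.m_pos
  by_contra hc
  exact absurd (div_neg_of_neg_of_pos (not_le.1 hc) h2) (not_lt.2 h1)

/-- The estimation error of `A` as a difference of averages. -/
lemma varErr_eq (h : d.Regular lo hi K) {a : ℝ} (ha : 0 ≤ a) (z : Fin m → ℝ) :
    d.varErr a z = (m : ℝ) / (m - p) * ((∑ j, (a + d.D j) * (z j ^ 2 - 1)) / m -
      (∑ j, ((d.proj *ᵥ d.noise a z) j ^ 2 - (a + d.D j) * d.leverage j)) / m) := by
  have h1 := h.sub_pos.2.ne'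
  have h2 : (m : ℝ) ≠ 0 := by exact_mod_cast h.m_pos.ne'
  rw [varErr, prasadRaoRaw]
  simp only [linPred_betaOLS]
  rw [h.sum_sub_proj_sq]
  have h3 : ∀ j, d.noise a z j ^ 2 = (a + d.D j) * z j ^ 2 := fun j => by
    rw [noise, mul_pow, Real.sq_sqrt (h.add_pos ha j).le]
  simp only [h3, mul_sub, Finset.sum_sub_distrib, mul_one, add_mul, Finset.sum_add_distrib,
    ← Finset.mul_sum, h.sum_leverage]
  simp only [Finset.sum_const, Finset.card_univ, Fintype.card_fin, nsmul_eq_mul]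
  field_simp
  ring

lemma sum_noise_sq_le (h : d.Regular lo hi K) {a : ℝ} (ha : 0 ≤ a) (v : Fin m → ℝ) :
    ∑ j, d.noise a v j ^ 2 ≤ (a + hi) * ∑ j, v j ^ 2 := by
  rw [Finset.mul_sum]
  refine Finset.sum_le_sum fun j _ => ?_
  rw [noise, mul_pow, Real.sq_sqrt (h.add_pos ha j).le]
  have := h.le_hi j
  gcongr

lemma sum_noise_sub_sq_le (h : d.Regular lo hi K) {a b : ℝ} (ha : 0 ≤ a) (hb : 0 ≤ b)
    (v : Fin m → ℝ) :
    ∑ j, (d.noise a v - d.noise b v) j ^ 2 ≤ (lo⁻¹ * (a - b) ^ 2) * ∑ j, v j ^ 2 := by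
  have hlo := h.lo_pos
  rw [Finset.mul_sum]
  refine Finset.sum_le_sum fun j _ => ?_
  rw [Pi.sub_apply, noise, noise, ← sub_mul, mul_pow]
  gcongr
  have h1 := (h.add_pos ha j).le
  have h2 := (h.add_pos hb j).le
  have h3 : √lo ≤ √(a + d.D j) := Real.sqrt_le_sqrt (by linarith [h.lo_le j])
  have h4 := Real.sqrt_nonneg (b + d.D j)
  have h5 : (a - b) ^ 2 = (√(a + d.D j) - √(b + d.D j)) ^ 2 *
      (√(a + d.D j) + √(b + d.D j)) ^ 2 := by
    rw [← mul_pow]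
    congr 1
    nlinarith [Real.mul_self_sqrt h1, Real.mul_self_sqrt h2]
  rw [h5, ← div_eq_inv_mul, le_div_iff₀ hlo]
  gcongr
  calc lo = √lo ^ 2 := (Real.sq_sqrt hlo.le).symm
    _ ≤ _ := by
      gcongr
      linarith

lemma proj_transpose_apply (d : Design m p) (k l : Fin m) : d.proj k l = d.proj l k := by
  conv_lhs => rw [← proj_transpose d]
  rfl

lemma abs_proj_mulVec_le (h : d.Regular lo hi K) (v : Fin m → ℝ) (i : Fin m) :
    |(d.proj *ᵥ v) i| ≤ √K * √(1 / m) * √(∑ j, v j ^ 2) := by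
  have hs : 0 ≤ ∑ j, v j ^ 2 := Finset.sum_nonneg fun j _ => sq_nonneg _
  rw [← Real.sqrt_mul h.K_nonneg, ← Real.sqrt_mul (by have := h.K_nonneg; positivity)]
  refine Real.abs_le_sqrt ?_
  calc (∑ j, d.proj i j * v j) ^ 2 ≤ (∑ j, d.proj i j ^ 2) * ∑ j, v j ^ 2 :=
        Finset.sum_mul_sq_le_sq_mul_sq _ _ _
    _ ≤ (K * (1 / m)) * ∑ j, v j ^ 2 := by
        rw [h.sum_proj_sq, mul_one_div]
        gcongr
        exact h.leverage_le i

lemma integral_varErr (h : d.Regular lo hi K) {a : ℝ} (ha : 0 ≤ a) :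
    ∫ z, d.varErr a z ∂stdNormal m = 0 := by
  have hz : ∀ j : Fin m, Integrable (fun z : Fin m → ℝ => z j ^ 2) (stdNormal m) := fun j =>
    Integrable.of_integral_ne_zero (by rw [integral_sq_stdNormal]; exact one_ne_zero)
  have hlin : ∀ (c : Fin m → ℝ), Integrable (fun z : Fin m → ℝ => (∑ l, c l * z l) ^ 2)
      (stdNormal m) := fun c => by
    by_cases hc : ∑ l, c l ^ 2 = 0
    · have : ∀ l, c l = 0 := fun l => by
        have := (Finset.sum_eq_zero_iff_of_nonneg fun l _ => sq_nonneg (c l)).1 hc l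
          (Finset.mem_univ l)
        exact pow_eq_zero_iff two_ne_zero |>.1 this
      simp [this]
    · exact Integrable.of_integral_ne_zero (by rwa [integral_linear_sq_stdNormal])
  have hP : ∀ (j : Fin m) (z : Fin m → ℝ), (d.proj *ᵥ d.noise a z) j =
      ∑ l, (d.proj j l * √(a + d.D l)) * z l := fun j z => by
    simp only [Matrix.mulVec, dotProduct, noise, mul_assoc]
  have hPi : ∀ j, Integrable (fun z => (d.proj *ᵥ d.noise a z) j ^ 2) (stdNormal m) := fun j => by
    simp only [hP]
    exact hlin _
  have hPe : ∀ j, ∫ z, (d.proj *ᵥ d.noise a z) j ^ 2 ∂stdNormal m =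
      ∑ l, d.proj j l ^ 2 * (a + d.D l) := fun j => by
    simp only [hP]
    rw [integral_linear_sq_stdNormal]
    refine Finset.sum_congr rfl fun l _ => ?_
    rw [mul_pow, Real.sq_sqrt (h.add_pos ha l).le]
  have i1 : ∀ j, Integrable (fun z : Fin m → ℝ => (a + d.D j) * (z j ^ 2 - 1)) (stdNormal m) :=
    fun j => ((hz j).sub (integrable_const _)).const_mul _
  have i2 : ∀ j, Integrable (fun z => (d.proj *ᵥ d.noise a z) j ^ 2 -
      (a + d.D j) * d.leverage j) (stdNormal m) := fun j => (hPi j).sub (integrable_const _)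
  simp only [h.varErr_eq ha]
  rw [integral_const_mul, integral_sub ((integrable_finsetSum _ fun j _ => i1 j).div_const _)
    ((integrable_finsetSum _ fun j _ => i2 j).div_const _), integral_div, integral_div,
    integral_finsetSum _ fun j _ => i1 j, integral_finsetSum _ fun j _ => i2 j]
  have e1 : ∀ j, ∫ z, (a + d.D j) * (z j ^ 2 - 1) ∂stdNormal m = 0 := fun j => by
    rw [integral_const_mul, integral_sub (hz j) (integrable_const _), integral_sq_stdNormal]
    simp
  have e2 : ∑ j, ∫ z, ((d.proj *ᵥ d.noise a z) j ^ 2 - (a + d.D j) * d.leverage j)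
      ∂stdNormal m = 0 := by
    have : ∀ j, ∫ z, ((d.proj *ᵥ d.noise a z) j ^ 2 - (a + d.D j) * d.leverage j)
        ∂stdNormal m = ∑ l, d.proj j l ^ 2 * (a + d.D l) - (a + d.D j) * d.leverage j :=
      fun j => by
        rw [integral_sub (hPi j) (integrable_const _), hPe j]
        simp
    simp only [this]
    rw [Finset.sum_sub_distrib, Finset.sum_comm, sub_eq_zero]
    refine Finset.sum_congr rfl fun l _ => ?_
    rw [← Finset.sum_mul, mul_comm, ← h.sum_proj_sq]
    congr 1
    exact Finset.sum_congr rfl fun j _ => by rw [proj_transpose_apply]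
  rw [Finset.sum_eq_zero fun j _ => e1 j, e2]
  simp

end Regular

end Design

section Orders

variable {lo hi K a₀ a₁ : ℝ}

lemma Setting.m_pos (t : Setting lo hi K) : (0 : ℝ) < t.m := by exact_mod_cast t.reg.m_pos

lemma Setting.sqrt_pos (t : Setting lo hi K) : 0 < √(1 / (t.m : ℝ)) := by
  have := t.m_pos
  positivity

lemma Setting.one_div_le_sqrt (t : Setting lo hi K) : 1 / (t.m : ℝ) ≤ √(1 / (t.m : ℝ)) := by
  have h1 : (1 : ℝ) ≤ t.m := by exact_mod_cast t.reg.m_pos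
  refine Real.le_sqrt_of_sq_le ?_
  rw [sq]
  have := t.m_pos
  refine mul_le_of_le_one_left (by positivity) ?_
  rw [div_le_one this]
  exact h1

/-- Coordinates of weighted least squares fits are of order `m^{-1/2}`, with increments in the
variance parameter to match. -/
lemma lipMoments_hat (h₀ : 0 < a₀) :
    LipMoments (fun t : Setting lo hi K => t.m) a₀ a₁
      (fun t a z => (t.d.hat a *ᵥ t.d.noise a z) t.i) (fun t => √(1 / t.m)) := by
  set κ := √(hi / lo * K) with hκ
  set B₁ := κ * √(a₁ + hi) with hB₁
  set B₂ := κ * √(lo⁻¹) + κ * (lo⁻¹ * √(a₁ + hi)) with hB₂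
  have hstep : ∀ (t : Setting lo hi K), ∀ a ∈ Set.Icc a₀ a₁, ∀ v,
      √(∑ l, t.d.noise a v l ^ 2) ≤ √(a₁ + hi) * √(∑ l, v l ^ 2) := fun t a ha v => by
    have hs : 0 ≤ ∑ j, v j ^ 2 := Finset.sum_nonneg fun j _ => sq_nonneg _
    have := t.reg.hi_pos
    have h1 := h₀.le.trans ha.1
    rw [← Real.sqrt_mul (by linarith [ha.2])]
    refine Real.sqrt_le_sqrt ((t.reg.sum_noise_sq_le h1 v).trans ?_)
    gcongr
    exact ha.2
  refine .of_isLinearMap (fun t => t.sqrt_pos) (fun t a => Design.isLinearMap_comp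
    (Design.isLinearMap_mulVec _ _) (t.d.isLinearMap_noise a)) (max B₁ B₂)
    (fun t a ha v => ?_) fun t a ha a' ha' v => ?_
  · refine (t.reg.abs_hat_mulVec_le (h₀.le.trans ha.1) _ _).trans ?_
    calc κ * √(1 / t.m) * √(∑ l, t.d.noise a v l ^ 2)
        ≤ κ * √(1 / t.m) * (√(a₁ + hi) * √(∑ l, v l ^ 2)) := by gcongr; exact hstep t a ha v
      _ = B₁ * √(1 / t.m) * √(∑ l, v l ^ 2) := by rw [hB₁]; ring
      _ ≤ _ := by gcongr; exact le_max_left _ _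
  · have hlo := t.reg.lo_pos
    have h1 := h₀.le.trans ha.1
    have h2 := h₀.le.trans ha'.1
    have hs : 0 ≤ ∑ j, v j ^ 2 := Finset.sum_nonneg fun j _ => sq_nonneg _
    have e1 := congrFun (t.reg.hat_mulVec_eq h2 h1 (t.d.noise a' v)) t.i
    simp only [Pi.sub_apply, Pi.smul_apply, smul_eq_mul] at e1
    have e2 : (t.d.hat a *ᵥ t.d.noise a v) t.i - (t.d.hat a' *ᵥ t.d.noise a' v) t.i =
        (t.d.hat a *ᵥ (t.d.noise a v - t.d.noise a' v)) t.i -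
          (a - a') * (t.d.hat a *ᵥ t.d.resid a' (t.d.noise a' v)) t.i := by
      rw [Matrix.mulVec_sub, Pi.sub_apply, e1]
      ring
    rw [e2]
    have b1 : |(t.d.hat a *ᵥ (t.d.noise a v - t.d.noise a' v)) t.i| ≤
        κ * √(1 / t.m) * (√(lo⁻¹) * |a - a'| * √(∑ l, v l ^ 2)) := by
      refine (t.reg.abs_hat_mulVec_le h1 _ _).trans ?_
      gcongr
      rw [← Real.sqrt_sq_eq_abs, ← Real.sqrt_mul (by positivity), ← Real.sqrt_mul (by positivity)]
      exact Real.sqrt_le_sqrt (t.reg.sum_noise_sub_sq_le h1 h2 v)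
    have b2 : |(t.d.hat a *ᵥ t.d.resid a' (t.d.noise a' v)) t.i| ≤
        κ * √(1 / t.m) * (lo⁻¹ * (√(a₁ + hi) * √(∑ l, v l ^ 2))) := by
      refine (t.reg.abs_hat_mulVec_le h1 _ _).trans ?_
      gcongr
      refine (Real.sqrt_le_sqrt (t.reg.sum_resid_sq_le h2 _)).trans ?_
      rw [Real.sqrt_mul (by positivity), Real.sqrt_sq (by positivity)]
      gcongr
      exact hstep t a' ha' v
    refine (abs_sub _ _).trans ?_
    rw [abs_mul]
    calc _ ≤ κ * √(1 / t.m) * (√(lo⁻¹) * |a - a'| * √(∑ l, v l ^ 2)) +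
          |a - a'| * (κ * √(1 / t.m) * (lo⁻¹ * (√(a₁ + hi) * √(∑ l, v l ^ 2)))) := by gcongr
      _ = B₂ * √(1 / t.m) * |a - a'| * √(∑ l, v l ^ 2) := by rw [hB₂]; ring
      _ ≤ _ := by gcongr; exact le_max_right _ _

lemma LipMoments.of_uniformMoments {ι : Type*} {N : ι → ℕ} {a₀ a₁ : ℝ}
    {X : ∀ j, (Fin (N j) → ℝ) → ℝ} {s : ι → ℝ}
    (h : UniformMoments (fun j => stdNormal (N j)) X s) :
    LipMoments N a₀ a₁ (fun j _ z => X j z) s :=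
  ⟨h.reindex Prod.fst, (UniformMoments.const (c := fun _ => 0) (fun j => mul_pos (h.scale_pos _)
    (abs_pos.2 (sub_ne_zero.2 fun h => j.2 (Subtype.ext h)))) 0 fun j => by simp).congr
      fun j z => sub_self _⟩

lemma lipMoments_proj (h₀ : 0 < a₀) :
    LipMoments (fun t : Setting lo hi K => t.m) a₀ a₁
      (fun t a z => (t.d.proj *ᵥ t.d.noise a z) t.i) (fun t => √(1 / t.m)) := by
  set B₁ := √K * √(a₁ + hi) with hB₁
  set B₂ := √K * √(lo⁻¹) with hB₂
  refine .of_isLinearMap (fun t => t.sqrt_pos) (fun t a => Design.isLinearMap_comp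
    (Design.isLinearMap_mulVec _ _) (t.d.isLinearMap_noise a)) (max B₁ B₂)
    (fun t a ha v => ?_) fun t a ha a' ha' v => ?_
  · have hs : 0 ≤ ∑ j, v j ^ 2 := Finset.sum_nonneg fun j _ => sq_nonneg _
    have := t.reg.hi_pos
    have h1 := h₀.le.trans ha.1
    refine (t.reg.abs_proj_mulVec_le _ _).trans ?_
    calc √K * √(1 / t.m) * √(∑ l, t.d.noise a v l ^ 2)
        ≤ √K * √(1 / t.m) * (√(a₁ + hi) * √(∑ l, v l ^ 2)) := by
          gcongr
          rw [← Real.sqrt_mul (by linarith [ha.2])]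
          refine Real.sqrt_le_sqrt ((t.reg.sum_noise_sq_le h1 v).trans ?_)
          gcongr
          exact ha.2
      _ = B₁ * √(1 / t.m) * √(∑ l, v l ^ 2) := by rw [hB₁]; ring
      _ ≤ _ := by gcongr; exact le_max_left _ _
  · have hlo := t.reg.lo_pos
    have h1 := h₀.le.trans ha.1
    have h2 := h₀.le.trans ha'.1
    have e : (t.d.proj *ᵥ t.d.noise a v) t.i - (t.d.proj *ᵥ t.d.noise a' v) t.i =
        (t.d.proj *ᵥ (t.d.noise a v - t.d.noise a' v)) t.i := by
      rw [Matrix.mulVec_sub, Pi.sub_apply]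
    rw [e]
    refine (t.reg.abs_proj_mulVec_le _ _).trans ?_
    calc √K * √(1 / t.m) * √(∑ l, (t.d.noise a v - t.d.noise a' v) l ^ 2)
        ≤ √K * √(1 / t.m) * (√(lo⁻¹) * |a - a'| * √(∑ l, v l ^ 2)) := by
          gcongr
          rw [← Real.sqrt_sq_eq_abs, ← Real.sqrt_mul (by positivity),
            ← Real.sqrt_mul (by positivity)]
          exact Real.sqrt_le_sqrt (t.reg.sum_noise_sub_sq_le h1 h2 v)
      _ = B₂ * √(1 / t.m) * |a - a'| * √(∑ l, v l ^ 2) := by rw [hB₂]; ring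
      _ ≤ _ := by gcongr; exact le_max_right _ _

lemma Setting.abs_D_le (t : Setting lo hi K) (j : Fin t.m) : |t.d.D j| ≤ hi :=
  (abs_of_pos (t.reg.D_pos j)).trans_le (t.reg.le_hi j)

lemma uniformMoments_average_sq {c : ∀ t : Setting lo hi K, Fin t.m → ℝ} {b : ℝ}
    (hc : ∀ t j, |c t j| ≤ b) :
    UniformMoments (fun t : Setting lo hi K => stdNormal t.m)
      (fun t z => (∑ j, c t j * (z j ^ 2 - 1)) / t.m) (fun t => √(1 / t.m)) := by
  have h1 := UniformMoments.centered_squares (fun t : Setting lo hi K => t.reg.m_pos) hc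
  have h2 : UniformMoments (fun t : Setting lo hi K => stdNormal t.m)
      (fun t _ => 1 / (t.m : ℝ)) (fun t => 1 / (t.m : ℝ)) :=
    .const (fun t => by have := t.m_pos; positivity) 1 fun t => by
      rw [one_mul, abs_of_pos]
      have := t.m_pos
      positivity
  refine ((h1.mul h2).mono (fun t => t.sqrt_pos) 1 fun t => ?_).congr fun t z => ?_
  · have := t.m_pos
    rw [one_mul, mul_one_div, Real.sqrt_div_self', Real.sqrt_div zero_le_one, Real.sqrt_one]
  · rw [mul_one_div]

/-- The Prasad–Rao estimator is `√m`-consistent, with increments in `a` to match. -/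
lemma lipMoments_varErr (h₀ : 0 < a₀) :
    LipMoments (fun t : Setting lo hi K => t.m) a₀ a₁ (fun t a z => t.d.varErr a z)
      (fun t => √(1 / t.m)) := by
  have h1 : LipMoments (fun t : Setting lo hi K => t.m) a₀ a₁
      (fun t a z => (∑ j, t.d.D j * (z j ^ 2 - 1)) / t.m +
        a * ((∑ j, 1 * (z j ^ 2 - 1)) / t.m)) (fun t => √(1 / t.m)) :=
    (LipMoments.of_uniformMoments (uniformMoments_average_sq fun t j => t.abs_D_le j)).add
      ((LipMoments.of_uniformMoments (uniformMoments_average_sq (c := fun _ _ => 1) (b := 1)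
        fun t j => by simp)).coef_mul (.id h₀.le))
  have h2 : LipMoments (fun q : (Σ t : Setting lo hi K, Fin t.m) => q.1.m) a₀ a₁
      (fun q a z => (q.1.d.proj *ᵥ q.1.d.noise a z) q.2) (fun q => √(1 / q.1.m)) :=
    (lipMoments_proj (lo := lo) (hi := hi) (K := K) (a₁ := a₁) h₀).reindex
      fun q : (Σ t : Setting lo hi K, Fin t.m) => ⟨q.1.m, q.1.p, q.1.d, q.1.reg, q.2⟩
  have h3 : LipMoments (fun q : (Σ t : Setting lo hi K, Fin t.m) => q.1.m) a₀ a₁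
      (fun q a _ => (a + q.1.d.D q.2) * q.1.d.leverage q.2) (fun q => 1 / q.1.m) := by
    refine .const (fun q => by have := q.1.m_pos; positivity) (max ((|a₁| + hi) * K) K)
      (fun q a ha => ?_) fun q a ha a' ha' => ?_
    · have hlev := q.1.reg.leverage_le q.2
      have hpos := q.1.reg.leverage_nonneg q.2
      have := q.1.m_pos
      have := q.1.reg.hi_pos
      rw [abs_mul, abs_of_nonneg hpos]
      calc |a + q.1.d.D q.2| * q.1.d.leverage q.2 ≤ (|a₁| + hi) * (K / q.1.m) := by
            gcongr
            refine (abs_add_le _ _).trans (add_le_add ?_ (q.1.abs_D_le _))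
            rw [abs_of_pos (h₀.trans_le ha.1)]
            exact ha.2.trans (le_abs_self _)
        _ = ((|a₁| + hi) * K) * (1 / q.1.m) := by ring
        _ ≤ _ := by gcongr; exact le_max_left _ _
    · have hlev := q.1.reg.leverage_le q.2
      have hpos := q.1.reg.leverage_nonneg q.2
      have := q.1.m_pos
      rw [← sub_mul, add_sub_add_right_eq_sub, abs_mul, abs_of_nonneg hpos]
      calc |a - a'| * q.1.d.leverage q.2 ≤ |a - a'| * (K / q.1.m) := by gcongr
        _ = K * (1 / q.1.m) * |a - a'| := by ring
        _ ≤ _ := by gcongr; exact le_max_right _ _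
  have h4 := ((h2.mul h2).mono (r := fun q => 1 / (q.1.m : ℝ))
    (fun q => by have := q.1.m_pos; positivity) 1 fun q => by
      rw [Real.mul_self_sqrt (by positivity), one_mul]).sub h3
  have h5 := LipMoments.average (n := fun t : Setting lo hi K => t.m) (N := fun t => t.m)
    (Z := fun t l a z => (t.d.proj *ᵥ t.d.noise a z) l * (t.d.proj *ᵥ t.d.noise a z) l -
      (a + t.d.D l) * t.d.leverage l)
    (s := fun t => 1 / (t.m : ℝ)) (fun t => t.reg.m_pos) h4
  have h6 := h5.mono (fun t => t.sqrt_pos) 1 fun t => by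
    rw [one_mul]
    exact t.one_div_le_sqrt
  have h7 : LipCoef a₀ a₁ fun (t : Setting lo hi K) _ => (t.m : ℝ) / (t.m - t.p) :=
    .const (B := 2) fun t => by
      obtain ⟨hp1, hp2⟩ := t.reg.sub_pos
      have := t.m_pos
      rw [abs_of_pos (by positivity), div_le_iff₀ hp2]
      linarith
  refine ((h1.sub h6).coef_mul h7).congr fun t a ha z => ?_
  rw [t.reg.varErr_eq (h₀.le.trans ha.1)]
  congr 2
  · simp only [add_mul, one_mul, Finset.sum_add_distrib, add_div]
    rw [← Finset.mul_sum]
    ring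
  · simp only [sq]

lemma lipCoef_add_D (h₀ : 0 < a₀) :
    LipCoef a₀ a₁ fun (t : Setting lo hi K) a => a + t.d.D t.i :=
  (LipCoef.id h₀.le).add (.const fun t => t.abs_D_le t.i)

lemma uniformMoments_coord :
    UniformMoments (fun t : Setting lo hi K => stdNormal t.m) (fun t z => z t.i) (fun _ => 1) := by
  refine .of_isLinearMap (fun _ => one_pos) (fun t => ⟨fun x y => rfl, fun c x => rfl⟩) 1
    fun t v => ?_
  rw [one_mul, one_mul]
  exact Real.abs_le_sqrt (Finset.single_le_sum (f := fun l => v l ^ 2)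
    (fun l _ => sq_nonneg _) (Finset.mem_univ t.i))

lemma lipMoments_noise (h₀ : 0 < a₀) :
    LipMoments (fun t : Setting lo hi K => t.m) a₀ a₁ (fun t a z => t.d.noise a z t.i)
      (fun _ => 1) :=
  (LipMoments.of_uniformMoments uniformMoments_coord).coef_mul
    ((lipCoef_add_D h₀).sqrt h₀ fun t a ha => by linarith [ha.1, t.reg.D_pos t.i])

/-- Coordinates of the weighted least squares fit of the weighted residuals are small. -/
lemma uniformMoments_hat_resid (h₀ : 0 < a₀) :
    UniformMoments (fun j : Setting lo hi K × Set.Icc a₀ a₁ => stdNormal j.1.m)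
      (fun j z => (j.1.d.hat j.2 *ᵥ j.1.d.resid j.2 (j.1.d.noise j.2 z)) j.1.i)
      (fun j => √(1 / j.1.m)) := by
  refine .of_isLinearMap (fun j => j.1.sqrt_pos) (fun j => Design.isLinearMap_comp
    (Design.isLinearMap_comp (Design.isLinearMap_mulVec _ _) (j.1.d.isLinearMap_resid j.2))
      (j.1.d.isLinearMap_noise j.2)) (√(hi / lo * K) * (lo⁻¹ * √(a₁ + hi))) fun j v => ?_
  have ha := h₀.le.trans j.2.2.1
  have hlo := j.1.reg.lo_pos
  have := j.1.reg.hi_pos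
  have hs : 0 ≤ ∑ j, v j ^ 2 := Finset.sum_nonneg fun j _ => sq_nonneg _
  refine (j.1.reg.abs_hat_mulVec_le ha _ _).trans ?_
  calc _ ≤ √(hi / lo * K) * √(1 / j.1.m) * (lo⁻¹ * (√(a₁ + hi) * √(∑ l, v l ^ 2))) := by
        gcongr
        refine (Real.sqrt_le_sqrt (j.1.reg.sum_resid_sq_le ha _)).trans ?_
        rw [Real.sqrt_mul (by positivity), Real.sqrt_sq (by positivity)]
        gcongr
        rw [← Real.sqrt_mul (by linarith [j.2.2.2])]
        refine Real.sqrt_le_sqrt ((j.1.reg.sum_noise_sq_le ha v).trans ?_)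
        gcongr
        exact j.2.2.2
    _ = _ := by ring

/-- The root mean square of the data is of order one. -/
lemma uniformMoments_rms (h₀ : 0 < a₀) :
    UniformMoments (fun j : Setting lo hi K × Set.Icc a₀ a₁ => stdNormal j.1.m)
      (fun j z => √(1 / j.1.m) * √(∑ l, j.1.d.noise j.2 z l ^ 2)) (fun _ => 1) := by
  have h1 : UniformMoments
      (ι := Σ j : Setting lo hi K × Set.Icc a₀ a₁, Fin j.1.m) (fun q => stdNormal q.1.1.m)
      (fun q z => q.1.1.d.noise q.1.2 z q.2) (fun _ => 1) :=
    (lipMoments_noise (lo := lo) (hi := hi) (K := K) (a₁ := a₁) h₀).bdd.reindex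
      fun q : (Σ j : Setting lo hi K × Set.Icc a₀ a₁, Fin j.1.m) =>
        (⟨q.1.1.m, q.1.1.p, q.1.1.d, q.1.1.reg, q.2⟩, q.1.2)
  have h2 := UniformMoments.average (N := fun j : Setting lo hi K × Set.Icc a₀ a₁ => j.1.m)
    (μ := fun j => stdNormal j.1.m)
    (Z := fun j l z => j.1.d.noise j.2 z l * j.1.d.noise j.2 z l)
    (s := fun _ => (1 : ℝ) * 1) (fun j => j.1.reg.m_pos) (h1.mul h1)
  have h3 := (h2.mono (fun _ => one_pos) 1 fun _ => by norm_num).add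
    (.const (c := fun _ => 1) (fun _ => one_pos) 1 fun _ => by simp)
  refine h3.of_abs_le (fun j => by
    have := j.1.d.measurable_noise j.2
    fun_prop) (fun _ => one_pos) (c := 1) (b := 1) (fun j z => ?_) fun _ => by simp
  have hm := j.1.m_pos
  have hs : 0 ≤ ∑ l, j.1.d.noise j.2 z l ^ 2 := Finset.sum_nonneg fun l _ => sq_nonneg _
  set A := (∑ l, j.1.d.noise j.2 z l ^ 2) / j.1.m with hA
  have hA0 : 0 ≤ A := by positivity
  have e : (∑ l, j.1.d.noise j.2 z l * j.1.d.noise j.2 z l) / (j.1.m : ℝ) = A := by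
    simp only [hA, sq]
  rw [← Real.sqrt_mul (by positivity), one_div_mul_eq_div, ← hA, one_mul,
    abs_of_nonneg (Real.sqrt_nonneg _), abs_of_nonneg (by rw [e]; positivity), e]
  rw [Real.sqrt_le_left (by positivity)]
  nlinarith

end Orders

/-! ### The standard normal distribution function -/

/-- The standard normal density. -/
noncomputable def normalPDF (x : ℝ) : ℝ := gaussianPDFReal 0 1 x

lemma normalPDF_eq (x : ℝ) : normalPDF x = (√(2 * Real.pi))⁻¹ * Real.exp (-x ^ 2 / 2) := by
  simp [normalPDF, gaussianPDFReal]

lemma normalPDF_pos (x : ℝ) : 0 < normalPDF x := gaussianPDFReal_pos _ _ _ one_ne_zero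

lemma inv_sqrt_two_pi_le : (√(2 * Real.pi))⁻¹ ≤ 1 := by
  refine inv_le_one_of_one_le₀ (Real.one_le_sqrt.2 ?_)
  linarith [Real.pi_gt_three]

lemma normalPDF_le_one (x : ℝ) : normalPDF x ≤ 1 := by
  rw [normalPDF_eq]
  refine mul_le_one₀ inv_sqrt_two_pi_le (Real.exp_pos _).le (Real.exp_le_one_iff.2 ?_)
  nlinarith [sq_nonneg x]

lemma hasDerivAt_normalPDF (x : ℝ) : HasDerivAt normalPDF (-x * normalPDF x) x := by
  have h1 : HasDerivAt (fun y : ℝ => (√(2 * Real.pi))⁻¹ * Real.exp (-y ^ 2 / 2))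
      ((√(2 * Real.pi))⁻¹ * (Real.exp (-x ^ 2 / 2) * (-(2 * x) / 2))) x := by
    refine (HasDerivAt.exp ?_).const_mul _
    have := ((hasDerivAt_pow 2 x).neg).div_const 2
    simpa using this
  have h2 : normalPDF = fun y : ℝ => (√(2 * Real.pi))⁻¹ * Real.exp (-y ^ 2 / 2) :=
    funext normalPDF_eq
  rw [h2]
  convert h1 using 1
  ring

lemma continuous_normalPDF : Continuous normalPDF :=
  continuous_iff_continuousAt.2 fun x => (hasDerivAt_normalPDF x).continuousAt

lemma hasDerivAt_Φ (x : ℝ) : HasDerivAt Φ (normalPDF x) x := by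
  have hint : Integrable normalPDF := integrable_gaussianPDFReal 0 1
  have h1 : ∀ y, Φ y = Φ 0 + ∫ u in (0 : ℝ)..y, normalPDF u := fun y => by
    have h2 : ∀ w, Φ w = ∫ u in Set.Iic w, normalPDF u := fun w => by
      rw [Φ, cdf_eq_real, measureReal_def, gaussianReal_apply_eq_integral _ one_ne_zero,
        ENNReal.toReal_ofReal (integral_nonneg fun u => gaussianPDFReal_nonneg _ _ _)]
      rfl
    rw [h2, h2, intervalIntegral.integral_Iic_sub_Iic hint.integrableOn hint.integrableOn |>.symm]
    ring
  have h3 : HasDerivAt (fun y => Φ 0 + ∫ u in (0 : ℝ)..y, normalPDF u) (normalPDF x) x :=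
    (intervalIntegral.integral_hasDerivAt_right (continuous_normalPDF.intervalIntegrable _ _)
      (continuous_normalPDF.stronglyMeasurableAtFilter _ _)
      continuous_normalPDF.continuousAt).const_add _
  exact h3.congr_of_eventuallyEq (Eventually.of_forall h1)

lemma continuous_Φ : Continuous Φ :=
  continuous_iff_continuousAt.2 fun x => (hasDerivAt_Φ x).continuousAt

lemma abs_sub_le_of_hasDerivAt {f f' : ℝ → ℝ} (hf : ∀ x, HasDerivAt f (f' x) x) {a b C : ℝ}
    (hC : ∀ x ∈ Set.uIcc a b, |f' x| ≤ C) : |f b - f a| ≤ C * |b - a| :=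
  (convex_uIcc a b).norm_image_sub_le_of_norm_hasDerivWithin_le
    (fun x _ => (hf x).hasDerivWithinAt) hC Set.left_mem_uIcc Set.right_mem_uIcc

lemma abs_sub_left_le_of_mem_uIcc {a b x : ℝ} (h : x ∈ Set.uIcc a b) : |x - a| ≤ |b - a| :=
  Set.abs_sub_left_of_mem_uIcc h

lemma abs_Φ_sub_le (x y : ℝ) : |Φ y - Φ x| ≤ |y - x| := by
  simpa using abs_sub_le_of_hasDerivAt hasDerivAt_Φ (a := x) (b := y) (C := 1) fun u _ => by
    rw [abs_of_pos (normalPDF_pos u)]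
    exact normalPDF_le_one u

/-- Second-order Taylor expansion of the normal distribution function. -/
lemma abs_Φ_taylor_le (q x : ℝ) :
    |Φ (q + x) - (Φ q + normalPDF q * x - q * normalPDF q / 2 * x ^ 2)| ≤ 2 * |x| ^ 3 := by
  have hd3 : ∀ y, HasDerivAt (fun y => -y * normalPDF y) ((y ^ 2 - 1) * normalPDF y) y :=
    fun y => by
      have := (hasDerivAt_id y).neg.mul (hasDerivAt_normalPDF y)
      exact this.congr_deriv (by simp only [Pi.neg_apply, id]; ring)
  have hb3 : ∀ y, |(y ^ 2 - 1) * normalPDF y| ≤ 2 := fun y => by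
    rw [abs_mul, abs_of_pos (normalPDF_pos y), normalPDF_eq]
    have h1 : |y ^ 2 - 1| ≤ 2 * Real.exp (y ^ 2 / 2) := by
      have := Real.add_one_le_exp (y ^ 2 / 2)
      rw [abs_le]
      constructor <;> nlinarith [sq_nonneg y]
    have h2 : Real.exp (y ^ 2 / 2) * Real.exp (-y ^ 2 / 2) = 1 := by
      rw [← Real.exp_add, ← Real.exp_zero]
      congr 1
      ring
    have h4 : 0 < (√(2 * Real.pi))⁻¹ := by positivity
    calc |y ^ 2 - 1| * ((√(2 * Real.pi))⁻¹ * Real.exp (-y ^ 2 / 2))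
        ≤ 2 * Real.exp (y ^ 2 / 2) * ((√(2 * Real.pi))⁻¹ * Real.exp (-y ^ 2 / 2)) := by gcongr
      _ = 2 * (√(2 * Real.pi))⁻¹ * (Real.exp (y ^ 2 / 2) * Real.exp (-y ^ 2 / 2)) := by ring
      _ ≤ 2 := by rw [h2]; linarith [inv_sqrt_two_pi_le]
  have h2 : ∀ y ∈ Set.uIcc q (q + x), |-y * normalPDF y - -q * normalPDF q| ≤ 2 * |x| :=
    fun y hy => by
      refine (abs_sub_le_of_hasDerivAt hd3 fun u _ => hb3 u).trans ?_
      have := abs_sub_left_le_of_mem_uIcc hy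
      rw [add_sub_cancel_left] at this
      gcongr
  have h1 : ∀ y ∈ Set.uIcc q (q + x),
      |normalPDF y - normalPDF q - -q * normalPDF q * (y - q)| ≤ 2 * |x| ^ 2 := fun y hy => by
    have hd : ∀ y, HasDerivAt (fun y => normalPDF y - -q * normalPDF q * (y - q))
        (-y * normalPDF y - -q * normalPDF q) y := fun y => by
      have := (hasDerivAt_normalPDF y).sub
        (((hasDerivAt_id y).sub_const q).const_mul (-q * normalPDF q))
      exact this.congr_deriv (by ring)
    have h := abs_sub_le_of_hasDerivAt hd (a := q) (b := y) (C := 2 * |x|) fun u hu =>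
      h2 u (Set.uIcc_subset_uIcc_left hy hu)
    have hy' := abs_sub_left_le_of_mem_uIcc hy
    rw [add_sub_cancel_left] at hy'
    calc _ = |normalPDF y - -q * normalPDF q * (y - q) -
          (normalPDF q - -q * normalPDF q * (q - q))| := by congr 1; ring
      _ ≤ 2 * |x| * |y - q| := h
      _ ≤ 2 * |x| * |x| := by gcongr
      _ = _ := by ring
  have hd : ∀ y, HasDerivAt
      (fun y => Φ y - (normalPDF q * (y - q) + -q * normalPDF q * (y - q) ^ 2 / 2))
      (normalPDF y - normalPDF q - -q * normalPDF q * (y - q)) y := fun y => by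
    have e1 := ((hasDerivAt_id y).sub_const q)
    have := (hasDerivAt_Φ y).sub ((e1.const_mul (normalPDF q)).add
      (((e1.pow 2).const_mul (-q * normalPDF q)).div_const 2))
    exact this.congr_deriv (by simp only [id]; norm_num; ring)
  have h := abs_sub_le_of_hasDerivAt hd h1
  calc _ = _ := by congr 1; ring
    _ ≤ 2 * |x| ^ 2 * |q + x - q| := h
    _ = _ := by rw [add_sub_cancel_left]; ring

/-! ### Expansions in the estimation error of the variance parameter -/

/-- First coefficient in the expansion of `√(g₁(a + V) / g₁(a))` in powers of `V`. -/
noncomputable def sdCoef₁ (a D : ℝ) : ℝ := D * (2⁻¹ * (a⁻¹ * (a + D)⁻¹))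

/-- Second coefficient in the expansion of `√(g₁(a + V) / g₁(a))` in powers of `V`. -/
noncomputable def sdCoef₂ (a D : ℝ) : ℝ :=
  (a + D)⁻¹ * (a + D)⁻¹ * (-2⁻¹ * (D * a⁻¹) + -8⁻¹ * ((D * a⁻¹) * (D * a⁻¹)))

lemma abs_sqrt_one_add_sub_le {r : ℝ} (hr : -1 ≤ r) :
    |√(1 + r) - 1 - (r / 2 - r ^ 2 / 8)| ≤ |r| ^ 3 := by
  set s := √(1 + r) with hs
  have hs0 : 0 ≤ s := Real.sqrt_nonneg _
  have hr' : r = s ^ 2 - 1 := by rw [hs, Real.sq_sqrt (by linarith)]; ring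
  have h1 : s - 1 - (r / 2 - r ^ 2 / 8) = (s - 1) ^ 3 * ((s + 3) / 8) := by rw [hr']; ring
  have h2 : |r| ^ 3 = |(s - 1) ^ 3| * (s + 1) ^ 3 := by
    rw [hr', ← abs_pow, show (s ^ 2 - 1) ^ 3 = (s - 1) ^ 3 * (s + 1) ^ 3 by ring, abs_mul,
      abs_of_nonneg (a := (s + 1) ^ 3) (by positivity)]
  rw [h1, h2, abs_mul, abs_of_nonneg (a := (s + 3) / 8) (by positivity)]
  gcongr
  nlinarith [mul_nonneg hs0 hs0, mul_nonneg hs0 (mul_nonneg hs0 hs0)]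

/-- Expansion of the estimated standard deviation `√g₁`. -/
lemma abs_sqrt_g1_ratio_sub_le {a D V : ℝ} (ha : 0 < a) (hD : 0 < D) (hV : |V| ≤ a / 2) :
    |√((a + V) * D / (a + V + D)) / √(a * D / (a + D)) -
      (1 + sdCoef₁ a D * V + sdCoef₂ a D * V ^ 2)| ≤ 2 / a ^ 3 * |V| ^ 3 := by
  obtain ⟨hV1, hV2⟩ := abs_le.1 hV
  set u := a + D with hu
  have hupos : 0 < u := by positivity
  have huV : 0 < u + V := by linarith
  have hDle : D ≤ u + V := by linarith
  have hale : a ≤ u := by linarith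
  set r := V * D / (a * (u + V)) with hr
  have e1 : √((a + V) * D / (a + V + D)) / √(a * D / u) = √(1 + r) := by
    rw [← Real.sqrt_div (div_nonneg (mul_nonneg (by linarith) hD.le) (by linarith))]
    congr 1
    have h1 : a + V + D = u + V := by rw [hu]; ring
    rw [h1, hr]
    field_simp
    rw [hu]
    ring
  have hrabs : |r| ≤ |V| / a := by
    rw [hr, abs_div, abs_mul, abs_of_pos hD, abs_of_pos (by positivity : 0 < a * (u + V)),
      div_le_div_iff₀ (by positivity) ha]
    have := mul_le_mul_of_nonneg_left hDle (mul_nonneg (abs_nonneg V) ha.le)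
    linarith
  have hr1 : -1 ≤ r := by
    have h2 : |r| ≤ 1 / 2 := hrabs.trans (by rw [div_le_iff₀ ha]; linarith)
    linarith [(abs_le.1 h2).1]
  have e2 : r / 2 - r ^ 2 / 8 - (sdCoef₁ a D * V + sdCoef₂ a D * V ^ 2) =
      D / (u + V) * (1 / (2 * (a * u ^ 2))) * V ^ 3 +
        (D / (u + V)) ^ 2 * ((2 * u + V) / (8 * (a ^ 2 * u ^ 2))) * V ^ 3 := by
    rw [hr, sdCoef₁, sdCoef₂, ← hu]
    field_simp
    ring
  have hDu : D / (u + V) ≤ 1 := (div_le_one huV).2 hDle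
  have hDu0 : 0 ≤ D / (u + V) := by positivity
  have b1 : 1 / (2 * (a * u ^ 2)) ≤ 1 / (2 * a ^ 3) := by
    rw [show a ^ 3 = a * a ^ 2 by ring]
    gcongr
  have b2 : (2 * u + V) / (8 * (a ^ 2 * u ^ 2)) ≤ 3 / (8 * a ^ 3) := by
    rw [div_le_div_iff₀ (by positivity) (by positivity)]
    have h1 : 2 * u + V ≤ 3 * u := by linarith
    have h2 : (2 * u + V) * (8 * a ^ 3) ≤ 3 * u * (8 * a ^ 3) := by gcongr
    have h3 : 3 * u * (8 * a ^ 3) ≤ 3 * (8 * (a ^ 2 * u ^ 2)) := by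
      have : a * (a ^ 2 * u) ≤ u * (a ^ 2 * u) := by gcongr
      nlinarith
    exact h2.trans h3
  have b2' : 0 ≤ (2 * u + V) / (8 * (a ^ 2 * u ^ 2)) := div_nonneg (by linarith) (by positivity)
  have h3 : |r / 2 - r ^ 2 / 8 - (sdCoef₁ a D * V + sdCoef₂ a D * V ^ 2)| ≤
      (1 / (2 * a ^ 3) + 3 / (8 * a ^ 3)) * |V| ^ 3 := by
    rw [e2, ← add_mul, abs_mul, abs_pow]
    gcongr
    rw [abs_of_nonneg (by positivity)]
    refine add_le_add ?_ ?_
    · exact (mul_le_mul hDu b1 (by positivity) zero_le_one).trans (one_mul _).le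
    · exact (mul_le_mul (pow_le_one₀ hDu0 hDu) b2 b2' zero_le_one).trans (one_mul _).le
  have h4 := abs_sqrt_one_add_sub_le hr1
  have h5 : |r| ^ 3 ≤ 1 / a ^ 3 * |V| ^ 3 := by
    refine (pow_le_pow_left₀ (abs_nonneg _) hrabs 3).trans (le_of_eq ?_)
    rw [div_pow]
    ring
  rw [e1]
  calc |√(1 + r) - (1 + sdCoef₁ a D * V + sdCoef₂ a D * V ^ 2)|
      = |(√(1 + r) - 1 - (r / 2 - r ^ 2 / 8)) +
          (r / 2 - r ^ 2 / 8 - (sdCoef₁ a D * V + sdCoef₂ a D * V ^ 2))| := by congr 1; ring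
    _ ≤ 1 / a ^ 3 * |V| ^ 3 + (1 / (2 * a ^ 3) + 3 / (8 * a ^ 3)) * |V| ^ 3 :=
        (abs_add_le _ _).trans (add_le_add (h4.trans h5) h3)
    _ = 15 / 8 / a ^ 3 * |V| ^ 3 := by field_simp; ring
    _ ≤ 2 / a ^ 3 * |V| ^ 3 := by gcongr; norm_num

/-- The quadratic approximation of `Φ(T + q (1 + ρ))` in the prediction error `T ≈ ℓ` and the
relative error `ρ ≈ c₁ V + c₂ V²` of the standard deviation. -/
noncomputable def normalApprox (q c₁ c₂ V T ℓ : ℝ) : ℝ :=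
  Φ q + normalPDF q * (T + q * (c₁ * V + c₂ * V ^ 2)) -
    q * normalPDF q / 2 * (ℓ + q * c₁ * V) ^ 2

lemma abs_Φ_sub_normalApprox_le {q M c c₁ c₂ V T ℓ ρ E : ℝ} (hM : 0 ≤ M) (hq : |q| ≤ M)
    (hc : 1 ≤ c) (hc₁ : |c₁| ≤ c) (hc₂ : |c₂| ≤ c) (hV : |V| ≤ c) (hE : 0 ≤ E)
    (hT : |T - ℓ| ≤ c * E) (hρ : |ρ - (c₁ * V + c₂ * V ^ 2)| ≤ c * |V| ^ 3) :
    |Φ (q + (T + q * ρ)) - normalApprox q c₁ c₂ V T ℓ| ≤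
      (M * c + 2 * (c * (1 + M) * (1 + c)) ^ 3) * (|ℓ| + |V| + (E + V ^ 2)) ^ 3 +
        M * (c * (1 + M) * (1 + c)) ^ 2 *
          ((E + V ^ 2) * (|ℓ| + |V| + (E + V ^ 2))) := by
  set k := c * (1 + M) * (1 + c) with hk
  set Λ := |ℓ| + |V| with hΛ
  set E' := E + V ^ 2 with hE'
  set x := T + q * ρ with hx
  set L := ℓ + q * c₁ * V with hL
  have hc0 : 0 ≤ c := by linarith
  have hE'0 : 0 ≤ E' := by positivity
  have hΛ0 : 0 ≤ Λ := by positivity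
  have hk1 : 1 ≤ k := by
    have h1 : 1 ≤ c * (1 + M) := by nlinarith
    nlinarith
  have hV2 : |V| ^ 2 = V ^ 2 := sq_abs V
  have hρ1 : |ρ - c₁ * V| ≤ c * (1 + c) * V ^ 2 := by
    have h1 : ρ - c₁ * V = (ρ - (c₁ * V + c₂ * V ^ 2)) + c₂ * V ^ 2 := by ring
    rw [h1]
    refine (abs_add_le _ _).trans ?_
    rw [abs_mul, abs_of_nonneg (sq_nonneg V)]
    have h2 : c * |V| ^ 3 ≤ c * (c * V ^ 2) := by
      rw [pow_succ' |V| 2, hV2]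
      gcongr
    have h3 : |c₂| * V ^ 2 ≤ c * V ^ 2 := by gcongr
    calc _ ≤ c * (c * V ^ 2) + c * V ^ 2 := add_le_add (hρ.trans h2) h3
      _ = _ := by ring
  have hxL : |x - L| ≤ k * E' := by
    have h1 : x - L = (T - ℓ) + q * (ρ - c₁ * V) := by rw [hx, hL]; ring
    rw [h1]
    refine (abs_add_le _ _).trans ?_
    rw [abs_mul]
    have h2 : |q| * |ρ - c₁ * V| ≤ M * (c * (1 + c) * V ^ 2) := by gcongr
    have h3 : c * E ≤ k * E := by
      have : c ≤ k := by
        rw [hk, mul_assoc]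
        exact le_mul_of_one_le_right hc0 (by nlinarith)
      gcongr
    have h4 : M * (c * (1 + c) * V ^ 2) ≤ k * V ^ 2 := by
      have : M * (c * (1 + c)) ≤ k := by rw [hk]; nlinarith [mul_nonneg hc0 (by linarith : 0 ≤ 1 + c)]
      calc _ = M * (c * (1 + c)) * V ^ 2 := by ring
        _ ≤ _ := by gcongr
    calc _ ≤ k * E + k * V ^ 2 := add_le_add (hT.trans h3) (h2.trans h4)
      _ = _ := by rw [hE']; ring
  have hLabs : |L| ≤ k * Λ := by
    rw [hL]
    refine (abs_add_le _ _).trans ?_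
    rw [abs_mul, abs_mul]
    have h2 : |q| * |c₁| * |V| ≤ M * c * |V| := by gcongr
    have h3 : M * c ≤ k := by rw [hk]; nlinarith [mul_nonneg hM hc0, mul_nonneg hc0 hc0]
    have h4 : M * c * |V| ≤ k * |V| := by gcongr
    have h5 : |ℓ| ≤ k * |ℓ| := le_mul_of_one_le_left (abs_nonneg _) hk1
    rw [hΛ]
    linarith
  have hxabs : |x| ≤ k * (Λ + E') := by
    have : x = L + (x - L) := by ring
    rw [this]
    refine (abs_add_le _ _).trans ?_
    linarith
  have hpdf := normalPDF_le_one q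
  have hpdf0 := (normalPDF_pos q).le
  have hdecomp : Φ (q + x) - normalApprox q c₁ c₂ V T ℓ =
      (Φ (q + x) - (Φ q + normalPDF q * x - q * normalPDF q / 2 * x ^ 2)) +
        q * normalPDF q * (ρ - (c₁ * V + c₂ * V ^ 2)) -
          q * normalPDF q / 2 * ((x - L) * (x + L)) := by
    rw [normalApprox, ← hL, hx]
    ring
  rw [hdecomp]
  have t1 := abs_Φ_taylor_le q x
  have t1' : 2 * |x| ^ 3 ≤ 2 * k ^ 3 * (Λ + E') ^ 3 := by
    calc 2 * |x| ^ 3 ≤ 2 * (k * (Λ + E')) ^ 3 := by gcongr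
      _ = _ := by ring
  have hqp : |q * normalPDF q| ≤ M := by
    rw [abs_mul, abs_of_nonneg hpdf0]
    exact (mul_le_mul hq hpdf hpdf0 hM).trans (mul_one _).le
  have t2 : |q * normalPDF q * (ρ - (c₁ * V + c₂ * V ^ 2))| ≤ M * c * (Λ + E') ^ 3 := by
    rw [abs_mul]
    calc _ ≤ M * (c * |V| ^ 3) := by gcongr
      _ ≤ M * (c * (Λ + E') ^ 3) := by
          gcongr
          rw [hΛ]
          linarith [abs_nonneg ℓ]
      _ = _ := by ring
  have t3 : |q * normalPDF q / 2 * ((x - L) * (x + L))| ≤ M * k ^ 2 * (E' * (Λ + E')) := by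
    have hxL' : |x + L| ≤ 2 * (k * (Λ + E')) := by
      refine (abs_add_le _ _).trans ?_
      have : k * Λ ≤ k * (Λ + E') := by gcongr; linarith
      linarith
    rw [abs_mul, abs_mul, abs_div, abs_two]
    calc |q * normalPDF q| / 2 * (|x - L| * |x + L|)
        ≤ M / 2 * ((k * E') * (2 * (k * (Λ + E')))) := by gcongr
      _ = _ := by ring
  refine (abs_sub _ _).trans ((add_le_add (abs_add_le _ _) le_rfl).trans ?_)
  linarith

lemma abs_normalApprox_le {q M c c₁ c₂ V ℓ E b : ℝ} (hM : 0 ≤ M) (hq : |q| ≤ M)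
    (hc : 1 ≤ c) (hc₁ : |c₁| ≤ c) (hc₂ : |c₂| ≤ c) (hE : 0 ≤ E) (hb : 0 < b) (hV : b ≤ |V|) :
    |normalApprox q c₁ c₂ V 0 ℓ| ≤
      (b⁻¹ ^ 3 + M * c * (b⁻¹ ^ 2 + b⁻¹) + M * (c * (1 + M) * (1 + c)) ^ 2 * b⁻¹) *
        (|ℓ| + |V| + (E + V ^ 2)) ^ 3 := by
  set k := c * (1 + M) * (1 + c) with hk
  set S := |ℓ| + |V| + (E + V ^ 2) with hS
  have hc0 : 0 ≤ c := by linarith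
  have hVS : |V| ≤ S := by
    rw [hS]
    nlinarith [abs_nonneg ℓ, sq_nonneg V]
  have hS0 : 0 ≤ S := (abs_nonneg V).trans hVS
  have hbS : 1 ≤ b⁻¹ * S := by
    rw [← div_eq_inv_mul, one_le_div hb]
    exact hV.trans hVS
  have hk1 : 1 ≤ k := by
    have h1 : 1 ≤ c * (1 + M) := by nlinarith
    nlinarith
  have hL : |ℓ + q * c₁ * V| ≤ k * S := by
    refine (abs_add_le _ _).trans ?_
    rw [abs_mul, abs_mul]
    have h2 : |q| * |c₁| * |V| ≤ M * c * |V| := by gcongr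
    have h3 : M * c ≤ k := by rw [hk]; nlinarith [mul_nonneg hM hc0, mul_nonneg hc0 hc0]
    have h4 : M * c * |V| ≤ k * |V| := by gcongr
    have h5 : |ℓ| ≤ k * |ℓ| := le_mul_of_one_le_left (abs_nonneg _) hk1
    have h6 : k * (|ℓ| + |V|) ≤ k * S := by
      gcongr
      rw [hS]
      linarith [sq_nonneg V]
    linarith
  have hpdf := normalPDF_le_one q
  have hpdf0 := (normalPDF_pos q).le
  have hqp : |q * normalPDF q| ≤ M := by
    rw [abs_mul, abs_of_nonneg hpdf0]
    exact (mul_le_mul hq hpdf hpdf0 hM).trans (mul_one _).le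
  have e : normalApprox q c₁ c₂ V 0 ℓ = Φ q + q * normalPDF q * (c₁ * V + c₂ * V ^ 2) -
      q * normalPDF q / 2 * (ℓ + q * c₁ * V) ^ 2 := by
    rw [normalApprox]
    ring
  have t1 : |Φ q| ≤ b⁻¹ ^ 3 * S ^ 3 := by
    rw [abs_of_nonneg (Φ_nonneg q), ← mul_pow]
    exact (Φ_le_one q).trans (one_le_pow₀ hbS)
  have t2 : |q * normalPDF q * (c₁ * V + c₂ * V ^ 2)| ≤ M * c * (b⁻¹ ^ 2 + b⁻¹) * S ^ 3 := by
    rw [abs_mul]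
    have h1 : |c₁ * V + c₂ * V ^ 2| ≤ c * (S + S ^ 2) := by
      refine (abs_add_le _ _).trans ?_
      rw [abs_mul, abs_mul, abs_pow, mul_add]
      gcongr
    have h2 : S ≤ b⁻¹ ^ 2 * S ^ 3 := by
      calc S = S * 1 := (mul_one _).symm
        _ ≤ S * (b⁻¹ * S) ^ 2 := by gcongr; exact one_le_pow₀ hbS
        _ = _ := by ring
    have h3 : S ^ 2 ≤ b⁻¹ * S ^ 3 := by
      calc S ^ 2 = S ^ 2 * 1 := (mul_one _).symm
        _ ≤ S ^ 2 * (b⁻¹ * S) := by gcongr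
        _ = _ := by ring
    calc _ ≤ M * (c * (b⁻¹ ^ 2 * S ^ 3 + b⁻¹ * S ^ 3)) := by
          refine mul_le_mul hqp (h1.trans ?_) (abs_nonneg _) hM
          gcongr
      _ = _ := by ring
  have t3 : |q * normalPDF q / 2 * (ℓ + q * c₁ * V) ^ 2| ≤ M * k ^ 2 * b⁻¹ * S ^ 3 := by
    rw [abs_mul, abs_div, abs_two, abs_pow]
    calc |q * normalPDF q| / 2 * |ℓ + q * c₁ * V| ^ 2 ≤ M * (k * S) ^ 2 := by
          gcongr
          linarith [abs_nonneg (q * normalPDF q)]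
      _ = M * k ^ 2 * (S ^ 2 * 1) := by ring
      _ ≤ M * k ^ 2 * (S ^ 2 * (b⁻¹ * S)) := by gcongr
      _ = _ := by ring
  rw [e]
  refine (abs_sub _ _).trans ((add_le_add (abs_add_le _ _) le_rfl).trans ?_)
  linarith

/-! ### Expansion of the distribution of the studentized prediction error -/

namespace Design

/-- `(θ̂ᵢ - θ̃ᵢ) / √g₁ᵢ`, in standard normal coordinates. -/
noncomputable def predErr (d : Design m p) (τ : ℝ) (i : Fin m) (a : ℝ) (z : Fin m → ℝ) : ℝ :=
  (d.eblup τ i (d.noise a z) - (1 - d.shrink a i) * d.noise a z i) / √(d.g1 a i)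

/-- `√ĝ₁ᵢ / √g₁ᵢ`, in standard normal coordinates. -/
noncomputable def sdRatio (d : Design m p) (τ : ℝ) (i : Fin m) (a : ℝ) (z : Fin m → ℝ) : ℝ :=
  √(d.g1 (d.AHat τ (d.noise a z)) i) / √(d.g1 a i)

/-- Coefficient of `V (yᵢ - xᵢ'β)` in the linearized prediction error. -/
noncomputable def errCoef₁ (d : Design m p) (i : Fin m) (a : ℝ) : ℝ :=
  d.D i * ((a + d.D i)⁻¹ * (a + d.D i)⁻¹) * (√(d.g1 a i))⁻¹

/-- Coefficient of the regression error in the linearized prediction error. -/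
noncomputable def errCoef₂ (d : Design m p) (i : Fin m) (a : ℝ) : ℝ :=
  d.D i * (a + d.D i)⁻¹ * (√(d.g1 a i))⁻¹

/-- The leading term of the prediction error `(θ̂ᵢ - θ̃ᵢ) / √g₁ᵢ`. -/
noncomputable def linErr (d : Design m p) (i : Fin m) (a : ℝ) (z : Fin m → ℝ) : ℝ :=
  d.errCoef₁ i a * (d.varErr a z * d.noise a z i) +
    d.errCoef₂ i a * (d.hat a *ᵥ d.noise a z) i

/-- A bound, up to a constant, for the error of the linearization `linErr`. -/
noncomputable def remErr (d : Design m p) (i : Fin m) (a : ℝ) (z : Fin m → ℝ) : ℝ :=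
  d.varErr a z * d.varErr a z * |d.noise a z i| + |d.varErr a z| * |(d.hat a *ᵥ d.noise a z) i| +
    |d.varErr a z| * |(d.hat a *ᵥ d.resid a (d.noise a z)) i| +
      d.varErr a z * d.varErr a z * (√(1 / m) * √(∑ l, d.noise a z l ^ 2))

lemma remErr_nonneg (d : Design m p) (i : Fin m) (a : ℝ) (z : Fin m → ℝ) :
    0 ≤ d.remErr i a z := by
  unfold remErr
  have := mul_self_nonneg (d.varErr a z)
  positivity

lemma AHat_noise_of_le (d : Design m p) (τ : ℝ) {a : ℝ} (ha : 0 < a) {z : Fin m → ℝ}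
    (hV : |d.varErr a z| ≤ a / 2) : d.AHat τ (d.noise a z) = a + d.varErr a z := by
  have h1 : d.prasadRaoRaw (d.noise a z) = a + d.varErr a z := by rw [varErr]; ring
  have h2 : 0 < a + d.varErr a z := by linarith [(abs_le.1 hV).1]
  rw [AHat, if_pos (h1 ▸ h2), h1]

namespace Regular

variable {d : Design m p} {lo hi K : ℝ}

lemma measurable_predErr (h : d.Regular lo hi K) {τ : ℝ} (hτ : 0 ≤ τ) (i : Fin m) (a : ℝ) :
    Measurable (d.predErr τ i a) := by
  have h1 : Measurable fun z => d.eblup τ i (d.noise a z) :=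
    (h.measurable_eblup hτ i).comp (d.measurable_noise a)
  have h2 := d.measurable_noise a
  unfold predErr
  fun_prop

lemma measurable_sdRatio (d : Design m p) (τ : ℝ) (i : Fin m) (a : ℝ) :
    Measurable (d.sdRatio τ i a) := by
  have h1 := d.measurable_AHat τ
  have h2 := d.measurable_noise a
  unfold sdRatio g1
  fun_prop

lemma g1_pos (h : d.Regular lo hi K) {a : ℝ} (ha : 0 < a) (i : Fin m) : 0 < d.g1 a i := by
  have := h.D_pos i
  unfold g1
  positivity

/-- Linearization of the prediction error where `Â` is close to `a`. -/
lemma abs_predErr_sub_le (h : d.Regular lo hi K) {τ : ℝ} (hτ : 0 ≤ τ) (i : Fin m) {a : ℝ}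
    (ha : 0 < a) {z : Fin m → ℝ} (hV : |d.varErr a z| ≤ a / 2) :
    |d.predErr τ i a z - d.linErr i a z| ≤
      (a⁻¹ ^ 2 + a⁻¹ + 1 + √(hi / lo * K) * lo⁻¹ ^ 2) / √(d.g1 a i) * d.remErr i a z := by
  obtain ⟨hV1, hV2⟩ := abs_le.1 hV
  have hD := h.D_pos i
  have hlo := h.lo_pos
  have hb : 0 < a + d.varErr a z := by linarith
  have hA := d.AHat_noise_of_le τ ha hV
  have hexp := h.hat_mulVec_eq₂ ha.le hb.le (d.noise a z) i
  rw [add_sub_cancel_left] at hexp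
  have hQ : |(d.hat (a + d.varErr a z) *ᵥ d.resid a (d.resid a (d.noise a z))) i| ≤
      √(hi / lo * K) * lo⁻¹ ^ 2 * (√(1 / m) * √(∑ l, d.noise a z l ^ 2)) := by
    refine (h.abs_hat_mulVec_le hb.le _ i).trans ?_
    have h1 : √(∑ j, d.resid a (d.resid a (d.noise a z)) j ^ 2) ≤
        lo⁻¹ ^ 2 * √(∑ l, d.noise a z l ^ 2) := by
      refine (Real.sqrt_le_sqrt ((h.sum_resid_sq_le ha.le _).trans
        (mul_le_mul_of_nonneg_left (h.sum_resid_sq_le ha.le _) (by positivity)))).trans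
          (le_of_eq ?_)
      rw [← mul_assoc, Real.sqrt_mul (by positivity), Real.sqrt_mul_self (by positivity)]
    calc _ ≤ √(hi / lo * K) * √(1 / m) * (lo⁻¹ ^ 2 * √(∑ l, d.noise a z l ^ 2)) := by gcongr
      _ = _ := by ring
  have hg : 0 < √(d.g1 a i) := Real.sqrt_pos.2 (h.g1_pos ha i)
  have hrem : d.remErr i a z = d.varErr a z ^ 2 * |d.noise a z i| +
      |d.varErr a z| * |(d.hat a *ᵥ d.noise a z) i| +
      |d.varErr a z| * |(d.hat a *ᵥ d.resid a (d.noise a z)) i| +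
      d.varErr a z ^ 2 * (√(1 / m) * √(∑ l, d.noise a z l ^ 2)) := by
    rw [remErr, sq]
  have hpred : d.predErr τ i a z = ((1 - d.D i / (a + d.varErr a z + d.D i)) * d.noise a z i +
      d.D i / (a + d.varErr a z + d.D i) * (d.hat (a + d.varErr a z) *ᵥ d.noise a z) i -
        (1 - d.D i / (a + d.D i)) * d.noise a z i) / √(d.g1 a i) := by
    rw [predErr, eblup, blp, h.linPred_betaHat hτ, hA, shrink, shrink]
  have hκ0 : 0 ≤ √(hi / lo * K) * lo⁻¹ ^ 2 := by positivity
  have hr0 : 0 ≤ √(1 / (m : ℝ)) * √(∑ l, d.noise a z l ^ 2) := by positivity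
  rw [hpred, hexp, hrem, linErr, errCoef₁, errCoef₂]
  generalize (d.hat (a + d.varErr a z) *ᵥ d.resid a (d.resid a (d.noise a z))) i = Q at *
  generalize (d.hat a *ᵥ d.resid a (d.noise a z)) i = R at *
  generalize (d.hat a *ᵥ d.noise a z) i = P at *
  generalize √(1 / (m : ℝ)) * √(∑ l, d.noise a z l ^ 2) = r at *
  generalize d.noise a z i = w at *
  generalize d.varErr a z = V at *
  generalize √(d.g1 a i) = g at *
  generalize d.D i = D at *
  generalize √(hi / lo * K) * lo⁻¹ ^ 2 = κ at *
  have hu : 0 < a + D := by positivity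
  have hv : 0 < a + V + D := by linarith
  have hdec : ((1 - D / (a + V + D)) * w + D / (a + V + D) * (P - V * R + V ^ 2 * Q) -
      (1 - D / (a + D)) * w) / g -
      (D * ((a + D)⁻¹ * (a + D)⁻¹) * g⁻¹ * (V * w) + D * (a + D)⁻¹ * g⁻¹ * P) =
      (-(D / (a + V + D) * (((a + D)⁻¹) ^ 2 * (V ^ 2 * w))) -
        D / (a + V + D) * ((a + D)⁻¹ * (V * P)) - D / (a + V + D) * (V * R) +
          D / (a + V + D) * (V ^ 2 * Q)) / g := by
    field_simp
    ring
  have hDv : D / (a + V + D) ≤ 1 := by rw [div_le_one hv]; linarith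
  have hDv0 : 0 ≤ D / (a + V + D) := by positivity
  have hinv : (a + D)⁻¹ ≤ a⁻¹ := inv_anti₀ ha (by linarith)
  rw [hdec, abs_div, abs_of_pos hg]
  refine (div_le_div_of_nonneg_right ?_ hg.le).trans (le_of_eq (div_mul_eq_mul_div _ _ _).symm)
  generalize D / (a + V + D) = ε at *
  have t1 : |ε * (((a + D)⁻¹) ^ 2 * (V ^ 2 * w))| ≤ a⁻¹ ^ 2 * (V ^ 2 * |w|) := by
    rw [abs_mul, abs_mul, abs_mul, abs_of_nonneg hDv0, abs_of_nonneg (sq_nonneg V),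
      abs_of_nonneg (sq_nonneg (a + D)⁻¹)]
    exact (mul_le_of_le_one_left (by positivity) hDv).trans (by gcongr)
  have t2 : |ε * ((a + D)⁻¹ * (V * P))| ≤ a⁻¹ * (|V| * |P|) := by
    rw [abs_mul, abs_mul, abs_mul, abs_of_nonneg hDv0, abs_of_pos (inv_pos.2 hu)]
    exact (mul_le_of_le_one_left (by positivity) hDv).trans (by gcongr)
  have t3 : |ε * (V * R)| ≤ |V| * |R| := by
    rw [abs_mul, abs_mul, abs_of_nonneg hDv0]
    exact mul_le_of_le_one_left (by positivity) hDv
  have t4 : |ε * (V ^ 2 * Q)| ≤ V ^ 2 * (κ * r) := by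
    rw [abs_mul, abs_mul, abs_of_nonneg hDv0, abs_of_nonneg (sq_nonneg V)]
    exact (mul_le_of_le_one_left (by positivity) hDv).trans (by gcongr)
  have ha0 : 0 ≤ a⁻¹ := by positivity
  have n1 : 0 ≤ V ^ 2 * |w| := by positivity
  have n2 : 0 ≤ |V| * |P| := by positivity
  have n3 : 0 ≤ |V| * |R| := by positivity
  have n4 : 0 ≤ V ^ 2 * r := by positivity
  have k1 : a⁻¹ ^ 2 * (V ^ 2 * |w|) ≤ (a⁻¹ ^ 2 + a⁻¹ + 1 + κ) * (V ^ 2 * |w|) := by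
    gcongr
    linarith
  have k2 : a⁻¹ * (|V| * |P|) ≤ (a⁻¹ ^ 2 + a⁻¹ + 1 + κ) * (|V| * |P|) := by
    gcongr
    linarith [sq_nonneg a⁻¹]
  have k3 : 1 * (|V| * |R|) ≤ (a⁻¹ ^ 2 + a⁻¹ + 1 + κ) * (|V| * |R|) := by
    gcongr
    linarith [sq_nonneg a⁻¹]
  have k4 : κ * (V ^ 2 * r) ≤ (a⁻¹ ^ 2 + a⁻¹ + 1 + κ) * (V ^ 2 * r) := by
    gcongr
    linarith [sq_nonneg a⁻¹]
  refine (abs_add_le _ _).trans ((add_le_add ((abs_sub _ _).trans (add_le_add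
    ((abs_sub _ _).trans (add_le_add (le_of_eq (abs_neg _)) le_rfl)) le_rfl)) le_rfl).trans ?_)
  linarith

lemma predErr_neg (h : d.Regular lo hi K) {τ : ℝ} (hτ : 0 ≤ τ) (i : Fin m) (a : ℝ)
    (z : Fin m → ℝ) : d.predErr τ i a (-z) = -d.predErr τ i a z := by
  have hA : d.AHat τ (-d.noise a z) = d.AHat τ (d.noise a z) := by
    unfold AHat
    rw [prasadRaoRaw_neg]
  rw [predErr, predErr, noise_neg, eblup, eblup, blp, blp, h.linPred_betaHat hτ,
    h.linPred_betaHat hτ, hA, Matrix.mulVec_neg]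
  simp only [Pi.neg_apply]
  ring

lemma linErr_neg (d : Design m p) (i : Fin m) (a : ℝ) (z : Fin m → ℝ) :
    d.linErr i a (-z) = -d.linErr i a z := by
  rw [linErr, linErr, noise_neg, varErr_neg, Matrix.mulVec_neg]
  simp only [Pi.neg_apply]
  ring

/-- Where `Â` is close to `a`, the event `Hᵢ(β̂, Â) ≤ q` bounds the deviation of `θᵢ` from its
conditional mean. -/
lemma HHat_simMap_le_iff (h : d.Regular lo hi K) (τ : ℝ) (i : Fin m) {a : ℝ}
    (ha : 0 < a) (s : Fin m → ℝ) {z : Fin m → ℝ} (hV : |d.varErr a z| ≤ a / 2) (q : ℝ) :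
    d.HHat τ i (d.simMap a (s, z)) ≤ q ↔ s i ≤ d.predErr τ i a z + q * d.sdRatio τ i a z := by
  have hb : 0 < a + d.varErr a z := by linarith [(abs_le.1 hV).1]
  have hA := d.AHat_noise_of_le τ ha hV
  have hg : 0 < √(d.g1 a i) := Real.sqrt_pos.2 (h.g1_pos ha i)
  have hg' : 0 < √(d.g1 (d.AHat τ (d.noise a z)) i) := by
    rw [hA]
    exact Real.sqrt_pos.2 (h.g1_pos hb i)
  have e : d.HHat τ i (d.simMap a (s, z)) = ((1 - d.shrink a i) * d.noise a z i +
      √(d.g1 a i) * s i - d.eblup τ i (d.noise a z)) / √(d.g1 (d.AHat τ (d.noise a z)) i) := rfl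
  rw [e, div_le_iff₀ hg', predErr, sdRatio, mul_div_assoc', ← add_div, le_div_iff₀ hg]
  constructor <;> intro h <;> linarith

end Regular

end Design

section Expansion

variable {lo hi K a₀ a₁ : ℝ}

lemma lipCoef_inv_add_D (h₀ : 0 < a₀) :
    LipCoef a₀ a₁ fun (t : Setting lo hi K) a => (a + t.d.D t.i)⁻¹ :=
  (lipCoef_add_D h₀).inv h₀ fun t a ha => by linarith [ha.1, t.reg.D_pos t.i]

lemma lipCoef_D : LipCoef a₀ a₁ fun (t : Setting lo hi K) _ => t.d.D t.i :=
  .const fun t => t.abs_D_le t.i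

lemma lipCoef_inv (h₀ : 0 < a₀) : LipCoef a₀ a₁ fun (_ : Setting lo hi K) a => a⁻¹ :=
  (LipCoef.id h₀.le).inv h₀ fun _ _ ha => ha.1

lemma lipCoef_const (c : ℝ) : LipCoef a₀ a₁ fun (_ : Setting lo hi K) _ => c :=
  .const (B := |c|) fun _ => le_rfl

lemma lipCoef_sdCoef₁ (h₀ : 0 < a₀) :
    LipCoef a₀ a₁ fun (t : Setting lo hi K) a => sdCoef₁ a (t.d.D t.i) :=
  lipCoef_D.mul ((lipCoef_const _).mul ((lipCoef_inv h₀).mul (lipCoef_inv_add_D h₀)))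

lemma lipCoef_sdCoef₂ (h₀ : 0 < a₀) :
    LipCoef a₀ a₁ fun (t : Setting lo hi K) a => sdCoef₂ a (t.d.D t.i) :=
  ((lipCoef_inv_add_D h₀).mul (lipCoef_inv_add_D h₀)).mul
    (((lipCoef_const _).mul (lipCoef_D.mul (lipCoef_inv h₀))).add ((lipCoef_const _).mul
      ((lipCoef_D.mul (lipCoef_inv h₀)).mul (lipCoef_D.mul (lipCoef_inv h₀)))))

/-- A uniform lower bound for `g₁ᵢ`. -/
lemma Setting.le_g1 (t : Setting lo hi K) (h₀ : 0 < a₀) {a : ℝ} (ha : a ∈ Set.Icc a₀ a₁) :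
    a₀ * lo / (a₁ + hi) ≤ t.d.g1 a t.i := by
  have hlo := t.reg.lo_pos
  have h1 := t.reg.lo_le t.i
  have h2 := t.reg.le_hi t.i
  have h3 := t.reg.D_pos t.i
  have h4 := h₀.trans_le ha.1
  have h5 := ha.1
  have h6 := ha.2
  unfold Design.g1
  gcongr

lemma lipCoef_inv_sqrt_g1 (h₀ : 0 < a₀) (hlo : 0 < lo) (hhi : 0 < a₁ + hi) :
    LipCoef a₀ a₁ fun (t : Setting lo hi K) a => (√(t.d.g1 a t.i))⁻¹ := by
  have h1 : LipCoef a₀ a₁ fun (t : Setting lo hi K) a => t.d.g1 a t.i :=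
    ((LipCoef.id h₀.le).mul lipCoef_D).mul (lipCoef_inv_add_D h₀)
  have hε : 0 < a₀ * lo / (a₁ + hi) := by positivity
  exact (h1.sqrt hε fun t a ha => t.le_g1 h₀ ha).inv (Real.sqrt_pos.2 hε) fun t a ha =>
    Real.sqrt_le_sqrt (t.le_g1 h₀ ha)

lemma lipMoments_linErr (h₀ : 0 < a₀) (hlo : 0 < lo) (hhi : 0 < a₁ + hi) :
    LipMoments (fun t : Setting lo hi K => t.m) a₀ a₁ (fun t a z => t.d.linErr t.i a z)
      (fun t => √(1 / t.m)) :=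
  ((((lipMoments_varErr h₀).mul (lipMoments_noise h₀)).mono (fun t => t.sqrt_pos) 1
    fun t => by simp).coef_mul
      ((lipCoef_D.mul ((lipCoef_inv_add_D h₀).mul (lipCoef_inv_add_D h₀))).mul
        (lipCoef_inv_sqrt_g1 h₀ hlo hhi))).add
    ((lipMoments_hat h₀).coef_mul
      ((lipCoef_D.mul (lipCoef_inv_add_D h₀)).mul (lipCoef_inv_sqrt_g1 h₀ hlo hhi)))

lemma uniformMoments_remErr (h₀ : 0 < a₀) :
    UniformMoments (fun j : Setting lo hi K × Set.Icc a₀ a₁ => stdNormal j.1.m)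
      (fun j z => j.1.d.remErr j.1.i j.2 z) (fun j => √(1 / j.1.m) * √(1 / j.1.m)) := by
  have hpos : ∀ j : Setting lo hi K × Set.Icc a₀ a₁, 0 < √(1 / (j.1.m : ℝ)) * √(1 / j.1.m) :=
    fun j => mul_pos j.1.sqrt_pos j.1.sqrt_pos
  have hV := (lipMoments_varErr (lo := lo) (hi := hi) (K := K) (a₁ := a₁) h₀).bdd
  have hw := (lipMoments_noise (lo := lo) (hi := hi) (K := K) (a₁ := a₁) h₀).bdd
  have hP := (lipMoments_hat (lo := lo) (hi := hi) (K := K) (a₁ := a₁) h₀).bdd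
  have hR := uniformMoments_hat_resid (lo := lo) (hi := hi) (K := K) (a₁ := a₁) h₀
  have hr := uniformMoments_rms (lo := lo) (hi := hi) (K := K) (a₁ := a₁) h₀
  exact (((((hV.mul hV).mul hw.abs).mono hpos 1 fun j => by simp).add (hV.abs.mul hP.abs)).add
    (hV.abs.mul hR.abs)).add (((hV.mul hV).mul hr).mono hpos 1 fun j => by simp)

/-- The random bound for the error of the quadratic approximation of the distribution of
`Hᵢ(β̂, Â)`. -/
noncomputable def Design.approxErr {m p : ℕ} (d : Design m p) (i : Fin m) (a : ℝ)
    (z : Fin m → ℝ) : ℝ :=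
  (|d.linErr i a z| + |d.varErr a z| + (d.remErr i a z + d.varErr a z ^ 2)) ^ 3 +
    (d.remErr i a z + d.varErr a z ^ 2) *
      (|d.linErr i a z| + |d.varErr a z| + (d.remErr i a z + d.varErr a z ^ 2))

lemma uniformMoments_approxErr (h₀ : 0 < a₀) (hlo : 0 < lo) (hhi : 0 < a₁ + hi) :
    UniformMoments (fun j : Setting lo hi K × Set.Icc a₀ a₁ => stdNormal j.1.m)
      (fun j z => j.1.d.approxErr j.1.i j.2 z) (fun j => √(1 / j.1.m) ^ 3) := by
  have hV := (lipMoments_varErr (lo := lo) (hi := hi) (K := K) (a₁ := a₁) h₀).bdd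
  have hL := (lipMoments_linErr (lo := lo) (hi := hi) (K := K) (a₁ := a₁) h₀ hlo hhi).bdd
  have hE := (uniformMoments_remErr (lo := lo) (hi := hi) (K := K) (a₁ := a₁) h₀).add (hV.mul hV)
  have hpos : ∀ j : Setting lo hi K × Set.Icc a₀ a₁, 0 < √(1 / (j.1.m : ℝ)) :=
    fun j => j.1.sqrt_pos
  have hE' := hE.mono hpos 1 fun j => by
    rw [Real.mul_self_sqrt (by have := j.1.m_pos; positivity), one_mul]
    exact j.1.one_div_le_sqrt
  have hS := (hL.abs.add hV.abs).add hE'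
  have h3 := ((hS.mul hS).mul hS).mono (fun j => pow_pos (hpos j) 3) 1 fun j => le_of_eq (by ring)
  have h2 := (hE.mul hS).mono (fun j => pow_pos (hpos j) 3) 1 fun j => le_of_eq (by ring)
  exact (h3.add h2).congr fun j z => by rw [Design.approxErr]; ring

end Expansion

/-- The Edgeworth-type correction `Φ(q) + φ(q) (e₁ q + e₃ q³)` of the normal distribution
function. -/
noncomputable def edgeworthFun (e₁ e₃ q : ℝ) : ℝ :=
  Φ q + normalPDF q * (e₁ * q + e₃ * q ^ 3)

namespace Design

/-- The coefficient of `q φ(q)` in the Edgeworth expansion of the distribution function of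
`Hᵢ(β̂, Â)`. -/
noncomputable def edgeCoef₁ (d : Design m p) (i : Fin m) (a : ℝ) : ℝ :=
  ∫ z, (sdCoef₂ a (d.D i) * (d.varErr a z * d.varErr a z) +
    -2⁻¹ * (d.linErr i a z * d.linErr i a z)) ∂stdNormal m

/-- The coefficient of `q³ φ(q)` in the Edgeworth expansion of the distribution function of
`Hᵢ(β̂, Â)`. -/
noncomputable def edgeCoef₃ (d : Design m p) (i : Fin m) (a : ℝ) : ℝ :=
  ∫ z, (-2⁻¹ * (sdCoef₁ a (d.D i) * sdCoef₁ a (d.D i))) * (d.varErr a z * d.varErr a z) ∂stdNormal m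

/-- The Edgeworth approximation of the distribution function of `Hᵢ(β̂, Â)`. -/
noncomputable def edgeworth (d : Design m p) (i : Fin m) (a q : ℝ) : ℝ :=
  edgeworthFun (d.edgeCoef₁ i a) (d.edgeCoef₃ i a) q

open Classical in
/-- The prediction error, restricted to the event that `Â` is close to `a`. This event is symmetric
in the data, so the restriction is an odd function of the data like the prediction error itself, and
the linearization makes it integrable. -/
noncomputable def truncPredErr (d : Design m p) (τ : ℝ) (i : Fin m) (a : ℝ) (z : Fin m → ℝ) : ℝ :=
  if |d.varErr a z| ≤ a / 2 then d.predErr τ i a z else 0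

lemma approxErr_nonneg (d : Design m p) (i : Fin m) (a : ℝ) (z : Fin m → ℝ) :
    0 ≤ d.approxErr i a z := by
  have := d.remErr_nonneg i a z
  unfold approxErr
  positivity

end Design

open Design

section Expansion

variable {lo hi K a₀ a₁ : ℝ}

/-- Uniform bounds for the deterministic coefficients of the expansion. -/
lemma exists_coef_bound (h₀ : 0 < a₀) (hlo : 0 < lo) (hhi : 0 < a₁ + hi) :
    ∃ c : ℝ, 1 ≤ c ∧ ∀ t : Setting lo hi K, ∀ a ∈ Set.Icc a₀ a₁, a / 2 ≤ c ∧
      |sdCoef₁ a (t.d.D t.i)| ≤ c ∧ |sdCoef₂ a (t.d.D t.i)| ≤ c ∧ 2 / a ^ 3 ≤ c ∧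
      (a⁻¹ ^ 2 + a⁻¹ + 1 + √(hi / lo * K) * lo⁻¹ ^ 2) / √(t.d.g1 a t.i) ≤ c := by
  obtain ⟨B₁, hB₁0, hB₁⟩ := lipCoef_sdCoef₁ (lo := lo) (hi := hi) (K := K) (a₁ := a₁) h₀
  obtain ⟨B₂, hB₂0, hB₂⟩ := lipCoef_sdCoef₂ (lo := lo) (hi := hi) (K := K) (a₁ := a₁) h₀
  have hε : 0 < √(a₀ * lo / (a₁ + hi)) := Real.sqrt_pos.2 (by positivity)
  have n1 := abs_nonneg a₁
  have n2 : 0 ≤ 2 / a₀ ^ 3 := by positivity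
  have n3 : 0 ≤ (a₀⁻¹ ^ 2 + a₀⁻¹ + 1 + √(hi / lo * K) * lo⁻¹ ^ 2) / √(a₀ * lo / (a₁ + hi)) := by
    positivity
  refine ⟨1 + B₁ + B₂ + |a₁| + 2 / a₀ ^ 3 +
    (a₀⁻¹ ^ 2 + a₀⁻¹ + 1 + √(hi / lo * K) * lo⁻¹ ^ 2) / √(a₀ * lo / (a₁ + hi)), by linarith,
    fun t a ha => ?_⟩
  have ha0 : 0 < a := h₀.trans_le ha.1
  have k1 := (hB₁ t a ha).1
  have k2 := (hB₂ t a ha).1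
  have k3 : a ≤ |a₁| := ha.2.trans (le_abs_self _)
  have k4 : 2 / a ^ 3 ≤ 2 / a₀ ^ 3 := by
    have := ha.1
    gcongr
  have k5 : (a⁻¹ ^ 2 + a⁻¹ + 1 + √(hi / lo * K) * lo⁻¹ ^ 2) / √(t.d.g1 a t.i) ≤
      (a₀⁻¹ ^ 2 + a₀⁻¹ + 1 + √(hi / lo * K) * lo⁻¹ ^ 2) / √(a₀ * lo / (a₁ + hi)) := by
    have h1 : a⁻¹ ≤ a₀⁻¹ := inv_anti₀ h₀ ha.1
    have h2 := Real.sqrt_le_sqrt (t.le_g1 h₀ ha)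
    gcongr
  refine ⟨?_, ?_, ?_, ?_, ?_⟩ <;> linarith

/-- Conditionally on the data, the distribution function of `Hᵢ(β̂, Â)` is quadratic in the
estimation errors, up to third order. -/
lemma exists_abs_Φ_sub_le (h₀ : 0 < a₀) (hlo : 0 < lo) (hhi : 0 < a₁ + hi) {M : ℝ} (hM : 0 ≤ M) :
    ∃ C : ℝ, 0 ≤ C ∧ ∀ (t : Setting lo hi K) (τ : ℝ), 0 ≤ τ → ∀ a ∈ Set.Icc a₀ a₁, ∀ q : ℝ,
      |q| ≤ M → ∀ z, |Φ (t.d.predErr τ t.i a z + q * t.d.sdRatio τ t.i a z) -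
        normalApprox q (sdCoef₁ a (t.d.D t.i)) (sdCoef₂ a (t.d.D t.i)) (t.d.varErr a z)
          (t.d.truncPredErr τ t.i a z) (t.d.linErr t.i a z)| ≤ C * t.d.approxErr t.i a z := by
  obtain ⟨c, hc1, hc⟩ := exists_coef_bound (K := K) (a₁ := a₁) h₀ hlo hhi
  have hb : 0 < a₀ / 2 := by positivity
  have hc0 : 0 ≤ c := by linarith
  set k := c * (1 + M) * (1 + c) with hk
  have hk0 : 0 ≤ k := by positivity
  set C₁ := M * c + 2 * k ^ 3 with hC₁
  set C₂ := M * k ^ 2 with hC₂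
  set C₃ := (a₀ / 2)⁻¹ ^ 3 + M * c * ((a₀ / 2)⁻¹ ^ 2 + (a₀ / 2)⁻¹) +
    M * k ^ 2 * (a₀ / 2)⁻¹ with hC₃
  have n1 : 0 ≤ C₁ := by positivity
  have n2 : 0 ≤ C₂ := by positivity
  have n3 : 0 ≤ C₃ := by positivity
  have n4 : 0 ≤ (a₀ / 2)⁻¹ ^ 3 := by positivity
  refine ⟨C₁ + C₂ + C₃ + (a₀ / 2)⁻¹ ^ 3, by positivity, fun t τ hτ a ha q hq z => ?_⟩
  obtain ⟨hca, hc₁, hc₂, hc₃, hcT⟩ := hc t a ha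
  have ha0 : 0 < a := h₀.trans_le ha.1
  have hR := t.d.remErr_nonneg t.i a z
  set S := |t.d.linErr t.i a z| + |t.d.varErr a z| + (t.d.remErr t.i a z + t.d.varErr a z ^ 2)
    with hS
  set E' := t.d.remErr t.i a z + t.d.varErr a z ^ 2 with hE'
  have hS0 : 0 ≤ S := by positivity
  have hE0 : 0 ≤ E' := by positivity
  have hS3 : 0 ≤ S ^ 3 := by positivity
  have hES : 0 ≤ E' * S := by positivity
  have happ : t.d.approxErr t.i a z = S ^ 3 + E' * S := rfl
  rw [happ]
  by_cases hV : |t.d.varErr a z| ≤ a / 2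
  · rw [truncPredErr, if_pos hV]
    have hT : |t.d.predErr τ t.i a z - t.d.linErr t.i a z| ≤ c * t.d.remErr t.i a z :=
      (t.reg.abs_predErr_sub_le hτ t.i ha0 hV).trans (mul_le_mul_of_nonneg_right hcT hR)
    have hρ : |t.d.sdRatio τ t.i a z - 1 - (sdCoef₁ a (t.d.D t.i) * t.d.varErr a z +
        sdCoef₂ a (t.d.D t.i) * t.d.varErr a z ^ 2)| ≤ c * |t.d.varErr a z| ^ 3 := by
      have h1 := abs_sqrt_g1_ratio_sub_le ha0 (t.reg.D_pos t.i) hV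
      rw [sdRatio, t.d.AHat_noise_of_le τ ha0 hV]
      rw [g1, g1, sub_sub, ← add_assoc]
      exact h1.trans (mul_le_mul_of_nonneg_right hc₃ (by positivity))
    have h2 := abs_Φ_sub_normalApprox_le hM hq hc1 hc₁ hc₂ (hV.trans hca) hR hT hρ
    rw [show t.d.predErr τ t.i a z + q * t.d.sdRatio τ t.i a z =
      q + (t.d.predErr τ t.i a z + q * (t.d.sdRatio τ t.i a z - 1)) by ring]
    refine h2.trans ?_
    have : C₁ * S ^ 3 + C₂ * (E' * S) ≤
        (C₁ + C₂ + C₃ + (a₀ / 2)⁻¹ ^ 3) * (S ^ 3 + E' * S) := by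
      linarith [mul_nonneg n2 hS3, mul_nonneg n3 hS3, mul_nonneg n4 hS3, mul_nonneg n1 hES,
        mul_nonneg n3 hES, mul_nonneg n4 hES]
    exact this
  · -- Where `Â` is far from `a`, both terms are bounded by powers of `S`, which is not small.
    rw [truncPredErr, if_neg hV]
    have hV' : a₀ / 2 ≤ |t.d.varErr a z| := by linarith [ha.1, not_le.1 hV]
    have h1 := abs_normalApprox_le (ℓ := t.d.linErr t.i a z) hM hq hc1 hc₁ hc₂ hR hb hV'
    have h2 : |Φ (t.d.predErr τ t.i a z + q * t.d.sdRatio τ t.i a z)| ≤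
        (a₀ / 2)⁻¹ ^ 3 * S ^ 3 := by
      rw [abs_of_nonneg (Φ_nonneg _), ← mul_pow]
      refine (Φ_le_one _).trans (one_le_pow₀ ?_)
      rw [inv_mul_eq_div, one_le_div hb]
      refine hV'.trans ?_
      rw [hS]
      linarith [abs_nonneg (t.d.linErr t.i a z)]
    refine (abs_sub _ _).trans ((add_le_add h2 h1).trans ?_)
    have : (a₀ / 2)⁻¹ ^ 3 * S ^ 3 + C₃ * S ^ 3 ≤
        (C₁ + C₂ + C₃ + (a₀ / 2)⁻¹ ^ 3) * (S ^ 3 + E' * S) := by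
      linarith [mul_nonneg n1 hS3, mul_nonneg n2 hS3, mul_nonneg n1 hES, mul_nonneg n2 hES,
        mul_nonneg n3 hES, mul_nonneg n4 hES]
    exact this

lemma integral_normalApprox (h₀ : 0 < a₀) (hlo : 0 < lo) (hhi : 0 < a₁ + hi)
    (t : Setting lo hi K) {τ : ℝ} (hτ : 0 ≤ τ) {a : ℝ} (ha : a ∈ Set.Icc a₀ a₁) (q : ℝ) :
    Integrable (fun z => normalApprox q (sdCoef₁ a (t.d.D t.i)) (sdCoef₂ a (t.d.D t.i))
      (t.d.varErr a z) (t.d.truncPredErr τ t.i a z) (t.d.linErr t.i a z)) (stdNormal t.m) ∧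
    ∫ z, normalApprox q (sdCoef₁ a (t.d.D t.i)) (sdCoef₂ a (t.d.D t.i))
      (t.d.varErr a z) (t.d.truncPredErr τ t.i a z) (t.d.linErr t.i a z) ∂stdNormal t.m =
      t.d.edgeworth t.i a q := by
  have ha0 : 0 < a := h₀.trans_le ha.1
  have mV := (lipMoments_varErr (lo := lo) (hi := hi) (K := K) (a₁ := a₁) h₀).bdd
  have mL := (lipMoments_linErr (lo := lo) (hi := hi) (K := K) (a₁ := a₁) h₀ hlo hhi).bdd
  have mR := uniformMoments_remErr (lo := lo) (hi := hi) (K := K) (a₁ := a₁) h₀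
  have iV : Integrable (t.d.varErr a) (stdNormal t.m) := mV.integrable (t, ⟨a, ha⟩)
  have iVV : Integrable (fun z => t.d.varErr a z * t.d.varErr a z) (stdNormal t.m) :=
    (mV.mul mV).integrable (t, ⟨a, ha⟩)
  have iLL : Integrable (fun z => t.d.linErr t.i a z * t.d.linErr t.i a z) (stdNormal t.m) :=
    (mL.mul mL).integrable (t, ⟨a, ha⟩)
  have iLV : Integrable (fun z => t.d.linErr t.i a z * t.d.varErr a z) (stdNormal t.m) :=
    (mL.mul mV).integrable (t, ⟨a, ha⟩)
  have iL : Integrable (t.d.linErr t.i a) (stdNormal t.m) := mL.integrable (t, ⟨a, ha⟩)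
  have iR : Integrable (t.d.remErr t.i a) (stdNormal t.m) := mR.integrable (t, ⟨a, ha⟩)
  have iT : Integrable (t.d.truncPredErr τ t.i a) (stdNormal t.m) := by
    refine Integrable.mono' (iL.abs.add (iR.const_mul ((a⁻¹ ^ 2 + a⁻¹ + 1 +
      √(hi / lo * K) * lo⁻¹ ^ 2) / √(t.d.g1 a t.i)))) ?_ (ae_of_all _ fun z => ?_)
    · have := t.d.measurable_varErr a
      exact (Measurable.ite (measurableSet_le (by fun_prop) measurable_const)
        (t.reg.measurable_predErr hτ t.i a) measurable_const).aestronglyMeasurable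
    · rw [Real.norm_eq_abs, Pi.add_apply, truncPredErr]
      split_ifs with hV
      · have h1 := t.reg.abs_predErr_sub_le hτ t.i ha0 hV
        have h2 := abs_add_le (t.d.predErr τ t.i a z - t.d.linErr t.i a z) (t.d.linErr t.i a z)
        rw [sub_add_cancel] at h2
        linarith
      · rw [abs_zero]
        have := t.d.remErr_nonneg t.i a z
        positivity
  -- `Â` is an even function of the data, the prediction error and its linearization are odd.
  have oT : ∫ z, t.d.truncPredErr τ t.i a z ∂stdNormal t.m = 0 :=
    integral_stdNormal_of_odd fun z => by
      rw [truncPredErr, truncPredErr, varErr_neg, t.reg.predErr_neg hτ]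
      split_ifs <;> simp
  have oLV : ∫ z, t.d.linErr t.i a z * t.d.varErr a z ∂stdNormal t.m = 0 :=
    integral_stdNormal_of_odd fun z => by rw [Regular.linErr_neg, varErr_neg]; ring
  have oV : ∫ z, t.d.varErr a z ∂stdNormal t.m = 0 := t.reg.integral_varErr ha0.le
  set c₁ := sdCoef₁ a (t.d.D t.i) with hc₁
  set c₂ := sdCoef₂ a (t.d.D t.i) with hc₂
  have hdec : (fun z => normalApprox q c₁ c₂ (t.d.varErr a z) (t.d.truncPredErr τ t.i a z)
      (t.d.linErr t.i a z)) = fun z => Φ q + normalPDF q * t.d.truncPredErr τ t.i a z +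
      normalPDF q * q * c₁ * t.d.varErr a z +
      -(q ^ 2 * normalPDF q * c₁) * (t.d.linErr t.i a z * t.d.varErr a z) +
      normalPDF q * q * (c₂ * (t.d.varErr a z * t.d.varErr a z) +
        -2⁻¹ * (t.d.linErr t.i a z * t.d.linErr t.i a z)) +
      normalPDF q * q ^ 3 * ((-2⁻¹ * (c₁ * c₁)) * (t.d.varErr a z * t.d.varErr a z)) := by
    ext z
    rw [normalApprox]
    ring
  have j0 : Integrable (fun _ : Fin t.m → ℝ => Φ q) (stdNormal t.m) := integrable_const _
  have j1 := iT.const_mul (normalPDF q)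
  have j2 := iV.const_mul (normalPDF q * q * c₁)
  have j3 := iLV.const_mul (-(q ^ 2 * normalPDF q * c₁))
  have j4 := ((iVV.const_mul c₂).add (iLL.const_mul (-2⁻¹))).const_mul (normalPDF q * q)
  have j5 := (iVV.const_mul (-2⁻¹ * (c₁ * c₁))).const_mul (normalPDF q * q ^ 3)
  simp only [Pi.add_apply] at j4
  have s1 : Integrable (fun z => Φ q + normalPDF q * t.d.truncPredErr τ t.i a z)
      (stdNormal t.m) := j0.add j1
  have s2 : Integrable (fun z => Φ q + normalPDF q * t.d.truncPredErr τ t.i a z +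
      normalPDF q * q * c₁ * t.d.varErr a z) (stdNormal t.m) := s1.add j2
  have s3 : Integrable (fun z => Φ q + normalPDF q * t.d.truncPredErr τ t.i a z +
      normalPDF q * q * c₁ * t.d.varErr a z +
      -(q ^ 2 * normalPDF q * c₁) * (t.d.linErr t.i a z * t.d.varErr a z)) (stdNormal t.m) :=
    s2.add j3
  have s4 : Integrable (fun z => Φ q + normalPDF q * t.d.truncPredErr τ t.i a z +
      normalPDF q * q * c₁ * t.d.varErr a z +
      -(q ^ 2 * normalPDF q * c₁) * (t.d.linErr t.i a z * t.d.varErr a z) +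
      normalPDF q * q * (c₂ * (t.d.varErr a z * t.d.varErr a z) +
        -2⁻¹ * (t.d.linErr t.i a z * t.d.linErr t.i a z))) (stdNormal t.m) := s3.add j4
  rw [hdec]
  refine ⟨s4.add j5, ?_⟩
  rw [integral_add s4 j5, integral_add s3 j4, integral_add s2 j3, integral_add s1 j2,
    integral_add j0 j1, integral_const_mul, integral_const_mul,
    integral_const_mul, integral_const_mul, integral_const_mul, oT, oLV, oV]
  simp only [integral_const, probReal_univ, one_smul]
  rw [edgeworth, edgeworthFun, edgeCoef₁, edgeCoef₃]
  ring

lemma exists_real_lt_abs_varErr_le (h₀ : 0 < a₀) (hlo : 0 < lo) (hhi : 0 < a₁ + hi) :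
    ∃ C : ℝ, 0 ≤ C ∧ ∀ t : Setting lo hi K, ∀ a ∈ Set.Icc a₀ a₁,
      (stdNormal t.m).real {z | a / 2 < |t.d.varErr a z|} ≤ C * √(1 / t.m) ^ 3 := by
  have mA := uniformMoments_approxErr (lo := lo) (hi := hi) (K := K) (a₁ := a₁) h₀ hlo hhi
  obtain ⟨C, hC0, hC⟩ := mA.abs_integral_le
  have hb : 0 < (a₀ / 2) ^ 3 := by positivity
  refine ⟨C / (a₀ / 2) ^ 3, by positivity, fun t a ha => ?_⟩
  have h1 := mul_meas_ge_le_integral_of_nonneg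
    (ae_of_all _ fun z => t.d.approxErr_nonneg t.i a z)
    (mA.integrable (t, ⟨a, ha⟩)) ((a₀ / 2) ^ 3)
  have h2 : (stdNormal t.m).real {z | a / 2 < |t.d.varErr a z|} ≤
      (stdNormal t.m).real {z | (a₀ / 2) ^ 3 ≤ t.d.approxErr t.i a z} := by
    refine measureReal_mono fun z hz => ?_
    have hz : a / 2 < |t.d.varErr a z| := hz
    have h3 : a₀ / 2 ≤ |t.d.varErr a z| := by linarith [ha.1]
    have h4 := t.d.remErr_nonneg t.i a z
    change (a₀ / 2) ^ 3 ≤ t.d.approxErr t.i a z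
    rw [approxErr]
    refine le_add_of_le_of_nonneg (pow_le_pow_left₀ (by positivity) ?_ 3) (by positivity)
    linarith [abs_nonneg (t.d.linErr t.i a z), sq_nonneg (t.d.varErr a z)]
  have h5 := (le_abs_self _).trans (hC (t, ⟨a, ha⟩))
  rw [div_mul_eq_mul_div, le_div_iff₀ hb, mul_comm]
  exact ((mul_le_mul_of_nonneg_left h2 hb.le).trans h1).trans h5

/-- Conditionally on the data, `Hᵢ(β̂, Â) ≤ q` is a normal event, except where `Â` is far from
`a`. -/
lemma abs_cdf_sub_integral_le (t : Setting lo hi K) {τ : ℝ} (hτ : 0 ≤ τ) {a : ℝ} (ha : 0 < a)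
    (q : ℝ) : |cdf (t.d.lawHHat τ t.i a) q -
      ∫ z, Φ (t.d.predErr τ t.i a z + q * t.d.sdRatio τ t.i a z) ∂stdNormal t.m| ≤
      (stdNormal t.m).real {z | a / 2 < |t.d.varErr a z|} := by
  have hm : Measurable fun z => t.d.predErr τ t.i a z + q * t.d.sdRatio τ t.i a z :=
    (t.reg.measurable_predErr hτ t.i a).add
      ((Regular.measurable_sdRatio t.d τ t.i a).const_mul q)
  have hB : MeasurableSet {z | a / 2 < |t.d.varErr a z|} := by
    have := t.d.measurable_varErr a
    exact measurableSet_lt measurable_const (by fun_prop)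
  have hs : (stdNormal t.m).real {z | a / 2 < |t.d.varErr a z|} =
      ((stdNormal t.m).prod (stdNormal t.m)).real
        (Set.univ ×ˢ {z | a / 2 < |t.d.varErr a z|}) := by
    rw [measureReal_prod_prod, probReal_univ, one_mul]
  rw [t.reg.cdf_lawHHat hτ, ← measureReal_le_eq_integral t.i hm, hs]
  have hsub : ∀ s s' : Set ((Fin t.m → ℝ) × (Fin t.m → ℝ)),
      (∀ sz, |t.d.varErr a sz.2| ≤ a / 2 → sz ∈ s → sz ∈ s') →
      ((stdNormal t.m).prod (stdNormal t.m)).real s ≤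
        ((stdNormal t.m).prod (stdNormal t.m)).real s' +
        ((stdNormal t.m).prod (stdNormal t.m)).real
          (Set.univ ×ˢ {z | a / 2 < |t.d.varErr a z|}) := fun s s' h => by
    refine (measureReal_mono fun sz hsz => ?_).trans (measureReal_union_le _ _)
    rcases le_or_gt |t.d.varErr a sz.2| (a / 2) with hV | hV
    · exact Or.inl (h sz hV hsz)
    · exact Or.inr ⟨Set.mem_univ _, hV⟩
  rw [abs_le]
  constructor
  · have := hsub {sz | sz.1 t.i ≤ t.d.predErr τ t.i a sz.2 + q * t.d.sdRatio τ t.i a sz.2}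
      {sz | t.d.HHat τ t.i (t.d.simMap a sz) ≤ q}
      fun sz hV hsz => (t.reg.HHat_simMap_le_iff τ t.i ha sz.1 hV q).2 hsz
    linarith
  · have := hsub {sz | t.d.HHat τ t.i (t.d.simMap a sz) ≤ q}
      {sz | sz.1 t.i ≤ t.d.predErr τ t.i a sz.2 + q * t.d.sdRatio τ t.i a sz.2}
      fun sz hV hsz => (t.reg.HHat_simMap_le_iff τ t.i ha sz.1 hV q).1 hsz
    linarith

/-- The Edgeworth expansion of the distribution function of `Hᵢ(β̂, Â)`, uniformly over regular
designs, areas and variance parameters in a compact subset of `(0, ∞)`. -/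
theorem exists_abs_cdf_sub_edgeworth_le (h₀ : 0 < a₀) (hlo : 0 < lo) (hhi : 0 < a₁ + hi) {M : ℝ}
    (hM : 0 ≤ M) : ∃ C : ℝ, 0 ≤ C ∧ ∀ (t : Setting lo hi K) (τ : ℝ), 0 ≤ τ →
      ∀ a ∈ Set.Icc a₀ a₁, ∀ q : ℝ, |q| ≤ M →
        |cdf (t.d.lawHHat τ t.i a) q - t.d.edgeworth t.i a q| ≤ C * √(1 / t.m) ^ 3 := by
  obtain ⟨C₁, hC₁0, hC₁⟩ := exists_abs_Φ_sub_le (K := K) h₀ hlo hhi hM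
  obtain ⟨C₂, hC₂0, hC₂⟩ := exists_real_lt_abs_varErr_le (K := K) h₀ hlo hhi
  have mA := uniformMoments_approxErr (lo := lo) (hi := hi) (K := K) (a₁ := a₁) h₀ hlo hhi
  obtain ⟨C₃, hC₃0, hC₃⟩ := mA.abs_integral_le
  refine ⟨C₂ + C₁ * C₃, by positivity, fun t τ hτ a ha q hq => ?_⟩
  have ha0 : 0 < a := h₀.trans_le ha.1
  have h1 := (abs_cdf_sub_integral_le t hτ ha0 q).trans (hC₂ t a ha)
  obtain ⟨hi1, hi2⟩ := integral_normalApprox h₀ hlo hhi t hτ ha q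
  have hm : Measurable fun z => t.d.predErr τ t.i a z + q * t.d.sdRatio τ t.i a z :=
    (t.reg.measurable_predErr hτ t.i a).add
      ((Regular.measurable_sdRatio t.d τ t.i a).const_mul q)
  have hΦ : Integrable (fun z => Φ (t.d.predErr τ t.i a z + q * t.d.sdRatio τ t.i a z))
      (stdNormal t.m) :=
    Integrable.of_bound (measurable_Φ.comp hm).aestronglyMeasurable 1 (ae_of_all _ fun z => by
      rw [Real.norm_eq_abs, abs_of_nonneg (Φ_nonneg _)]
      exact Φ_le_one _)
  have h2 : |∫ z, Φ (t.d.predErr τ t.i a z + q * t.d.sdRatio τ t.i a z) ∂stdNormal t.m -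
      t.d.edgeworth t.i a q| ≤ C₁ * (C₃ * √(1 / t.m) ^ 3) := by
    rw [← hi2, ← integral_sub hΦ hi1]
    refine (abs_integral_le_integral_abs).trans ((integral_mono (hΦ.sub hi1).abs
      ((mA.integrable (t, ⟨a, ha⟩)).const_mul C₁) fun z => hC₁ t τ hτ a ha q hq z).trans ?_)
    rw [integral_const_mul]
    exact mul_le_mul_of_nonneg_left ((le_abs_self _).trans (hC₃ (t, ⟨a, ha⟩))) hC₁0
  have h3 := abs_add_le (cdf (t.d.lawHHat τ t.i a) q -
    ∫ z, Φ (t.d.predErr τ t.i a z + q * t.d.sdRatio τ t.i a z) ∂stdNormal t.m)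
    (∫ z, Φ (t.d.predErr τ t.i a z + q * t.d.sdRatio τ t.i a z) ∂stdNormal t.m -
      t.d.edgeworth t.i a q)
  rw [sub_add_sub_cancel] at h3
  linarith

/-- The Edgeworth coefficients are of order `1 / m`, and so are their Lipschitz constants in the
variance parameter. -/
lemma exists_abs_edgeCoef_le (h₀ : 0 < a₀) (hlo : 0 < lo) (hhi : 0 < a₁ + hi) :
    ∃ C : ℝ, 0 ≤ C ∧ ∀ t : Setting lo hi K, ∀ a ∈ Set.Icc a₀ a₁,
      |t.d.edgeCoef₁ t.i a| ≤ C * (1 / t.m) ∧ |t.d.edgeCoef₃ t.i a| ≤ C * (1 / t.m) ∧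
      ∀ a' ∈ Set.Icc a₀ a₁,
        |t.d.edgeCoef₁ t.i a - t.d.edgeCoef₁ t.i a'| ≤ C * (1 / t.m) * |a - a'| ∧
        |t.d.edgeCoef₃ t.i a - t.d.edgeCoef₃ t.i a'| ≤ C * (1 / t.m) * |a - a'| := by
  have mV := lipMoments_varErr (lo := lo) (hi := hi) (K := K) (a₁ := a₁) h₀
  have mL := lipMoments_linErr (lo := lo) (hi := hi) (K := K) (a₁ := a₁) h₀ hlo hhi
  obtain ⟨C₁, hC₁0, hC₁⟩ := (((mV.mul mV).coef_mul (lipCoef_sdCoef₂ h₀)).add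
    ((mL.mul mL).coef_mul (lipCoef_const (-2⁻¹)))).integral
  obtain ⟨C₃, hC₃0, hC₃⟩ := ((mV.mul mV).coef_mul ((lipCoef_const (-2⁻¹)).mul
    ((lipCoef_sdCoef₁ h₀).mul (lipCoef_sdCoef₁ h₀)))).integral
  refine ⟨max C₁ C₃, le_max_of_le_left hC₁0, fun t a ha => ?_⟩
  have hm : 0 ≤ 1 / (t.m : ℝ) := by positivity
  have hs : √(1 / (t.m : ℝ)) * √(1 / t.m) = 1 / t.m := Real.mul_self_sqrt hm
  have e1 := hC₁ t a ha
  have e3 := hC₃ t a ha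
  simp only [hs] at e1 e3
  have k1 : C₁ * (1 / (t.m : ℝ)) ≤ max C₁ C₃ * (1 / t.m) :=
    mul_le_mul_of_nonneg_right (le_max_left _ _) hm
  have k3 : C₃ * (1 / (t.m : ℝ)) ≤ max C₁ C₃ * (1 / t.m) :=
    mul_le_mul_of_nonneg_right (le_max_right _ _) hm
  refine ⟨e1.1.trans k1, e3.1.trans k3, fun a' ha' => ⟨?_, ?_⟩⟩
  · exact (e1.2 a' ha').trans (mul_le_mul_of_nonneg_right k1 (abs_nonneg _))
  · exact (e3.2 a' ha').trans (mul_le_mul_of_nonneg_right k3 (abs_nonneg _))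

end Expansion

/-! ### Inversion of the expansion -/

lemma exists_Φ_eq {t : ℝ} (ht : 0 < t) (ht1 : t < 1) : ∃ z, Φ z = t :=
  mem_range_of_exists_le_of_exists_ge continuous_Φ
    (((tendsto_cdf_atBot (gaussianReal 0 1)).eventually (eventually_le_nhds ht)).exists)
    (((tendsto_cdf_atTop (gaussianReal 0 1)).eventually (eventually_ge_nhds ht1)).exists)

lemma continuous_edgeworthFun (e₁ e₃ : ℝ) : Continuous (edgeworthFun e₁ e₃) := by
  have h1 := continuous_Φ
  have h2 := continuous_normalPDF
  unfold edgeworthFun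
  fun_prop

lemma abs_edgeCorrection_le {e₁ e₃ η q M : ℝ} (h₁ : |e₁| ≤ η) (h₃ : |e₃| ≤ η) (hq : |q| ≤ M) :
    |normalPDF q * (e₁ * q + e₃ * q ^ 3)| ≤ η * (M + M ^ 3) := by
  have hη : 0 ≤ η := (abs_nonneg _).trans h₁
  have hp := normalPDF_pos q
  rw [abs_mul, abs_of_pos hp]
  refine (mul_le_of_le_one_left (abs_nonneg _) (normalPDF_le_one q)).trans ?_
  refine (abs_add_le _ _).trans ?_
  rw [abs_mul, abs_mul, abs_pow, mul_add]
  gcongr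

lemma mul_sub_le_Φ_sub {M q q' : ℝ} (hq : |q| ≤ M) (hq' : |q'| ≤ M) (h : q ≤ q') :
    normalPDF M * (q' - q) ≤ Φ q' - Φ q := by
  refine Convex.mul_sub_le_image_sub_of_le_deriv (D := Set.Icc (-M) M) (convex_Icc _ _)
    continuous_Φ.continuousOn (fun x _ => (hasDerivAt_Φ x).differentiableAt.differentiableWithinAt)
    (fun x hx => ?_) q (abs_le.1 hq) q' (abs_le.1 hq') h
  rw [(hasDerivAt_Φ x).deriv, normalPDF_eq, normalPDF_eq]
  obtain ⟨hx1, hx2⟩ : x ∈ Set.Icc (-M) M := interior_subset hx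
  have : x ^ 2 ≤ M ^ 2 := sq_le_sq' hx1 hx2
  gcongr

lemma abs_edgeCorrection_sub_le {e₁ e₃ η q q' M : ℝ} (h₁ : |e₁| ≤ η) (h₃ : |e₃| ≤ η)
    (hq : |q| ≤ M) (hq' : |q'| ≤ M) :
    |normalPDF q * (e₁ * q + e₃ * q ^ 3) - normalPDF q' * (e₁ * q' + e₃ * q' ^ 3)| ≤
      η * (1 + 4 * M ^ 2 + M ^ 4) * |q - q'| := by
  have hη : 0 ≤ η := (abs_nonneg _).trans h₁
  have hd : ∀ x, HasDerivAt (fun x => normalPDF x * (e₁ * x + e₃ * x ^ 3))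
      (-x * normalPDF x * (e₁ * x + e₃ * x ^ 3) + normalPDF x * (e₁ * 1 + e₃ * (3 * x ^ 2))) x :=
    fun x => by
      have h3 := hasDerivAt_pow 3 x
      exact (hasDerivAt_normalPDF x).mul (((hasDerivAt_id x).const_mul e₁).add
        (by simpa using h3.const_mul e₃))
  have := Convex.norm_image_sub_le_of_norm_hasDerivWithin_le (s := Set.Icc (-M) M)
    (C := η * (1 + 4 * M ^ 2 + M ^ 4)) (fun x _ => (hd x).hasDerivWithinAt) (fun x hx => ?_)
    (convex_Icc _ _) (abs_le.1 hq') (abs_le.1 hq)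
  · exact this
  · have hx' : |x| ≤ M := abs_le.2 hx
    have hx2 : x ^ 2 ≤ M ^ 2 := sq_le_sq' hx.1 hx.2
    have hx4 : x ^ 4 ≤ M ^ 4 := by
      rw [show x ^ 4 = (x ^ 2) ^ 2 by ring, show M ^ 4 = (M ^ 2) ^ 2 by ring]
      gcongr
    have hp := normalPDF_pos x
    rw [Real.norm_eq_abs, show -x * normalPDF x * (e₁ * x + e₃ * x ^ 3) +
      normalPDF x * (e₁ * 1 + e₃ * (3 * x ^ 2)) = normalPDF x * (e₁ * (1 - x ^ 2) +
        e₃ * (3 * x ^ 2 - x ^ 4)) by ring, abs_mul, abs_of_pos hp]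
    refine (mul_le_of_le_one_left (abs_nonneg _) (normalPDF_le_one x)).trans ?_
    have k1 : |1 - x ^ 2| ≤ 1 + M ^ 2 := by
      rw [abs_le]; constructor <;> nlinarith [sq_nonneg x]
    have k2 : |3 * x ^ 2 - x ^ 4| ≤ 3 * M ^ 2 + M ^ 4 := by
      have : 0 ≤ x ^ 4 := by positivity
      rw [abs_le]; constructor <;> nlinarith [sq_nonneg x]
    refine (abs_add_le _ _).trans ?_
    rw [abs_mul, abs_mul]
    calc |e₁| * |1 - x ^ 2| + |e₃| * |3 * x ^ 2 - x ^ 4|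
        ≤ η * (1 + M ^ 2) + η * (3 * M ^ 2 + M ^ 4) := by gcongr
      _ = _ := by ring

/-- A distribution function close to `edgeworthFun e₁ e₃` near the normal quantile `z` has its
quantile near `z`, and there `edgeworthFun e₁ e₃` almost attains the level `Φ z`. -/
lemma quantile_of_abs_cdf_sub_le (ν : Measure ℝ) {z ε η e₁ e₃ M : ℝ} (hM : M = |z| + 1)
    (ht : 0 < Φ z) (ht1 : Φ z < 1) (h₁ : |e₁| ≤ η) (h₃ : |e₃| ≤ η)
    (hF : ∀ q, |q| ≤ M → |cdf ν q - edgeworthFun e₁ e₃ q| ≤ ε)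
    (hsmall : ε + η * (M + M ^ 3) < normalPDF M) :
    |sInf {q | Φ z ≤ cdf ν q}| ≤ M ∧
      |edgeworthFun e₁ e₃ (sInf {q | Φ z ≤ cdf ν q}) - Φ z| ≤ ε := by
  set Q := sInf {q | Φ z ≤ cdf ν q} with hQ
  have hz0 : |z| ≤ M := by linarith
  obtain ⟨hz1, hz2⟩ := abs_le.1 (le_refl |z|)
  have hz' : |z + 1| ≤ M := abs_le.2 ⟨by linarith, by linarith⟩
  have hz'' : |z - 1| ≤ M := abs_le.2 ⟨by linarith, by linarith⟩
  have hQ1 : Q ≤ z + 1 := by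
    rw [hQ, sInf_cdf_le_iff ν ht ht1]
    have h1 := (abs_le.1 (hF _ hz')).1
    have h2 := (abs_le.1 (abs_edgeCorrection_le h₁ h₃ hz')).1
    have h3 := mul_sub_le_Φ_sub hz0 hz' (by linarith)
    rw [edgeworthFun] at h1
    linarith
  have hQ2 : z - 1 < Q := by
    rw [← not_le, hQ, sInf_cdf_le_iff ν ht ht1]
    have h1 := (abs_le.1 (hF _ hz'')).2
    have h2 := (abs_le.1 (abs_edgeCorrection_le h₁ h₃ hz'')).2
    have h3 := mul_sub_le_Φ_sub hz'' hz0 (by linarith)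
    rw [edgeworthFun] at h1
    linarith
  have hQM : |Q| ≤ M := abs_le.2 ⟨by linarith, by linarith⟩
  refine ⟨hQM, abs_le.2 ⟨?_, ?_⟩⟩
  · have h1 := (sInf_cdf_le_iff ν ht ht1 Q).1 le_rfl
    have h2 := (abs_le.1 (hF _ hQM)).2
    linarith
  · -- The distribution function may jump at `Q`, but to the left of `Q` it is below `Φ z`.
    have h1 : Tendsto (edgeworthFun e₁ e₃) (𝓝[<] Q) (𝓝 (edgeworthFun e₁ e₃ Q)) :=
      (continuous_edgeworthFun e₁ e₃).continuousAt.mono_left nhdsWithin_le_nhds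
    have h2 : edgeworthFun e₁ e₃ Q ≤ Φ z + ε := by
      refine le_of_tendsto h1 ?_
      filter_upwards [Ioo_mem_nhdsLT hQ2] with q hq
      have h3 : ¬ Φ z ≤ cdf ν q := fun h => absurd ((sInf_cdf_le_iff ν ht ht1 q).2 h)
        (not_le.2 hq.2)
      have h4 := (abs_le.1 (hF q (abs_le.2 ⟨by linarith [hq.1], by linarith [hq.2]⟩))).1
      linarith
    linarith

/-- `edgeworthFun e₁ e₃` has a slope bounded below where its coefficients are small. -/
lemma abs_sub_le_of_edgeworthFun {e₁ e₃ η M q q' : ℝ} (h₁ : |e₁| ≤ η) (h₃ : |e₃| ≤ η)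
    (hq : |q| ≤ M) (hq' : |q'| ≤ M) (hsmall : η * (1 + 4 * M ^ 2 + M ^ 4) ≤ normalPDF M / 2) :
    normalPDF M / 2 * |q - q'| ≤ |edgeworthFun e₁ e₃ q - edgeworthFun e₁ e₃ q'| := by
  have h1 : normalPDF M * |q - q'| ≤ |Φ q - Φ q'| := by
    rcases le_total q q' with h | h
    · have := mul_sub_le_Φ_sub hq hq' h
      rw [abs_sub_comm, abs_of_nonneg (sub_nonneg.2 h), abs_sub_comm]
      exact this.trans (le_abs_self _)
    · have := mul_sub_le_Φ_sub hq' hq h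
      rw [abs_of_nonneg (sub_nonneg.2 h)]
      exact this.trans (le_abs_self _)
  have h2 := abs_edgeCorrection_sub_le h₁ h₃ hq hq'
  have h3 := mul_le_mul_of_nonneg_right hsmall (abs_nonneg (q - q'))
  have h4 := abs_sub_abs_le_abs_sub (Φ q - Φ q') (-(normalPDF q * (e₁ * q + e₃ * q ^ 3) -
    normalPDF q' * (e₁ * q' + e₃ * q' ^ 3)))
  rw [abs_neg] at h4
  rw [show edgeworthFun e₁ e₃ q - edgeworthFun e₁ e₃ q' = Φ q - Φ q' -
    -(normalPDF q * (e₁ * q + e₃ * q ^ 3) - normalPDF q' * (e₁ * q' + e₃ * q' ^ 3)) by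
      rw [edgeworthFun, edgeworthFun]; ring]
  linarith

/-- The quantiles of `Hᵢ(β̂, Â)` are bounded, attain their level up to `O(m^{-3/2})`, and depend on
the variance parameter only through terms of order `1 / m`, up to `O(m^{-3/2})`. -/
theorem exists_abs_quantile_sub_le {lo hi K a₀ a₁ t : ℝ} (h₀ : 0 < a₀) (hlo : 0 < lo)
    (hhi : 0 < a₁ + hi) (ht : 0 < t) (ht1 : t < 1) :
    ∃ (M C : ℝ) (m₀ : ℕ), 0 ≤ M ∧ 0 ≤ C ∧ ∀ s : Setting lo hi K, m₀ ≤ s.m → ∀ τ : ℝ, 0 ≤ τ →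
      ∀ a ∈ Set.Icc a₀ a₁, |s.d.quantile τ s.i t a| ≤ M ∧
        |cdf (s.d.lawHHat τ s.i a) (s.d.quantile τ s.i t a) - t| ≤ C * √(1 / s.m) ^ 3 ∧
        ∀ a' ∈ Set.Icc a₀ a₁, |s.d.quantile τ s.i t a - s.d.quantile τ s.i t a'| ≤
          C * (√(1 / s.m) ^ 3 + 1 / s.m * |a - a'|) := by
  obtain ⟨z, rfl⟩ := exists_Φ_eq ht ht1
  set M := |z| + 1 with hM
  have hM0 : 0 ≤ M := by positivity
  obtain ⟨C₁, hC₁0, hC₁⟩ := exists_abs_cdf_sub_edgeworth_le (lo := lo) (hi := hi) (K := K)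
    (a₁ := a₁) h₀ hlo hhi hM0
  obtain ⟨C₂, hC₂0, hC₂⟩ := exists_abs_edgeCoef_le (lo := lo) (hi := hi) (K := K) (a₁ := a₁)
    h₀ hlo hhi
  set c := normalPDF M with hc
  have hc0 : 0 < c := normalPDF_pos M
  set B := C₁ + C₂ * (M + M ^ 3) + C₂ * (1 + 4 * M ^ 2 + M ^ 4) with hB
  have hB0 : 0 ≤ B := by positivity
  -- For `m ≥ m₀` the corrections are negligible against the slope `c` of `Φ` near `z`.
  obtain ⟨m₀, hm₀⟩ := exists_nat_gt (B / (c / 2))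
  have hC0 : 0 ≤ 2 * C₁ + (c / 2)⁻¹ * (2 * C₁ + C₂ * (M + M ^ 3)) := by positivity
  refine ⟨M, 2 * C₁ + (c / 2)⁻¹ * (2 * C₁ + C₂ * (M + M ^ 3)), m₀, hM0, hC0,
    fun s hs τ hτ a ha => ?_⟩
  have hm : (0 : ℝ) < s.m := by exact_mod_cast s.m_pos
  have hσ1 : √(1 / (s.m : ℝ)) ^ 3 ≤ 1 / s.m := by
    have h1 := Real.sq_sqrt (show 0 ≤ 1 / (s.m : ℝ) by positivity)
    have h2 : √(1 / (s.m : ℝ)) ≤ 1 := by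
      rw [Real.sqrt_le_one, div_le_one hm]
      exact_mod_cast s.m_pos
    rw [pow_succ, h1]
    exact mul_le_of_le_one_right (by positivity) h2
  have hBm : B * (1 / s.m) < c / 2 := by
    rw [mul_one_div, div_lt_iff₀ hm, mul_comm, ← div_lt_iff₀ (by positivity)]
    exact hm₀.trans_le (by exact_mod_cast hs)
  have hε : C₁ * √(1 / (s.m : ℝ)) ^ 3 ≤ C₁ * (1 / s.m) := mul_le_mul_of_nonneg_left hσ1 hC₁0
  have n0 : 0 ≤ 1 / (s.m : ℝ) := by positivity
  have n1 : 0 ≤ C₁ * (1 / (s.m : ℝ)) := by positivity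
  have n2 : 0 ≤ C₂ * (1 / (s.m : ℝ)) * (M + M ^ 3) := by positivity
  have n3 : 0 ≤ C₂ * (1 / (s.m : ℝ)) * (1 + 4 * M ^ 2 + M ^ 4) := by positivity
  have hBe : B * (1 / s.m) = C₁ * (1 / (s.m : ℝ)) + C₂ * (1 / (s.m : ℝ)) * (M + M ^ 3) +
      C₂ * (1 / (s.m : ℝ)) * (1 + 4 * M ^ 2 + M ^ 4) := by rw [hB]; ring
  have key : ∀ b ∈ Set.Icc a₀ a₁, |s.d.quantile τ s.i (Φ z) b| ≤ M ∧
      |edgeworthFun (s.d.edgeCoef₁ s.i b) (s.d.edgeCoef₃ s.i b) (s.d.quantile τ s.i (Φ z) b) -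
        Φ z| ≤ C₁ * √(1 / (s.m : ℝ)) ^ 3 := fun b hb =>
    quantile_of_abs_cdf_sub_le _ hM ht ht1 (hC₂ s b hb).1 (hC₂ s b hb).2.1
      (hC₁ s τ hτ b hb) (by linarith)
  have hσ0 : 0 ≤ √(1 / (s.m : ℝ)) ^ 3 := by positivity
  refine ⟨(key a ha).1, ?_, fun a' ha' => ?_⟩
  · have h1 := hC₁ s τ hτ a ha _ (key a ha).1
    have h2 := (key a ha).2
    have h3 := abs_add_le (cdf (s.d.lawHHat τ s.i a) (s.d.quantile τ s.i (Φ z) a) -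
      s.d.edgeworth s.i a (s.d.quantile τ s.i (Φ z) a))
      (s.d.edgeworth s.i a (s.d.quantile τ s.i (Φ z) a) - Φ z)
    rw [sub_add_sub_cancel] at h3
    have h4 : 0 ≤ (c / 2)⁻¹ * (2 * C₁ + C₂ * (M + M ^ 3)) * √(1 / (s.m : ℝ)) ^ 3 := by positivity
    rw [add_mul]
    have h5 : |s.d.edgeworth s.i a (s.d.quantile τ s.i (Φ z) a) - Φ z| ≤
      C₁ * √(1 / (s.m : ℝ)) ^ 3 := h2
    linarith
  · set Q := s.d.quantile τ s.i (Φ z) a with hQ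
    set Q' := s.d.quantile τ s.i (Φ z) a' with hQ'
    obtain ⟨k1, k2⟩ := key a ha
    obtain ⟨k1', k2'⟩ := key a' ha'
    rw [← hQ] at k1 k2
    rw [← hQ'] at k1' k2'
    obtain ⟨l1, l3, l⟩ := hC₂ s a ha
    obtain ⟨l1', l3'⟩ := l a' ha'
    have h1 : c / 2 * |Q - Q'| ≤ |edgeworthFun (s.d.edgeCoef₁ s.i a) (s.d.edgeCoef₃ s.i a) Q -
        edgeworthFun (s.d.edgeCoef₁ s.i a) (s.d.edgeCoef₃ s.i a) Q'| :=
      abs_sub_le_of_edgeworthFun l1 l3 k1 k1' (by linarith)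
    have h2 : |edgeworthFun (s.d.edgeCoef₁ s.i a) (s.d.edgeCoef₃ s.i a) Q' -
        edgeworthFun (s.d.edgeCoef₁ s.i a') (s.d.edgeCoef₃ s.i a') Q'| ≤
        C₂ * (1 / s.m) * |a - a'| * (M + M ^ 3) := by
      refine le_trans (le_of_eq ?_) (abs_edgeCorrection_le l1' l3' k1')
      rw [edgeworthFun, edgeworthFun]
      congr 1
      ring
    have h3 := abs_sub_le (edgeworthFun (s.d.edgeCoef₁ s.i a) (s.d.edgeCoef₃ s.i a) Q) (Φ z)
      (edgeworthFun (s.d.edgeCoef₁ s.i a) (s.d.edgeCoef₃ s.i a) Q')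
    have h4 := abs_sub_le (Φ z) (edgeworthFun (s.d.edgeCoef₁ s.i a') (s.d.edgeCoef₃ s.i a') Q')
      (edgeworthFun (s.d.edgeCoef₁ s.i a) (s.d.edgeCoef₃ s.i a) Q')
    rw [abs_sub_comm (edgeworthFun (s.d.edgeCoef₁ s.i a') _ Q'),
      abs_sub_comm (Φ z) (edgeworthFun (s.d.edgeCoef₁ s.i a') _ Q')] at h4
    have h5 : c / 2 * |Q - Q'| ≤ 2 * C₁ * √(1 / (s.m : ℝ)) ^ 3 +
        C₂ * (M + M ^ 3) * (1 / s.m * |a - a'|) := by linarith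
    rw [← le_inv_mul_iff₀ (by positivity)] at h5
    refine h5.trans ?_
    have n4 : 0 ≤ 1 / (s.m : ℝ) * |a - a'| := by positivity
    rw [add_mul (2 * C₁), mul_assoc (c / 2)⁻¹]
    refine le_add_of_nonneg_of_le (by positivity) (mul_le_mul_of_nonneg_left ?_ (by positivity))
    have e : (2 * C₁ + C₂ * (M + M ^ 3)) * (√(1 / (s.m : ℝ)) ^ 3 + 1 / s.m * |a - a'|) =
        2 * C₁ * √(1 / (s.m : ℝ)) ^ 3 + C₂ * (M + M ^ 3) * (1 / s.m * |a - a'|) +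
          (C₂ * (M + M ^ 3) * √(1 / (s.m : ℝ)) ^ 3 + 2 * C₁ * (1 / s.m * |a - a'|)) := by ring
    rw [e]
    exact le_add_of_nonneg_right (by positivity)

/-! ### Coverage of the bootstrap interval -/

namespace Design

/-- In standard normal coordinates `(s, z)`, the value of `sᵢ` at which `θᵢ` equals the endpoint
`θ̂ᵢ + q √ĝ₁ᵢ`, with `q` the bootstrap `t`-quantile. -/
noncomputable def cutoff (d : Design m p) (τ : ℝ) (i : Fin m) (t a : ℝ) (z : Fin m → ℝ) : ℝ :=
  d.predErr τ i a z + d.quantile τ i t (d.AHat τ (d.noise a z)) * d.sdRatio τ i a z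

lemma quantile_mono (d : Design m p) (τ : ℝ) (i : Fin m) {t t' : ℝ} (ht : 0 < t)
    (htt : t ≤ t') (ht' : t' < 1) (a : ℝ) : d.quantile τ i t a ≤ d.quantile τ i t' a :=
  (sInf_cdf_le_iff _ ht (htt.trans_lt ht') _).2
    (htt.trans ((sInf_cdf_le_iff _ (ht.trans_le htt) ht' _).1 le_rfl))

lemma cutoff_mono (d : Design m p) (τ : ℝ) (i : Fin m) {t t' : ℝ} (ht : 0 < t)
    (htt : t ≤ t') (ht' : t' < 1) (a : ℝ) (z : Fin m → ℝ) :
    d.cutoff τ i t a z ≤ d.cutoff τ i t' a z := by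
  have h1 := d.quantile_mono τ i ht htt ht' (d.AHat τ (d.noise a z))
  have h2 : 0 ≤ d.sdRatio τ i a z := by
    unfold sdRatio
    positivity
  unfold cutoff
  gcongr

namespace Regular

variable {d : Design m p} {lo hi K : ℝ}

lemma measurable_cutoff (h : d.Regular lo hi K) {τ : ℝ} (hτ : 0 ≤ τ) (i : Fin m) {t : ℝ}
    (ht : 0 < t) (ht1 : t < 1) (a : ℝ) : Measurable (d.cutoff τ i t a) :=
  (h.measurable_predErr hτ i a).add (((h.measurable_quantile hτ i ht ht1).comp
    ((d.measurable_AHat τ).comp (d.measurable_noise a))).mul (measurable_sdRatio d τ i a))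

variable {G : RandomEffectFamily k} {φHat : (Fin m → ℝ) → (Fin k → ℝ)}

lemma measurable_bootEndpoint (h : d.Regular lo hi K) {τ : ℝ} (hτ : 0 ≤ τ) (i : Fin m)
    (hG : ∀ a, 0 ≤ a → ∀ φ ∈ G.Θ, G.law a φ = gaussianReal 0 a.toNNReal)
    (hφ : ∀ y, φHat y ∈ G.Θ) {t : ℝ} (ht : 0 < t) (ht1 : t < 1) :
    Measurable (d.bootEndpoint G τ φHat i t) := by
  have h1 := h.measurable_eblup hτ i
  have h2 := (h.measurable_quantile hτ i ht ht1).comp (d.measurable_AHat τ)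
  have h3 := d.measurable_AHat τ
  have h4 : Measurable fun y => √(d.g1 (d.AHat τ y) i) := by
    unfold g1
    fun_prop
  have h5 : d.bootEndpoint G τ φHat i t = fun y => d.eblup τ i y +
      d.quantile τ i t (d.AHat τ y) * √(d.g1 (d.AHat τ y) i) := by
    ext y
    rw [bootEndpoint, h.bootQuantile_eq hτ i hG hφ]
  rw [h5]
  exact h1.add (h2.mul h4)

lemma simMap_sub_bootEndpoint (h : d.Regular lo hi K) {τ : ℝ} (hτ : 0 ≤ τ) (i : Fin m)
    (hG : ∀ a, 0 ≤ a → ∀ φ ∈ G.Θ, G.law a φ = gaussianReal 0 a.toNNReal)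
    (hφ : ∀ y, φHat y ∈ G.Θ) (β : Fin p → ℝ) (t : ℝ) {a : ℝ} (ha : 0 < a)
    (sz : (Fin m → ℝ) × (Fin m → ℝ)) :
    (d.X *ᵥ β + (d.simMap a sz).1) i -
      d.bootEndpoint G τ φHat i t (d.X *ᵥ β + (d.simMap a sz).2) =
        √(d.g1 a i) * (sz.1 i - d.cutoff τ i t a sz.2) := by
  have hg : √(d.g1 a i) ≠ 0 := (Real.sqrt_pos.2 (h.g1_pos ha i)).ne'
  rw [bootEndpoint, h.bootQuantile_eq hτ i hG hφ, h.AHat_shift, h.eblup_shift hτ, cutoff, predErr,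
    sdRatio, Pi.add_apply]
  simp only [simMap]
  field_simp
  ring

/-- Both the open and the closed interval with bootstrap endpoints have the same coverage, an
integral of normal probabilities. -/
lemma coverage_eq (h : d.Regular lo hi K) {τ : ℝ} (hτ : 0 ≤ τ) (i : Fin m)
    (hG : ∀ a, 0 ≤ a → ∀ φ ∈ G.Θ, G.law a φ = gaussianReal 0 a.toNNReal)
    (hφ : ∀ y, φHat y ∈ G.Θ) (β : Fin p → ℝ) {t t' : ℝ} (ht : 0 < t) (htt : t ≤ t')
    (ht' : t' < 1) {a : ℝ} (ha : 0 < a) {φ : Fin k → ℝ} (hφΘ : φ ∈ G.Θ) :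
    (d.modelLaw G β a φ).real {ω | ω.1 i ∈ Set.Ioo (d.bootEndpoint G τ φHat i t ω.2)
        (d.bootEndpoint G τ φHat i t' ω.2)} =
      ∫ z, Φ (d.cutoff τ i t' a z) ∂stdNormal m - ∫ z, Φ (d.cutoff τ i t a z) ∂stdNormal m ∧
    (d.modelLaw G β a φ).real {ω | d.bootEndpoint G τ φHat i t ω.2 ≤ ω.1 i ∧
        ω.1 i ≤ d.bootEndpoint G τ φHat i t' ω.2} =
      ∫ z, Φ (d.cutoff τ i t' a z) ∂stdNormal m - ∫ z, Φ (d.cutoff τ i t a z) ∂stdNormal m := by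
  have ht1 := htt.trans_lt ht'
  have ht0 := ht.trans_le htt
  have mL := h.measurable_bootEndpoint hτ i hG hφ ht ht1
  have mU := h.measurable_bootEndpoint hτ i hG hφ ht0 ht'
  have mω : Measurable fun ω : (Fin m → ℝ) × (Fin m → ℝ) => ω.1 i :=
    (measurable_pi_apply i).comp measurable_fst
  have mL' : Measurable fun ω : (Fin m → ℝ) × (Fin m → ℝ) =>
    d.bootEndpoint G τ φHat i t ω.2 := mL.comp measurable_snd
  have mU' : Measurable fun ω : (Fin m → ℝ) × (Fin m → ℝ) =>
    d.bootEndpoint G τ φHat i t' ω.2 := mU.comp measurable_snd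
  have sO : MeasurableSet {ω : (Fin m → ℝ) × (Fin m → ℝ) |
      ω.1 i ∈ Set.Ioo (d.bootEndpoint G τ φHat i t ω.2) (d.bootEndpoint G τ φHat i t' ω.2)} :=
    (measurableSet_lt mL' mω).inter (measurableSet_lt mω mU')
  have sC : MeasurableSet {ω : (Fin m → ℝ) × (Fin m → ℝ) |
      d.bootEndpoint G τ φHat i t ω.2 ≤ ω.1 i ∧ ω.1 i ≤ d.bootEndpoint G τ φHat i t' ω.2} :=
    (measurableSet_le mL' mω).inter (measurableSet_le mω mU')
  have cL := h.measurable_cutoff hτ i ht ht1 a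
  have cU := h.measurable_cutoff hτ i ht0 ht' a
  have hg : 0 < √(d.g1 a i) := Real.sqrt_pos.2 (h.g1_pos ha i)
  have key : ∀ t sz, (d.X *ᵥ β + (d.simMap a sz).1) i -
      d.bootEndpoint G τ φHat i t (d.X *ᵥ β + (d.simMap a sz).2) =
        √(d.g1 a i) * (sz.1 i - d.cutoff τ i t a sz.2) := fun t sz =>
    h.simMap_sub_bootEndpoint hτ i hG hφ β t ha sz
  have k1 : ∀ t sz, d.bootEndpoint G τ φHat i t (d.X *ᵥ β + (d.simMap a sz).2) <
      (d.X *ᵥ β + (d.simMap a sz).1) i ↔ d.cutoff τ i t a sz.2 < sz.1 i := fun t sz => by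
    rw [← _root_.sub_pos, key, mul_pos_iff_of_pos_left hg, _root_.sub_pos]
  have k2 : ∀ t sz, (d.X *ᵥ β + (d.simMap a sz).1) i <
      d.bootEndpoint G τ φHat i t (d.X *ᵥ β + (d.simMap a sz).2) ↔
        sz.1 i < d.cutoff τ i t a sz.2 := fun t sz => by
    rw [← _root_.sub_pos, ← neg_sub, key, ← mul_neg, mul_pos_iff_of_pos_left hg, neg_sub,
      _root_.sub_pos]
  set P := (stdNormal m).prod (stdNormal m) with hP
  have hdiff : P.real ({sz | sz.1 i ≤ d.cutoff τ i t' a sz.2} \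
      {sz | sz.1 i ≤ d.cutoff τ i t a sz.2}) =
      ∫ z, Φ (d.cutoff τ i t' a z) ∂stdNormal m - ∫ z, Φ (d.cutoff τ i t a z) ∂stdNormal m := by
    rw [measureReal_sdiff (fun sz hsz => ?_), hP, measureReal_le_eq_integral i cU,
      measureReal_le_eq_integral i cL]
    · exact measurableSet_le (by fun_prop) (by fun_prop)
    · have hsz : sz.1 i ≤ d.cutoff τ i t a sz.2 := hsz
      exact hsz.trans (d.cutoff_mono τ i ht htt ht' a sz.2)
  have nL : ∀ᵐ sz ∂P, sz.1 i ≠ d.cutoff τ i t a sz.2 := by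
    have := measure_eq_zero_graph i cL
    rw [ae_iff]
    simpa using this
  have nU : ∀ᵐ sz ∂P, sz.1 i ≠ d.cutoff τ i t' a sz.2 := by
    have := measure_eq_zero_graph i cU
    rw [ae_iff]
    simpa using this
  constructor
  · rw [measureReal_def, d.modelLaw_apply G β ha.le h.D_pos (hG a ha.le φ hφΘ) sO, ← hdiff,
      measureReal_def]
    congr 1
    refine measure_congr ?_
    filter_upwards [nU] with sz hU
    refine propext ?_
    change (_ < _ ∧ _ < _) ↔ (sz.1 i ≤ _ ∧ ¬ sz.1 i ≤ _)
    rw [k1, k2, not_le, and_comm, le_iff_lt_or_eq, or_iff_left hU]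
  · rw [measureReal_def, d.modelLaw_apply G β ha.le h.D_pos (hG a ha.le φ hφΘ) sC, ← hdiff,
      measureReal_def]
    congr 1
    refine measure_congr ?_
    filter_upwards [nL] with sz hL
    refine propext ?_
    change (_ ≤ _ ∧ _ ≤ _) ↔ (sz.1 i ≤ _ ∧ ¬ sz.1 i ≤ _)
    rw [← not_lt, k2, ← not_lt, k1, not_lt, not_lt, not_le, and_comm, le_iff_lt_or_eq (b := sz.1 i),
      or_iff_left hL.symm]

lemma sdRatio_le_two (h : d.Regular lo hi K) (τ : ℝ) (i : Fin m) {a : ℝ} (ha : 0 < a)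
    {z : Fin m → ℝ} (hV : |d.varErr a z| ≤ a / 2) : d.sdRatio τ i a z ≤ 2 := by
  obtain ⟨hV1, hV2⟩ := abs_le.1 hV
  have hD := h.D_pos i
  rw [sdRatio, d.AHat_noise_of_le τ ha hV, div_le_iff₀ (Real.sqrt_pos.2 (h.g1_pos ha i))]
  refine Real.sqrt_le_iff.2 ⟨by positivity, ?_⟩
  rw [mul_pow, Real.sq_sqrt (h.g1_pos ha i).le, g1, g1]
  generalize d.varErr a z = V at *
  generalize d.D i = D at *
  have h1 : 0 < a + V + D := by linarith
  have h2 : 0 < a + D := by linarith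
  rw [mul_div_assoc', div_le_div_iff₀ h1 h2]
  have h3 : (a + V) * (a + D) ≤ 4 * a * (a + V + D) := by nlinarith
  nlinarith [mul_le_mul_of_nonneg_left h3 hD.le]

end Regular

end Design

/-- The one-sided coverage of the bootstrap endpoint is correct up to `O(m^{-3/2})`, uniformly over
regular designs and areas. -/
theorem exists_abs_integral_cutoff_sub_le {lo hi K A t : ℝ} (hA : 0 < A) (hlo : 0 < lo)
    (hhi : 0 < 2 * A + hi) (ht : 0 < t) (ht1 : t < 1) :
    ∃ (C : ℝ) (m₀ : ℕ), ∀ s : Setting lo hi K, m₀ ≤ s.m → ∀ τ : ℝ, 0 ≤ τ →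
      |∫ z, Φ (s.d.cutoff τ s.i t A z) ∂stdNormal s.m - t| ≤ C * √(1 / s.m) ^ 3 := by
  have h₀ : 0 < A / 2 := by positivity
  obtain ⟨M, C₁, m₀, hM0, hC₁0, hC₁⟩ := exists_abs_quantile_sub_le (K := K) h₀ hlo hhi ht ht1
  obtain ⟨C₂, hC₂0, hC₂⟩ := exists_real_lt_abs_varErr_le (K := K) h₀ hlo hhi
  have mV := (lipMoments_varErr (lo := lo) (hi := hi) (K := K) (a₁ := 2 * A) h₀).bdd
  obtain ⟨C₃, hC₃0, hC₃⟩ := mV.integral_abs_le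
  have hAI : A ∈ Set.Icc (A / 2) (2 * A) := ⟨by linarith, by linarith⟩
  refine ⟨2 * C₁ + 2 * C₁ * C₃ + C₂ + C₂ + C₁, m₀, fun s hs τ hτ => ?_⟩
  obtain ⟨-, hcdf, hq⟩ := hC₁ s hs τ hτ A hAI
  have hbad := hC₂ s A hAI
  have hcond := abs_cdf_sub_integral_le s hτ hA (s.d.quantile τ s.i t A)
  have hm : (0 : ℝ) < s.m := by exact_mod_cast s.m_pos
  have hσ : √(1 / (s.m : ℝ)) ^ 2 = 1 / s.m := Real.sq_sqrt (by positivity)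
  have hiV : Integrable (s.d.varErr A) (stdNormal s.m) := mV.integrable (s, ⟨A, hAI⟩)
  have hV1 : ∫ z, |s.d.varErr A z| ∂stdNormal s.m ≤ C₃ * √(1 / s.m) := hC₃ (s, ⟨A, hAI⟩)
  have hBm : MeasurableSet {z | A / 2 < |s.d.varErr A z|} := by
    have := s.d.measurable_varErr A
    exact measurableSet_lt measurable_const (by fun_prop)
  have hΦi : ∀ {f : (Fin s.m → ℝ) → ℝ}, Measurable f →
      Integrable (fun z => Φ (f z)) (stdNormal s.m) := fun {f} hf =>
    Integrable.of_bound (measurable_Φ.comp hf).aestronglyMeasurable 1 (ae_of_all _ fun z => by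
      rw [Real.norm_eq_abs, abs_of_nonneg (Φ_nonneg _)]
      exact Φ_le_one _)
  have i1 := hΦi (s.reg.measurable_cutoff hτ s.i ht ht1 A)
  have i2 : Integrable (fun z => Φ (s.d.predErr τ s.i A z +
      s.d.quantile τ s.i t A * s.d.sdRatio τ s.i A z)) (stdNormal s.m) :=
    hΦi ((s.reg.measurable_predErr hτ s.i A).add
    ((Design.Regular.measurable_sdRatio s.d τ s.i A).const_mul (s.d.quantile τ s.i t A)))
  have i3 : Integrable (fun z => 2 * C₁ * √(1 / (s.m : ℝ)) ^ 3 +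
      2 * C₁ * (1 / s.m) * |s.d.varErr A z|) (stdNormal s.m) :=
    (integrable_const _).add (hiV.abs.const_mul _)
  have i4 : Integrable ({z | A / 2 < |s.d.varErr A z|}.indicator fun _ => (1 : ℝ))
      (stdNormal s.m) := (integrable_const _).indicator hBm
  have hpt : ∀ z, |Φ (s.d.cutoff τ s.i t A z) - Φ (s.d.predErr τ s.i A z +
      s.d.quantile τ s.i t A * s.d.sdRatio τ s.i A z)| ≤
      (2 * C₁ * √(1 / (s.m : ℝ)) ^ 3 + 2 * C₁ * (1 / s.m) * |s.d.varErr A z|) +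
        {z | A / 2 < |s.d.varErr A z|}.indicator (fun _ => (1 : ℝ)) z := fun z => by
    by_cases hV : |s.d.varErr A z| ≤ A / 2
    · obtain ⟨hV1, hV2⟩ := abs_le.1 hV
      have hz : z ∉ {z | A / 2 < |s.d.varErr A z|} := fun h => absurd hV (not_le.2 h)
      have hsd0 : 0 ≤ s.d.sdRatio τ s.i A z := by unfold Design.sdRatio; positivity
      rw [Set.indicator_of_notMem hz, add_zero]
      refine (abs_Φ_sub_le _ _).trans ?_
      rw [Design.cutoff, add_sub_add_left_eq_sub, ← sub_mul, abs_mul, abs_of_nonneg hsd0,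
        s.d.AHat_noise_of_le τ hA hV, abs_sub_comm]
      have h1 := hq (A + s.d.varErr A z) ⟨by linarith, by linarith⟩
      rw [sub_add_cancel_left, abs_neg] at h1
      calc _ ≤ C₁ * (√(1 / (s.m : ℝ)) ^ 3 + 1 / s.m * |s.d.varErr A z|) * 2 :=
            mul_le_mul h1 (s.reg.sdRatio_le_two τ s.i hA hV) hsd0 (by positivity)
        _ = _ := by ring
    · have hz : z ∈ {z | A / 2 < |s.d.varErr A z|} := not_le.1 hV
      rw [Set.indicator_of_mem hz]
      refine le_add_of_nonneg_of_le (by positivity) (abs_le.2 ⟨?_, ?_⟩)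
      · linarith [Φ_nonneg (s.d.cutoff τ s.i t A z), Φ_le_one (s.d.predErr τ s.i A z +
          s.d.quantile τ s.i t A * s.d.sdRatio τ s.i A z)]
      · linarith [Φ_le_one (s.d.cutoff τ s.i t A z), Φ_nonneg (s.d.predErr τ s.i A z +
          s.d.quantile τ s.i t A * s.d.sdRatio τ s.i A z)]
  -- The quantile at `Â` may be replaced by the one at `A`.
  have hcut : |∫ z, Φ (s.d.cutoff τ s.i t A z) ∂stdNormal s.m - ∫ z, Φ (s.d.predErr τ s.i A z +
      s.d.quantile τ s.i t A * s.d.sdRatio τ s.i A z) ∂stdNormal s.m| ≤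
      (2 * C₁ + 2 * C₁ * C₃ + C₂) * √(1 / (s.m : ℝ)) ^ 3 := by
    rw [← integral_sub i1 i2]
    refine abs_integral_le_integral_abs.trans ((integral_mono (i1.sub i2).abs (i3.add i4)
      hpt).trans ?_)
    simp only [Pi.add_apply]
    rw [integral_add i3 i4, integral_indicator_const _ hBm, integral_add (integrable_const _)
      (hiV.abs.const_mul _), integral_const_mul (2 * C₁ * (1 / s.m)), integral_const,
      probReal_univ, one_smul,
      smul_eq_mul, mul_one]
    have h1 : 2 * C₁ * (1 / s.m) * ∫ z, |s.d.varErr A z| ∂stdNormal s.m ≤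
        2 * C₁ * (1 / s.m) * (C₃ * √(1 / s.m)) :=
      mul_le_mul_of_nonneg_left hV1 (by positivity)
    have h2 : 2 * C₁ * (1 / s.m) * (C₃ * √(1 / (s.m : ℝ))) =
        2 * C₁ * C₃ * √(1 / (s.m : ℝ)) ^ 3 := by
      linear_combination -(2 * C₁ * C₃ * √(1 / (s.m : ℝ))) * hσ
    linarith
  have h1 := abs_sub_le (∫ z, Φ (s.d.cutoff τ s.i t A z) ∂stdNormal s.m)
    (∫ z, Φ (s.d.predErr τ s.i A z + s.d.quantile τ s.i t A * s.d.sdRatio τ s.i A z)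
      ∂stdNormal s.m) t
  have h2 := abs_sub_le (∫ z, Φ (s.d.predErr τ s.i A z + s.d.quantile τ s.i t A *
    s.d.sdRatio τ s.i A z) ∂stdNormal s.m)
    (cdf (s.d.lawHHat τ s.i A) (s.d.quantile τ s.i t A)) t
  rw [abs_sub_comm _ (cdf (s.d.lawHHat τ s.i A) (s.d.quantile τ s.i t A))] at h2
  linarith

end SmallArea

theorem theorem1
    {k : ℕ} (G : SmallArea.RandomEffectFamily k)
    -- known design: number of covariates, covariates, sampling variances
    (p : ℕ → ℕ) (X : ∀ m : ℕ, Matrix (Fin m) (Fin (p m)) ℝ) (D : ℕ → ℝ)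
    -- true parameters
    (β : ∀ m : ℕ, Fin (p m) → ℝ) (A : ℝ) (φ : Fin k → ℝ)
    -- truncation value of the variance estimator, and the estimator of the additional parameters
    (τ : ℕ → ℝ) (hτ : ∀ m, 0 ≤ τ m)
    (φHat : ∀ m : ℕ, (Fin m → ℝ) → (Fin k → ℝ))
    (hφHat_meas : ∀ m, Measurable (φHat m)) (hφHat_mem : ∀ m y, φHat m y ∈ G.Θ)
    -- the design for `m` areas
    (d : ∀ m : ℕ, SmallArea.Design m (p m))
    (hd : ∀ m, d m = { X := X m, D := fun i => D (i : ℕ) })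
    -- R1: `X` has full column rank `p`, which is bounded for large `m`
    (R1 : ∃ P : ℕ, ∀ᶠ m in atTop, (X m).rank = p m ∧ p m ≤ P)
    -- R2
    (R2_D : ∃ lo hi : ℝ, 0 < lo ∧ ∀ i, lo ≤ D i ∧ D i ≤ hi)
    (R2_A : 0 < A) (R2_φ : φ ∈ interior G.Θ)
    -- R3: the leverages are uniformly of order `1 / m`
    (R3 : ∃ K : ℝ, ∀ᶠ m in atTop, ∀ i : Fin m, (d m).leverage i ≤ K / (m : ℝ))
    -- R4: moments of the random effects
    (R4 : ∃ δ : ℝ, 0 < δ ∧ δ < 1 ∧ Integrable (fun u : ℝ => |u| ^ (8 + δ)) (G.law A φ))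
    -- R5: smoothness of the distribution function of `Hᵢ(β, A)`
    (R5 : ∀ (m : ℕ) (i : Fin m), ContDiff ℝ 3 ((d m).F2 G i (β m) A φ) ∧
      ∃ M : ℝ, ∀ x, |iteratedDeriv 3 ((d m).F2 G i (β m) A φ) x| ≤ M)
    (α : ℝ) (hα : 0 < α ∧ α < 1) :
    ∃ C : ℝ, ∀ᶠ m in atTop, ∀ i : Fin m, (d m).IsPivot G i →
      ((d m).modelLaw G (β m) A φ).real
          {ω | ω.1 i ∈ Set.Ioo ((d m).bootEndpoint G (τ m) (φHat m) i (α / 2) ω.2)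
            ((d m).bootEndpoint G (τ m) (φHat m) i (1 - α / 2) ω.2)} =
        ((d m).modelLaw G (β m) A φ).real
          {ω | (d m).bootEndpoint G (τ m) (φHat m) i (α / 2) ω.2 ≤ ω.1 i ∧
            ω.1 i ≤ (d m).bootEndpoint G (τ m) (φHat m) i (1 - α / 2) ω.2} ∧
      |((d m).modelLaw G (β m) A φ).real
          {ω | (d m).bootEndpoint G (τ m) (φHat m) i (α / 2) ω.2 ≤ ω.1 i ∧
            ω.1 i ≤ (d m).bootEndpoint G (τ m) (φHat m) i (1 - α / 2) ω.2} - (1 - α)|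
        ≤ C * (m : ℝ) ^ (-(3 / 2) : ℝ) := by
  by_cases hG : ∀ a, 0 ≤ a → ∀ φ ∈ G.Θ, G.law a φ = gaussianReal 0 a.toNNReal
  swap
  · -- Without normality of the random effects no `Hᵢ(β, A)` is a pivot.
    obtain ⟨lo, hi, hlo, hD⟩ := R2_D
    refine ⟨0, Eventually.of_forall fun m i hpiv => absurd ?_ hG⟩
    have hDi : 0 < (d m).D i := by
      rw [hd]
      exact hlo.trans_le (hD i).1
    exact fun a ha φ hφ => hpiv.law_eq_gaussianReal hDi ha hφ
  have hφ := interior_subset R2_φ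
  obtain ⟨P, hP⟩ := R1
  obtain ⟨lo, hi, hlo, hD⟩ := R2_D
  obtain ⟨K, hK⟩ := R3
  have hhi : 0 < 2 * A + hi := by linarith [(hD 0).1.trans (hD 0).2]
  obtain ⟨C₁, m₁, hC₁⟩ := SmallArea.exists_abs_integral_cutoff_sub_le (K := K) (t := α / 2) R2_A hlo
    hhi (by linarith) (by linarith)
  obtain ⟨C₂, m₂, hC₂⟩ := SmallArea.exists_abs_integral_cutoff_sub_le (K := K) (t := 1 - α / 2) R2_A
    hlo hhi (by linarith) (by linarith)
  refine ⟨C₁ + C₂, ?_⟩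
  filter_upwards [hP, hK, eventually_ge_atTop m₁, eventually_ge_atTop m₂,
    eventually_ge_atTop (2 * P), eventually_gt_atTop 0] with m hPm hKm hm₁ hm₂ h2P hm0 i _
  have hreg : (d m).Regular lo hi K :=
    { lo_pos := hlo
      m_pos := hm0
      injective := by
        rw [hd, Matrix.mulVec_injective_iff, linearIndependent_iff_card_eq_finrank_span,
          Set.finrank, ← Matrix.rank_eq_finrank_span_cols, hPm.1, Fintype.card_fin]
      two_mul_le := by omega
      lo_le := fun j => by rw [hd]; exact (hD j).1
      le_hi := fun j => by rw [hd]; exact (hD j).2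
      leverage_le := hKm }
  have h1 := hC₁ ⟨m, p m, d m, hreg, i⟩ hm₁ (τ m) (hτ m)
  have h2 := hC₂ ⟨m, p m, d m, hreg, i⟩ hm₂ (τ m) (hτ m)
  obtain ⟨hO, hC⟩ := hreg.coverage_eq (hτ m) i hG (hφHat_mem m) (β m) (t := α / 2)
    (t' := 1 - α / 2) (by linarith) (by linarith) (by linarith) R2_A hφ
  refine ⟨hO.trans hC.symm, ?_⟩
  have hpow : √(1 / (m : ℝ)) ^ 3 = (m : ℝ) ^ (-(3 / 2) : ℝ) := by
    have hm : (0 : ℝ) ≤ m := m.cast_nonneg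
    rw [one_div, Real.sqrt_eq_rpow, Real.inv_rpow hm, ← Real.rpow_neg hm, ← Real.rpow_natCast,
      ← Real.rpow_mul hm]
    norm_num
  simp only [hpow] at h1 h2
  rw [hC]
  rw [abs_le] at h1 h2 ⊢
  constructor <;> linarith [h1.1, h1.2, h2.1, h2.2]
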